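/- **Theorem 1.5 (Genus zero LG/General type Correspondence).** Let $w_1,\dots,w_N$ be positive integers with $\gcd(w_1,\dots,w_N)=1$, let $d$ be a positive integer with $w_j\mid d$ for all $j$, and let $W\in\mathbb C[x_1,\dots,x_N]$ be quasi-homogeneous of degree $d$ for these weights, with the origin as its only critical point. Assume $\kappa_{\mathcal X}:=d-\sum_j w_j>0$. Put $q_j=w_j/d$ and write $\langle x\rangle=x-\lfloor x\rfloor$. *FJRW side.* Let $\mathbf{Nar}$ be the set of $k\in\{0,\dots,d-1\}$ with $(k+1)w_j\notin d\mathbb Z$ for all $j$, i.e. such that $J^{k+1}$, where $J=(e^{2\pi i w_j/d})_j$, fixes only the origin of $\mathbb C^N$; let $H^{nar}_{FJRW}(W)=\bigoplus_{k\in\mathbf{Nar}}\mathbb C\phi_k$ and $$I^{small}_{FJRW}(t,z)=z\sum_{k\in\mathbf{Nar}}\sum_{l\ge0}\frac{t^{dl+k+1}}{z^{dl+k}(dl+k)!}\prod_{j=1}^N\frac{z^{\lfloor q_j(dl+k)\rfloor}\,\Gamma(q_j(dl+k+1))}{\Gamma(q_j+\langle q_jk\rangle)}\,\phi_k .$$ *Gromov–Witten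 side.* Let $\mathcal X_W=\{W=0\}\subset\mathbb P(w_1,\dots,w_N)$ and $F=\{k/w_j: 1\le j\le N,\ 0\le k<w_j\}$. For $f\in F$ let $\mathbb C^N_f$ be the fixed space of $(e^{2\pi i f w_j})_j$, $N_f$ its dimension, and $\mathbf 1_f$ the unit class of the corresponding sector $\{W|_{\mathbb C^N_f}=0\}$ of the inertia stack of $\mathcal X_W$, which has dimension $N_f-2$ (and is empty if $N_f=1$). Let $P$ be the hyperplane class. The ambient Chen–Ruan cohomology is $$H^{amb}_{CR}(\mathcal X_W;\mathbb C)=\bigoplus_{f\in F}\ \bigoplus_{r=0}^{N_f-2}\mathbb C\,P^r\mathbf 1_f,\qquad P^{N_f-1}\mathbf 1_f=0,$$ and the small Gromov–Witten $I$-function is the formal series $$I^{small}_{GW}(q,z)=z\,q^{P/z}\sum_{\substack{n\in\mathbb Q_{\ge0}\\ \exists j:\ nw_j\in\mathbb Z}}q^n\,\frac{\prod_{0<b\le nd,\ \langle b\rangle=\langle nd\rangle}(dP+bz)}{\prod_{j=1}^N\prod_{0<b\le nw_j,\ \langle b\rangle=\langle nw_j\rangle}(w_jP+bz)}\,\mathbf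 1_{\langle -n\rangle},$$ where for $q=t^{-d}$ one reads $q^n=t^{-dn}$ (here $dn\in\mathbb Z_{\ge 0}$) and $q^{P/z}=\exp(-d\log(t)\,P/z)$, with $\log$ the principal branch. *Claim.* The series $I^{small}_{FJRW}(t,-1)$ converges absolutely for every $t\in\mathbb C$, and there is a sector $D=\{t\ne0: a<\arg t<b\}$ with $-\pi\le a<b\le\pi$ for which there exists a unique linear map $$L_{FJRW}: H^{nar}_{FJRW}(W)\to H^{amb}_{CR}(\mathcal X_W;\mathbb C)$$ of rank equal to $\dim H^{amb}_{CR}(\mathcal X_W;\mathbb C)$ such that $$L_{FJRW}\cdot I^{small}_{FJRW}(t,-1)\ \sim\ I^{small}_{GW}(q=t^{-d},1)\qquad\text{as } t\to\infty \text{ from } D.$$ Here $\sim$ means: for every integer $m\ge0$, the difference between the left-hand side and the sum of the terms of the right-hand side with $dn\le m$ is $o(t^{-m})$ as $t\to\infty$, $t\in D$. -/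

import Mathlib

open scoped BigOperators Nat Topology

noncomputable section

namespace LGGeneralType

/-- The canonical bundle index `κ = d - ∑ w_j` of a degree `d` hypersurface in `ℙ(w_1, …, w_N)`. -/
def canonicalIndex {N : ℕ} (w : Fin N → ℕ) (d : ℕ) : ℤ := (d : ℤ) - ∑ j, (w j : ℤ)

/-- `W` is quasi-homogeneous of degree `d` for the weights `w`, and the origin is its unique
singular (critical) point. -/
structure IsNondegenerate {N : ℕ} (w : Fin N → ℕ) (d : ℕ) (W : MvPolynomial (Fin N) ℂ) :
    Prop where
  homogeneous : W.IsWeightedHomogeneous w d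
  singular_iff : ∀ x : Fin N → ℂ,
    (∀ i, MvPolynomial.eval x (MvPolynomial.pderiv i W) = 0) ↔ x = 0

/-- The root of unity `exp (2 π i f)`. -/
def rootOfUnity (f : ℚ) : ℂ := Complex.exp (2 * Real.pi * Complex.I * (f : ℂ))

/-- The fixed space in `ℂ^N` of the diagonal matrix `(lam ^ w_1, …, lam ^ w_N)`. -/
def fixedSpace {N : ℕ} (w : Fin N → ℕ) (lam : ℂ) : Submodule ℂ (Fin N → ℂ) where
  carrier := {x | ∀ j, lam ^ w j * x j = x j}
  add_mem' := by
    intro x y hx hy j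
    simp only [Pi.add_apply, mul_add, hx j, hy j]
  zero_mem' := by
    intro j
    simp
  smul_mem' := by
    intro c x hx j
    simp only [Pi.smul_apply, smul_eq_mul]
    rw [mul_left_comm, hx j]

/-! ### The narrow FJRW state space of `(W, ⟨J⟩)` -/

/-- The set `Nar` of the `k ∈ {0, …, d - 1}` whose sector, that of
`J ^ (k + 1) = (exp (2 π i w_j (k + 1) / d))_j`, is narrow: only the origin is fixed. -/
def Nar {N : ℕ} (w : Fin N → ℕ) (d : ℕ) : Type :=
  {k : Fin d // fixedSpace w (rootOfUnity (((k : ℕ) + 1 : ℚ) / d)) = ⊥}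

/-- The direct sum of the narrow sectors. The sector of `J ^ (k + 1)` is the cohomology of a point,
so it is `ℂ φ_k`, and a vector is the family of its coordinates with respect to the `φ_k`. -/
abbrev NarrowSpace {N : ℕ} (w : Fin N → ℕ) (d : ℕ) : Type := Nar w d → ℂ

/-- The charge `q_j = w_j / d`. -/
def charge {N : ℕ} (w : Fin N → ℕ) (d : ℕ) (j : Fin N) : ℚ := (w j : ℚ) / d

/-- The term with indices `k`, `l` of the small FJRW `I`-function:
`z * t^(dl+k+1) / (z^(dl+k) (dl+k)!) * ∏_j z^⌊q_j(dl+k)⌋ Γ(q_j(dl+k+1)) / Γ(q_j + ⟨q_j k⟩)`. -/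
def fjrwTerm {N : ℕ} (w : Fin N → ℕ) (d : ℕ) (t z : ℂ) (k l : ℕ) : ℂ :=
  z * (t ^ (d * l + k + 1) / (z ^ (d * l + k) * ((d * l + k)! : ℂ))) *
    ∏ j, (z ^ ⌊charge w d j * (d * l + k : ℕ)⌋₊ *
        Complex.Gamma ((charge w d j * (d * l + k + 1 : ℕ) : ℚ) : ℂ) /
      Complex.Gamma ((charge w d j + Int.fract (charge w d j * k) : ℚ) : ℂ))

/-- The small FJRW `I`-function, with values in the narrow state space. -/
def smallIFJRW {N : ℕ} (w : Fin N → ℕ) (d : ℕ) (t z : ℂ) : NarrowSpace w d :=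
  fun k => ∑' l : ℕ, fjrwTerm w d t z (k.1 : ℕ) l

/-! ### The ambient Chen–Ruan cohomology of `{W = 0} ⊂ ℙ(w)` -/

/-- The set `F = {k / w_j | 0 ≤ k < w_j}`, which indexes the sectors `exp (2 π i f)` of the inertia
stack with a nonzero fixed space. -/
def sectors {N : ℕ} (w : Fin N → ℕ) : Finset ℚ :=
  Finset.univ.biUnion fun j => (Finset.range (w j)).image fun k : ℕ => (k : ℚ) / (w j : ℚ)

open Classical in
/-- The number of nonzero powers of the hyperplane class `P` on the sector `f`, that is
`1 + dim {W_f = 0}`, where `W_f` is the restriction of `W` to the fixed space `ℂ^N_f` of dimension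
`N_f` and `{W_f = 0}` is taken in the weighted projective space of `ℂ^N_f`: it is `N_f` if
`W_f` vanishes identically and `N_f - 1` otherwise (for `N_f = 1` the sector is then empty). -/
def ambientLength {N : ℕ} (w : Fin N → ℕ) (W : MvPolynomial (Fin N) ℂ) (f : ℚ) : ℕ :=
  if ∀ x ∈ fixedSpace w (rootOfUnity f), MvPolynomial.eval x W = 0 then
    Module.finrank ℂ (fixedSpace w (rootOfUnity f))
  else Module.finrank ℂ (fixedSpace w (rootOfUnity f)) - 1

/-- The indices `(f, r)` of the basis `P ^ r 1_f` of the ambient cohomology. -/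
abbrev AmbientIndex {N : ℕ} (w : Fin N → ℕ) (W : MvPolynomial (Fin N) ℂ) : Type :=
  Σ f : {f : ℚ // f ∈ sectors w}, Fin (ambientLength w W f.1)

/-- The ambient cohomology `⨁_f ℂ[P] / (P ^ ambientLength f) 1_f`, a vector being given by its
coordinates with respect to the basis `P ^ r 1_f`. -/
abbrev AmbientSpace {N : ℕ} (w : Fin N → ℕ) (W : MvPolynomial (Fin N) ℂ) : Type :=
  AmbientIndex w W → ℂ

/-- The class `g(P) 1_f` for a power series `g` in the nilpotent class `P`;
it is `0` if `f` does not index a sector. -/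
def ambientClass {N : ℕ} (w : Fin N → ℕ) (W : MvPolynomial (Fin N) ℂ) (g : PowerSeries ℂ)
    (f : ℚ) : AmbientSpace w W :=
  fun p => if p.1.1 = f then PowerSeries.coeff (p.2 : ℕ) g else 0

/-- The product of `c P + b z` over the `b` with `0 < b ≤ x` and `⟨b⟩ = ⟨x⟩`, that is over
`b = x - i` with `i = 0, …, ⌈x⌉ - 1`, as a power series in `P`. -/
def hyperFactor (c : ℕ) (x : ℚ) (z : ℂ) : PowerSeries ℂ :=
  ∏ i ∈ Finset.range ⌈x⌉₊,
    ((c : ℂ) • PowerSeries.X + PowerSeries.C (((x - i : ℚ) : ℂ) * z))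

/-- The power series `exp (a P)` in `P`. -/
def expSeries (a : ℂ) : PowerSeries ℂ := PowerSeries.mk fun r => a ^ r / (r ! : ℂ)

/-- The term of index `n` of the small Gromov–Witten `I`-function, as a function of `log q`:
`z q^(P/z) q^n ∏_{0<b≤nd} (d P + b z) / ∏_j ∏_{0<b≤n w_j} (w_j P + b z) 1_⟨-n⟩`
with `⟨b⟩ = ⟨nd⟩`, respectively `⟨b⟩ = ⟨n w_j⟩`. It is `0` unless `n w_j` is an integer for
some `j`. -/
def gwTerm {N : ℕ} (w : Fin N → ℕ) (d : ℕ) (W : MvPolynomial (Fin N) ℂ) (logq z : ℂ) (n : ℚ) :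
    AmbientSpace w W :=
  ambientClass w W
    (PowerSeries.C (z * Complex.exp (n * logq)) * expSeries (logq / z) *
      hyperFactor d (n * d) z * (∏ j, hyperFactor (w j) (n * w j) z)⁻¹)
    (Int.fract (-n))

/-! ### Asymptotic expansions in sectors -/

/-- The open sector of the `t` with `a < arg t < b`. -/
def sector (a b : ℝ) : Set ℂ := {t | t ≠ 0 ∧ a < t.arg ∧ t.arg < b}

/-- The filter of `t → ∞` from the set `D`. -/
def atInftyFrom (D : Set ℂ) : Filter ℂ := Bornology.cobounded ℂ ⊓ Filter.principal D

/-- `G` has the formal series `∑ m, term m` as an asymptotic expansion along `l`, with respect to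
the asymptotic sequence `ψ`: the remainder after the term of index `m` is `o(ψ_m)`. -/
def HasAsymptoticExpansion {E : Type*} [NormedAddCommGroup E] (l : Filter ℂ) (ψ : ℕ → ℂ → ℂ)
    (G : ℂ → E) (term : ℕ → ℂ → E) : Prop :=
  (∀ m, ψ (m + 1) =o[l] ψ m) ∧
    ∀ m, (fun t => G t - ∑ i ∈ Finset.range (m + 1), term i t) =o[l] ψ m

end LGGeneralType

end

/-!
# The genus zero correspondence between FJRW theory and hypersurfaces of general type

Write `κ = d - ∑ⱼ wⱼ` and `qⱼ = wⱼ / d`. The `I`-function of the Landau–Ginzburg side is entire in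
`t`, that of the geometric side is a divergent series in `1 / t`. Both are sums of residues of the
same Mellin–Barnes integrand
`t ^ s * Γ(1 - s) / ∏ⱼ Γ(1 - qⱼ s) * (exp (2 π i (s + a + d P) / d) - 1)⁻¹`,
where `a` is a residue class modulo `d` and the hyperplane class `P` is replaced by a small complex
number.

*Existence.* The poles of `Γ(1 - s)` are the positive integers `s = M`. Their residues vanish if
`d ∣ M wⱼ` for some `j`, and otherwise are, by the reflection formula, the terms of the narrow FJRW
`I`-function times a factor depending only on `M` modulo `d`. The poles of the last factor are the
points of `-(a + d P) + d ℤ`. There the residues are, for `Re s ≤ 0`, the terms of the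
Gromov–Witten `I`-function supported on the sector `⟨-a / d⟩`, up to a factor depending on `P` and
`a` only (`gwFunction_mul_gammaWeight`); for `Re s > 0` they are of high order in `P`, and hence
disappear on the sector. Taking coefficients of powers of `P` by Cauchy integrals over a small
circle turns these functions into the coordinates of classes. On vertical lines the integrand decays
exponentially as long as `|arg t - π / d| < π κ / (2 d)`; moving the contour to the right recovers
the convergent FJRW series, and moving it to the left across `L` poles leaves an error
`O(|t| ^ (1 / 2 - d L))` (`exists_norm_coeff_sum_le`). This yields a linear map with the required
expansion (`hasAsymptoticExpansion_connectionMap`).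

*Rank.* The coordinate of the `m`-th Gromov–Witten term along `P ^ r` is `t ^ (-m)` times a
polynomial of degree exactly `r` in `log t`. So a linear form which vanishes on all these terms to
all orders is zero (`linearForm_eq_zero_of_isLittleO`), and every map with the required expansion is
surjective.

*Uniqueness.* The narrow FJRW series grows exponentially in most directions, while any map `L` with
the required expansion turns it into a function of polynomial growth. Up to phases its coefficients
are positive, so on the `κ` rays `arg t = θ` with `θ = (2 (i + 1) - κ) π / d` the terms of each
sector have the same argument. For a coordinate of `L` applied to the series, the Laplace transform
along a direction `ϑ` in the domain near `θ` is holomorphic on a half plane. It is also the sum of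
a power series with positive coefficients in each residue class, which diverges at a boundary point
seen by the half plane. An Abelian theorem shows that the leading coefficient of this singularity is
a linear expression in `L`, which has to vanish (`sum_mul_cexp_eq_zero`): this means that `L`
annihilates `κ` explicit vectors (`map_relationVector_eq_zero`). They are independent by a
Vandermonde determinant (`linearIndependent_relationVector`), and the narrow state space has
dimension `dim H^{amb} + κ` (`card_nar_eq`), so they span the kernel of `L`. The difference of two
such maps thus factors through the first of them, and it is zero because the Gromov–Witten terms
span (`eq_of_hasAsymptoticExpansion`).
-/

noncomputable section

namespace LGGeneralType

open Filter Set MeasureTheory Complex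

/-! ### A residue theorem for rectangles and strips -/

/-- The contour integral of `f` along the boundary of the rectangle `[x₁, x₂] × [y₁, y₂]`,
counterclockwise. -/
def rectIntegral (f : ℂ → ℂ) (x₁ x₂ y₁ y₂ : ℝ) : ℂ :=
  (∫ x : ℝ in x₁..x₂, f (x + y₁ * I)) - (∫ x : ℝ in x₁..x₂, f (x + y₂ * I)) +
    I * (∫ y : ℝ in y₁..y₂, f (x₂ + y * I)) - I * ∫ y : ℝ in y₁..y₂, f (x₁ + y * I)

lemma rectIntegral_eq_zero {f : ℂ → ℂ} {x₁ x₂ y₁ y₂ : ℝ}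
    (hf : DifferentiableOn ℂ f (uIcc x₁ x₂ ×ℂ uIcc y₁ y₂)) :
    rectIntegral f x₁ x₂ y₁ y₂ = 0 := by
  have := Complex.integral_boundary_rect_eq_zero_of_differentiableOn f (x₁ + y₁ * I)
    (x₂ + y₂ * I) (by simpa using hf)
  simpa [rectIntegral] using this

lemma intervalIntegrable_horizontal {f : ℂ → ℂ} {x₁ x₂ y : ℝ} {U : Set ℂ}
    (hf : ContinuousOn f U) (h : ∀ x ∈ uIcc x₁ x₂, ((x : ℂ) + y * I) ∈ U) :
    IntervalIntegrable (fun x : ℝ => f (x + y * I)) volume x₁ x₂ := by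
  apply ContinuousOn.intervalIntegrable
  exact hf.comp (by fun_prop) (fun x hx => h x hx)

lemma intervalIntegrable_vertical {f : ℂ → ℂ} {x y₁ y₂ : ℝ} {U : Set ℂ}
    (hf : ContinuousOn f U) (h : ∀ y ∈ uIcc y₁ y₂, ((x : ℂ) + y * I) ∈ U) :
    IntervalIntegrable (fun y : ℝ => f (x + y * I)) volume y₁ y₂ := by
  apply ContinuousOn.intervalIntegrable
  exact hf.comp (by fun_prop) (fun y hy => h y hy)

lemma integral_inv_horizontal {x₁ x₂ y : ℝ} (hy : y ≠ 0) :
    ∫ x : ℝ in x₁..x₂, ((x : ℂ) + y * I)⁻¹ = log (x₂ + y * I) - log (x₁ + y * I) := by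
  have hs : ∀ x : ℝ, ((x : ℂ) + y * I) ∈ slitPlane := fun x => by
    right; simpa using hy
  apply intervalIntegral.integral_eq_sub_of_hasDerivAt
  · intro x _
    have h1 : HasDerivAt (fun x : ℝ => (x : ℂ) + y * I) 1 x :=
      (ofRealCLM.hasDerivAt).add_const _
    simpa using h1.clog_real (hs x)
  · apply intervalIntegrable_horizontal (f := fun z => z⁻¹) (U := slitPlane)
    · exact continuousOn_inv₀.mono (fun z hz => slitPlane_ne_zero hz)
    · exact fun x _ => hs x

lemma integral_inv_vertical {x y₁ y₂ : ℝ} (hx : 0 < x) :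
    I * ∫ y : ℝ in y₁..y₂, ((x : ℂ) + y * I)⁻¹ = log (x + y₂ * I) - log (x + y₁ * I) := by
  have hs : ∀ y : ℝ, ((x : ℂ) + y * I) ∈ slitPlane := fun y => by
    left; simpa using hx
  rw [← intervalIntegral.integral_const_mul]
  apply intervalIntegral.integral_eq_sub_of_hasDerivAt
  · intro y _
    have h1 : HasDerivAt (fun y : ℝ => (x : ℂ) + y * I) (1 * I) y :=
      ((ofRealCLM.hasDerivAt).mul_const I).const_add _
    simpa [div_eq_mul_inv] using h1.clog_real (hs y)
  · apply IntervalIntegrable.const_mul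
    apply intervalIntegrable_vertical (f := fun z => z⁻¹) (U := slitPlane)
    · exact continuousOn_inv₀.mono (fun z hz => slitPlane_ne_zero hz)
    · exact fun x _ => hs x

lemma log_sub_log_neg_of_im_pos {z : ℂ} (hz : 0 < z.im) : log z - log (-z) = Real.pi * I := by
  simp only [log, norm_neg, arg_neg_eq_arg_sub_pi_of_im_pos hz]
  push_cast
  ring

lemma log_sub_log_neg_of_im_neg {z : ℂ} (hz : z.im < 0) : log z - log (-z) = -(Real.pi * I) := by
  simp only [log, norm_neg, arg_neg_eq_arg_add_pi_of_im_neg hz]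
  push_cast
  ring

/-- On the three sides of the rectangle other than the left one, the principal branch of `log` is a
primitive of `z⁻¹`; on the left side `log (-z)` is one. -/
lemma rectIntegral_inv {x₁ x₂ y₁ y₂ : ℝ} (hx₁ : x₁ < 0) (hx₂ : 0 < x₂) (hy₁ : y₁ < 0)
    (hy₂ : 0 < y₂) : rectIntegral (fun z => z⁻¹) x₁ x₂ y₁ y₂ = 2 * Real.pi * I := by
  have hleft : I * ∫ y : ℝ in y₁..y₂, ((x₁ : ℂ) + y * I)⁻¹ =
      log (-(x₁ + y₂ * I)) - log (-(x₁ + y₁ * I)) := by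
    have h := integral_inv_vertical (x := -x₁) (y₁ := -y₁) (y₂ := -y₂) (by linarith)
    rw [← intervalIntegral.integral_comp_neg, intervalIntegral.integral_symm] at h
    have e : ∀ y : ℝ, (((-x₁ : ℝ) : ℂ) + ((-y : ℝ) : ℂ) * I)⁻¹ = -((x₁ : ℂ) + y * I)⁻¹ := by
      intro y
      rw [← inv_neg]
      congr 1
      push_cast
      ring
    simp only [e, intervalIntegral.integral_neg] at h
    rw [intervalIntegral.integral_symm] at h
    simp only [neg_neg] at h
    rw [intervalIntegral.integral_symm] at h
    have e1 : ∀ y : ℝ, (((-x₁ : ℝ) : ℂ) + ((-y : ℝ) : ℂ) * I) = -((x₁ : ℂ) + y * I) := by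
      intro y
      push_cast
      ring
    rw [e1, e1] at h
    rw [← h, neg_neg]
  have h1 := log_sub_log_neg_of_im_pos (z := x₁ + y₂ * I) (by simpa using hy₂)
  have h2 := log_sub_log_neg_of_im_neg (z := x₁ + y₁ * I) (by simpa using hy₁)
  rw [rectIntegral, integral_inv_horizontal hy₁.ne, integral_inv_horizontal hy₂.ne',
    integral_inv_vertical hx₂, hleft]
  linear_combination h1 - h2

lemma rectIntegral_inv_sub {p : ℂ} {x₁ x₂ y₁ y₂ : ℝ} (hx₁ : x₁ < p.re) (hx₂ : p.re < x₂)
    (hy₁ : y₁ < p.im) (hy₂ : p.im < y₂) :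
    rectIntegral (fun z => (z - p)⁻¹) x₁ x₂ y₁ y₂ = 2 * Real.pi * I := by
  rw [← rectIntegral_inv (sub_neg.2 hx₁) (sub_pos.2 hx₂) (sub_neg.2 hy₁) (sub_pos.2 hy₂)]
  have e : ∀ x y : ℝ, (x : ℂ) + y * I - p = ((x - p.re : ℝ) : ℂ) + ((y - p.im : ℝ) : ℂ) * I := by
    intro x y
    conv_lhs => rw [← re_add_im p]
    push_cast
    ring
  simp only [rectIntegral, e]
  rw [intervalIntegral.integral_comp_sub_right
      (fun x : ℝ => ((x : ℂ) + ((y₁ - p.im : ℝ) : ℂ) * I)⁻¹) p.re,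
    intervalIntegral.integral_comp_sub_right
      (fun x : ℝ => ((x : ℂ) + ((y₂ - p.im : ℝ) : ℂ) * I)⁻¹) p.re,
    intervalIntegral.integral_comp_sub_right
      (fun y : ℝ => (((x₂ - p.re : ℝ) : ℂ) + (y : ℂ) * I)⁻¹) p.im,
    intervalIntegral.integral_comp_sub_right
      (fun y : ℝ => (((x₁ - p.re : ℝ) : ℂ) + (y : ℂ) * I)⁻¹) p.im]

lemma rectIntegral_congr {f g : ℂ → ℂ} {x₁ x₂ y₁ y₂ : ℝ}
    (h : ∀ z, (z.re = x₁ ∨ z.re = x₂ ∨ z.im = y₁ ∨ z.im = y₂) → f z = g z) :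
    rectIntegral f x₁ x₂ y₁ y₂ = rectIntegral g x₁ x₂ y₁ y₂ := by
  unfold rectIntegral
  congr 1
  · congr 1
    · congr 1
      · exact intervalIntegral.integral_congr fun x _ => h _ (by simp)
      · exact intervalIntegral.integral_congr fun x _ => h _ (by simp)
    · congr 1
      exact intervalIntegral.integral_congr fun x _ => h _ (by simp)
  · congr 1
    exact intervalIntegral.integral_congr fun x _ => h _ (by simp)

/-- The residue theorem for a rectangle and a function with at most simple poles inside it. -/
theorem rectIntegral_eq_sum_residues {x₁ x₂ y₁ y₂ : ℝ} (hx : x₁ ≤ x₂) (hy : y₁ ≤ y₂)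
    (res : ℂ → ℂ) (S : Finset ℂ) :
    ∀ f : ℂ → ℂ, (∀ p ∈ S, x₁ < p.re ∧ p.re < x₂ ∧ y₁ < p.im ∧ p.im < y₂) →
      DifferentiableOn ℂ f ((Icc x₁ x₂ ×ℂ Icc y₁ y₂) \ S) →
      (∀ p ∈ S, Tendsto (fun z => (z - p) * f z) (𝓝[≠] p) (𝓝 (res p))) →
      rectIntegral f x₁ x₂ y₁ y₂ = 2 * Real.pi * I * ∑ p ∈ S, res p := by
  classical
  induction S using Finset.induction_on with
  | empty =>
    intro f _ hf _
    simp only [Finset.coe_empty, sdiff_empty] at hf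
    rw [Finset.sum_empty, mul_zero]
    apply rectIntegral_eq_zero
    rwa [uIcc_of_le hx, uIcc_of_le hy]
  | insert p S hpS ih =>
    intro f hS hf hres
    obtain ⟨hp1, hp2, hp3, hp4⟩ := hS p (Finset.mem_insert_self p S)
    set R : Set ℂ := Icc x₁ x₂ ×ℂ Icc y₁ y₂ with hR
    set f₁ : ℂ → ℂ := fun z => f z - res p * (z - p)⁻¹ with hf₁
    have hnhds : R \ S ∈ 𝓝 p := by
      have h1 : R ∈ 𝓝 p := by
        have ho : IsOpen (Ioo x₁ x₂ ×ℂ Ioo y₁ y₂) := isOpen_Ioo.reProdIm isOpen_Ioo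
        refine mem_of_superset (ho.mem_nhds ⟨⟨hp1, hp2⟩, ⟨hp3, hp4⟩⟩) ?_
        rintro z ⟨h1, h2⟩
        exact ⟨Ioo_subset_Icc_self h1, Ioo_subset_Icc_self h2⟩
      have h2 : (S : Set ℂ)ᶜ ∈ 𝓝 p :=
        S.finite_toSet.isClosed.isOpen_compl.mem_nhds (by simpa using hpS)
      exact inter_mem h1 h2
    have hset : (R \ S) \ {p} = R \ (insert p S : Finset ℂ) := by
      ext z; simp only [Finset.coe_insert, Set.mem_sdiff, mem_insert_iff, mem_singleton_iff]; tauto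
    have hinv : ∀ z : ℂ, z ≠ p → DifferentiableAt ℂ (fun z => res p * (z - p)⁻¹) z := by
      intro z hz
      exact ((differentiableAt_id.sub_const p).inv (sub_ne_zero.2 hz)).const_mul _
    have hd₁ : DifferentiableOn ℂ f₁ ((R \ S) \ {p}) := by
      rw [hset]
      refine hf.sub fun z hz => (hinv z ?_).differentiableWithinAt
      rintro rfl
      simp at hz
    have hlim : Tendsto (fun z => (z - p) * (f₁ z - f₁ p)) (𝓝[≠] p) (𝓝 0) := by
      have h1 := hres p (Finset.mem_insert_self p S)
      have h2 : Tendsto (fun z : ℂ => (z - p) * f₁ p) (𝓝[≠] p) (𝓝 0) := by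
        have : Tendsto (fun z : ℂ => (z - p) * f₁ p) (𝓝 p) (𝓝 ((p - p) * f₁ p)) := by
          apply Continuous.tendsto; fun_prop
        simpa using this.mono_left nhdsWithin_le_nhds
      have h3 := (h1.sub_const (res p)).sub h2
      simp only [sub_self] at h3
      refine h3.congr' ?_
      filter_upwards [self_mem_nhdsWithin] with z hz
      have : z - p ≠ 0 := sub_ne_zero.2 hz
      simp only [hf₁]
      field_simp
    have hlittle : (fun z => f₁ z - f₁ p) =o[𝓝[≠] p] fun z => (z - p)⁻¹ := by
      rw [Asymptotics.isLittleO_iff_tendsto']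
      · simpa [div_eq_mul_inv, mul_comm] using hlim
      · filter_upwards [self_mem_nhdsWithin] with z hz h
        simp [sub_ne_zero.2 hz] at h
    have hg := differentiableOn_update_limUnder_of_isLittleO hnhds hd₁ hlittle
    set g := Function.update f₁ p (limUnder (𝓝[≠] p) f₁) with hgdef
    have hgf : ∀ z, z ≠ p → g z = f₁ z := fun z hz => Function.update_of_ne hz _ _
    have hI := ih g (fun q hq => hS q (Finset.mem_insert_of_mem hq)) hg (by
      intro q hq
      have hqp : q ≠ p := fun h => hpS (h ▸ hq)
      have h1 := hres q (Finset.mem_insert_of_mem hq)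
      have h2 : Tendsto (fun z : ℂ => (z - q) * (res p * (z - p)⁻¹)) (𝓝[≠] q) (𝓝 0) := by
        have : ContinuousAt (fun z : ℂ => (z - q) * (res p * (z - p)⁻¹)) q :=
          (continuousAt_id.sub continuousAt_const).mul (hinv q hqp).continuousAt
        have h := this.tendsto
        simp only [sub_self, zero_mul] at h
        exact h.mono_left nhdsWithin_le_nhds
      have h3 := h1.sub h2
      rw [sub_zero] at h3
      refine h3.congr' ?_
      have : ∀ᶠ z in 𝓝[≠] q, z ≠ p := (eventually_ne_nhds hqp).filter_mono nhdsWithin_le_nhds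
      filter_upwards [this] with z hz
      rw [hgf z hz]
      simp only [hf₁]
      ring)
    have hbd : rectIntegral g x₁ x₂ y₁ y₂ = rectIntegral f₁ x₁ x₂ y₁ y₂ := by
      apply rectIntegral_congr
      rintro z hz
      apply hgf
      rintro rfl
      rcases hz with h | h | h | h <;> linarith
    have hcf : ContinuousOn f (R \ (insert p S : Finset ℂ)) := hf.continuousOn
    have hci : ContinuousOn (fun z => res p * (z - p)⁻¹) (R \ (insert p S : Finset ℂ)) := by
      intro z hz
      refine (hinv z ?_).continuousAt.continuousWithinAt
      rintro rfl
      simp at hz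
    have hmem : ∀ z : ℂ, z ∈ R → (z.re = x₁ ∨ z.re = x₂ ∨ z.im = y₁ ∨ z.im = y₂) →
        z ∈ R \ (insert p S : Finset ℂ) := by
      intro z hz h
      refine ⟨hz, fun hzS => ?_⟩
      obtain ⟨h1, h2, h3, h4⟩ := hS z (by exact_mod_cast hzS)
      rcases h with h | h | h | h <;> linarith
    have hh : ∀ y : ℝ, y = y₁ ∨ y = y₂ → ∀ x ∈ uIcc x₁ x₂,
        ((x : ℂ) + y * I) ∈ R \ (insert p S : Finset ℂ) := by
      intro y hy' x hx'
      rw [uIcc_of_le hx] at hx'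
      apply hmem
      · refine ⟨by simpa using hx', ?_⟩
        rcases hy' with rfl | rfl <;> simp [hy]
      · rcases hy' with rfl | rfl <;> simp
    have hv : ∀ x : ℝ, x = x₁ ∨ x = x₂ → ∀ y ∈ uIcc y₁ y₂,
        ((x : ℂ) + y * I) ∈ R \ (insert p S : Finset ℂ) := by
      intro x hx' y hy'
      rw [uIcc_of_le hy] at hy'
      apply hmem
      · refine ⟨?_, by simpa using hy'⟩
        rcases hx' with rfl | rfl <;> simp [hx]
      · rcases hx' with rfl | rfl <;> simp
    have hsub : rectIntegral f₁ x₁ x₂ y₁ y₂ =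
        rectIntegral f x₁ x₂ y₁ y₂ - res p * rectIntegral (fun z => (z - p)⁻¹) x₁ x₂ y₁ y₂ := by
      have e1 := intervalIntegral.integral_sub
        (intervalIntegrable_horizontal hcf (hh y₁ (Or.inl rfl)))
        (intervalIntegrable_horizontal hci (hh y₁ (Or.inl rfl)))
      have e2 := intervalIntegral.integral_sub
        (intervalIntegrable_horizontal hcf (hh y₂ (Or.inr rfl)))
        (intervalIntegrable_horizontal hci (hh y₂ (Or.inr rfl)))
      have e3 := intervalIntegral.integral_sub
        (intervalIntegrable_vertical hcf (hv x₁ (Or.inl rfl)))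
        (intervalIntegrable_vertical hci (hv x₁ (Or.inl rfl)))
      have e4 := intervalIntegral.integral_sub
        (intervalIntegrable_vertical hcf (hv x₂ (Or.inr rfl)))
        (intervalIntegrable_vertical hci (hv x₂ (Or.inr rfl)))
      simp only [rectIntegral, hf₁, e1, e2, e3, e4, intervalIntegral.integral_const_mul]
      ring
    rw [Finset.sum_insert hpS, mul_add, ← hI, hbd, hsub, rectIntegral_inv_sub hp1 hp2 hp3 hp4]
    ring

/-- The residue theorem for a vertical strip: if `f` tends to zero at both ends of the strip, the
difference of its integrals over the two boundary lines is `2π` times the sum of its residues. -/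
theorem integral_sub_integral_eq_sum_residues {x₁ x₂ : ℝ} (hx : x₁ ≤ x₂) (res : ℂ → ℂ)
    (S : Finset ℂ) (f : ℂ → ℂ) (hS : ∀ p ∈ S, x₁ < p.re ∧ p.re < x₂)
    (hf : DifferentiableOn ℂ f ({z | z.re ∈ Icc x₁ x₂} \ S))
    (hres : ∀ p ∈ S, Tendsto (fun z => (z - p) * f z) (𝓝[≠] p) (𝓝 (res p)))
    (hi₁ : Integrable fun y : ℝ => f (x₁ + y * I))
    (hi₂ : Integrable fun y : ℝ => f (x₂ + y * I))
    (B : ℝ → ℝ) (hB : Tendsto B atTop (𝓝 0)) (Y : ℝ)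
    (hfB : ∀ x y : ℝ, x ∈ Icc x₁ x₂ → Y ≤ |y| → ‖f (x + y * I)‖ ≤ B |y|) :
    (∫ y : ℝ, f (x₂ + y * I)) - (∫ y : ℝ, f (x₁ + y * I)) =
      2 * Real.pi * ∑ p ∈ S, res p := by
  have hev : ∀ᶠ T : ℝ in atTop, ∀ p ∈ S, |p.im| < T := by
    rw [Filter.eventually_all_finset]
    exact fun p _ => eventually_gt_atTop _
  have h0 : ∀ s : ℝ, s = 1 ∨ s = -1 →
      Tendsto (fun T : ℝ => ∫ x : ℝ in x₁..x₂, f (x + (s * T : ℝ) * I)) atTop (𝓝 0) := by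
    intro s hs
    have hB' : Tendsto (fun T => B T * |x₂ - x₁|) atTop (𝓝 0) := by
      simpa using hB.mul_const (|x₂ - x₁|)
    refine squeeze_zero_norm' ?_ hB'
    filter_upwards [eventually_ge_atTop Y, eventually_ge_atTop 0] with T hT hT0
    apply intervalIntegral.norm_integral_le_of_norm_le_const
    intro x hx'
    have habs : |s * T| = T := by
      rcases hs with rfl | rfl <;> simp [abs_of_nonneg hT0]
    have := hfB x (s * T) (by
      rw [uIoc_of_le hx] at hx'; exact ⟨hx'.1.le, hx'.2⟩) (by rw [habs]; exact hT)
    rwa [habs] at this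
  have key : ∀ᶠ T : ℝ in atTop, rectIntegral f x₁ x₂ (-1 * T) (1 * T) =
      2 * Real.pi * I * ∑ p ∈ S, res p := by
    filter_upwards [hev, eventually_ge_atTop 0] with T hT hT0
    refine rectIntegral_eq_sum_residues hx (by linarith) res S f ?_ ?_ hres
    · intro p hp
      have := abs_lt.1 (hT p hp)
      exact ⟨(hS p hp).1, (hS p hp).2, by linarith, by linarith⟩
    · refine hf.mono ?_
      rintro z ⟨hz, hzS⟩
      exact ⟨hz.1, hzS⟩
  have htop : Tendsto (fun T : ℝ => 1 * T) atTop atTop := by simpa using! tendsto_id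
  have hbot : Tendsto (fun T : ℝ => -1 * T) atTop atBot := by
    simpa using tendsto_neg_atTop_atBot
  have h1 := intervalIntegral_tendsto_integral hi₁ hbot htop
  have h2 := intervalIntegral_tendsto_integral hi₂ hbot htop
  have h3 := ((((h0 (-1) (Or.inr rfl)).sub (h0 1 (Or.inl rfl))).add (h2.const_mul I)).sub
    (h1.const_mul I))
  have h4 := tendsto_nhds_unique (h3.congr' (f₂ := fun T : ℝ =>
    rectIntegral f x₁ x₂ (-1 * T) (1 * T)) (Eventually.of_forall fun T => rfl))
    (tendsto_const_nhds.congr' (key.mono fun T hT => hT.symm))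
  have hI := I_ne_zero
  apply mul_left_cancel₀ hI
  linear_combination h4

/-! ### Laplace integrals and bounds for the Gamma function on vertical lines -/

lemma norm_mul_cexp_neg_mul (a p : ℂ) (v : ℝ) :
    ‖a * cexp (-p * v)‖ = ‖a‖ * Real.exp (-(p.re * v)) := by
  rw [norm_mul, norm_exp]
  simp

lemma aestronglyMeasurable_of_integrable_laplace {Φ : ℝ → ℂ} {δ : ℝ}
    (h : IntegrableOn (fun v : ℝ => Φ v * cexp (-(δ : ℂ) * v)) (Ioi 0)) :
    AEStronglyMeasurable Φ (volume.restrict (Ioi 0)) := by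
  have h1 : AEStronglyMeasurable (fun v : ℝ => cexp ((δ : ℂ) * v)) (volume.restrict (Ioi 0)) :=
    Continuous.aestronglyMeasurable (by fun_prop)
  refine (h.aestronglyMeasurable.mul h1).congr (Eventually.of_forall fun v => ?_)
  simp only [Pi.mul_apply]
  rw [mul_assoc, ← Complex.exp_add]
  simp

lemma integrableOn_laplace {Φ : ℝ → ℂ}
    (h : ∀ δ : ℝ, 0 < δ → IntegrableOn (fun v : ℝ => Φ v * cexp (-(δ : ℂ) * v)) (Ioi 0))
    {p : ℂ} (hp : 0 < p.re) : IntegrableOn (fun v : ℝ => Φ v * cexp (-p * v)) (Ioi 0) := by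
  refine Integrable.mono (h p.re hp) ?_ (Eventually.of_forall fun v => ?_)
  · exact (aestronglyMeasurable_of_integrable_laplace (h 1 one_pos)).mul
      (Continuous.aestronglyMeasurable (by fun_prop))
  · rw [norm_mul_cexp_neg_mul, norm_mul_cexp_neg_mul, ofReal_re]

lemma differentiableOn_laplace {Φ : ℝ → ℂ}
    (h : ∀ δ : ℝ, 0 < δ → IntegrableOn (fun v : ℝ => Φ v * cexp (-(δ : ℂ) * v)) (Ioi 0)) :
    DifferentiableOn ℂ (fun p : ℂ => ∫ v in Ioi (0 : ℝ), Φ v * cexp (-p * v))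
      {p : ℂ | 0 < p.re} := by
  intro p₀ hp₀
  have hp₀' : 0 < p₀.re := hp₀
  have hm := aestronglyMeasurable_of_integrable_laplace (h 1 one_pos)
  set δ := p₀.re / 4 with hδ
  have hδ0 : 0 < δ := by positivity
  have key := hasDerivAt_integral_of_dominated_loc_of_deriv_le
    (μ := volume.restrict (Ioi (0 : ℝ))) (F := fun (p : ℂ) (v : ℝ) => Φ v * cexp (-p * v))
    (F' := fun (p : ℂ) (v : ℝ) => Φ v * (cexp (-p * v) * (-v)))
    (x₀ := p₀) (s := Metric.ball p₀ (2 * δ))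
    (bound := fun v => δ⁻¹ * ‖Φ v * cexp (-(δ : ℂ) * v)‖)
    (Metric.ball_mem_nhds p₀ (by positivity))
    (Eventually.of_forall fun p => hm.mul (Continuous.aestronglyMeasurable (by fun_prop)))
    (integrableOn_laplace h hp₀')
    (hm.mul (Continuous.aestronglyMeasurable (by fun_prop)))
    (by
      refine (ae_restrict_iff' measurableSet_Ioi).2 (Eventually.of_forall fun v hv p hp => ?_)
      have hv : 0 < v := hv
      have hre : 2 * δ ≤ p.re := by
        have h1 : |(p - p₀).re| ≤ ‖p - p₀‖ := abs_re_le_norm _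
        have h2 : ‖p - p₀‖ < 2 * δ := by rwa [← dist_eq_norm]
        have h3 := (abs_le.1 (h1.trans h2.le)).1
        rw [sub_re] at h3
        have : p₀.re = 4 * δ := by rw [hδ]; ring
        linarith
      rw [norm_mul_cexp_neg_mul, ← mul_assoc, norm_mul, norm_mul_cexp_neg_mul, ofReal_re]
      rw [norm_neg, norm_real, Real.norm_of_nonneg hv.le]
      have h1 : δ * v ≤ Real.exp (δ * v) := by
        linarith [Real.add_one_le_exp (δ * v)]
      have h2 : v ≤ δ⁻¹ * Real.exp (δ * v) := by
        rw [inv_mul_eq_div, le_div_iff₀ hδ0]; linarith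
      have h3 : Real.exp (-(p.re * v)) ≤ Real.exp (-(2 * δ * v)) :=
        Real.exp_le_exp.2 (by nlinarith)
      have h4 : Real.exp (-(2 * δ * v)) * Real.exp (δ * v) = Real.exp (-(δ * v)) := by
        rw [← Real.exp_add]; congr 1; ring
      calc ‖Φ v‖ * Real.exp (-(p.re * v)) * v
          ≤ ‖Φ v‖ * Real.exp (-(2 * δ * v)) * (δ⁻¹ * Real.exp (δ * v)) := by gcongr
        _ = δ⁻¹ * (‖Φ v‖ * (Real.exp (-(2 * δ * v)) * Real.exp (δ * v))) := by ring
        _ = δ⁻¹ * (‖Φ v‖ * Real.exp (-(δ * v))) := by rw [h4])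
    ((h δ hδ0).norm.const_mul _)
    (Eventually.of_forall fun v p _ => by
      have h1 : HasDerivAt (fun p : ℂ => -p * (v : ℂ)) (-1 * v) p :=
        ((hasDerivAt_id p).neg).mul_const _
      simpa using (h1.cexp).const_mul (Φ v))
  exact key.2.differentiableAt.differentiableWithinAt

lemma preconnected_re_pos : IsPreconnected {p : ℂ | 0 < p.re} :=
  (convex_halfSpace_re_gt 0).isPreconnected

lemma isOpen_re_pos : IsOpen {p : ℂ | 0 < p.re} := isOpen_lt continuous_const continuous_re

lemma integrableOn_cpow_mul_exp {a : ℂ} (ha : 0 < a.re) {δ : ℝ} (hδ : 0 < δ) :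
    IntegrableOn (fun v : ℝ => (v : ℂ) ^ (a - 1) * cexp (-(δ : ℂ) * v)) (Ioi 0) := by
  by_contra hcon
  have h1 := integral_cpow_mul_exp_neg_mul_Ioi ha hδ
  have h2 : ∫ v : ℝ in Ioi 0, (v : ℂ) ^ (a - 1) * cexp (-(δ : ℂ) * v) = 0 :=
    integral_undef hcon
  have h3 : ∀ v : ℝ, (-(δ : ℂ) * v) = -((δ : ℂ) * v) := fun v => by ring
  simp only [h3] at h2
  rw [h2] at h1
  have : (1 / (δ : ℂ)) ^ a ≠ 0 := by
    rw [Ne, cpow_eq_zero_iff]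
    have : (1 / (δ : ℂ)) ≠ 0 := one_div_ne_zero (ofReal_ne_zero.2 hδ.ne')
    tauto
  exact (mul_ne_zero this (Gamma_ne_zero_of_re_pos ha)) h1.symm

/-- Euler's integral with a complex scale parameter `p`, by analytic continuation in `p`. -/
lemma integral_cpow_mul_cexp_neg_mul {a p : ℂ} (ha : 0 < a.re) (hp : 0 < p.re) :
    ∫ v : ℝ in Ioi 0, (v : ℂ) ^ (a - 1) * cexp (-p * v) = p ^ (-a) * Gamma a := by
  have hslit : ∀ z : ℂ, 0 < z.re → z ∈ slitPlane := fun z hz => Or.inl hz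
  have h1 := (differentiableOn_laplace (fun δ hδ => integrableOn_cpow_mul_exp ha hδ)).analyticOnNhd
    isOpen_re_pos
  have h2 : AnalyticOnNhd ℂ (fun p : ℂ => p ^ (-a) * Gamma a) {p : ℂ | 0 < p.re} := by
    apply DifferentiableOn.analyticOnNhd _ isOpen_re_pos
    intro z hz
    exact ((differentiableAt_id.cpow_const (hslit z hz)).mul_const _).differentiableWithinAt
  have h3 := h1.eqOn_of_preconnected_of_frequently_eq h2 preconnected_re_pos
    (z₀ := 1) (by simp) ?_
  · exact h3 hp
  · have ht : Tendsto (fun x : ℝ => (x : ℂ)) (𝓝[>] 1) (𝓝[≠] 1) := by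
      refine tendsto_nhdsWithin_iff.2 ⟨?_, ?_⟩
      · exact (continuous_ofReal.tendsto' 1 1 (by simp)).mono_left nhdsWithin_le_nhds
      · filter_upwards [self_mem_nhdsWithin] with x hx
        have hx : 1 < x := hx
        simpa using! hx.ne'
    refine ht.frequently (Eventually.frequently ?_)
    filter_upwards [self_mem_nhdsWithin] with x hx
    have hx : 0 < x := one_pos.trans hx
    have := integral_cpow_mul_exp_neg_mul_Ioi ha hx
    have e : ∀ v : ℝ, (-(x : ℂ) * v) = -((x : ℂ) * v) := fun v => by ring
    simp only [e, this]
    congr 1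
    rw [one_div, inv_cpow _ _ (by rw [arg_ofReal_of_nonneg hx.le]; exact Real.pi_ne_zero.symm),
      cpow_neg]

/-- Rotating the ray in Euler's integral by the angle `θ` gives exponential decay of rate `θ`
of the Gamma function on vertical lines. -/
lemma norm_Gamma_le_of_re_pos {s : ℂ} (hs : 0 < s.re) {θ : ℝ} (h0 : 0 ≤ θ) (h1 : θ < Real.pi / 2) :
    ‖Gamma s‖ ≤ (Real.cos θ) ^ (-s.re) * Real.Gamma s.re * Real.exp (-θ * |s.im|) := by
  obtain ⟨σ, hσ, hσ'⟩ : ∃ σ : ℝ, (σ = θ ∨ σ = -θ) ∧ -σ * s.im = -θ * |s.im| := by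
    rcases abs_choice s.im with h | h
    · exact ⟨θ, Or.inl rfl, by rw [h]⟩
    · exact ⟨-θ, Or.inr rfl, by rw [h]; ring⟩
  have hcos : Real.cos σ = Real.cos θ := by rcases hσ with rfl | rfl <;> simp
  have hcpos : 0 < Real.cos θ := Real.cos_pos_of_mem_Ioo ⟨by linarith [Real.pi_pos], h1⟩
  have hlog : log (cexp (σ * I)) = σ * I := by
    apply log_exp
    · rw [mul_I_im, ofReal_re]; rcases hσ with rfl | rfl <;> linarith [Real.pi_pos]
    · rw [mul_I_im, ofReal_re]; rcases hσ with rfl | rfl <;> linarith [Real.pi_pos]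
  have hre : (cexp (σ * I)).re = Real.cos θ := by rw [exp_ofReal_mul_I_re, hcos]
  have hI := integral_cpow_mul_cexp_neg_mul (p := cexp (σ * I)) hs (by rw [hre]; exact hcpos)
  have hne : cexp (σ * I) ≠ 0 := exp_ne_zero _
  have hG : Gamma s = cexp (σ * I) ^ s *
      ∫ v : ℝ in Ioi 0, (v : ℂ) ^ (s - 1) * cexp (-cexp (σ * I) * v) := by
    rw [hI, ← mul_assoc, ← cpow_add _ _ hne]
    simp
  have hnorm : ‖cexp (σ * I) ^ s‖ = Real.exp (-θ * |s.im|) := by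
    rw [cpow_def_of_ne_zero hne, hlog, norm_exp, ← hσ']
    simp
  rw [hG, norm_mul, hnorm, mul_comm]
  gcongr
  refine (norm_integral_le_integral_norm _).trans ?_
  have hR := Real.integral_rpow_mul_exp_neg_mul_Ioi hs hcpos
  rw [Real.rpow_neg hcpos.le, ← Real.inv_rpow hcpos.le, ← one_div, ← hR]
  apply le_of_eq
  refine setIntegral_congr_fun measurableSet_Ioi fun v hv => ?_
  have hv : 0 < v := hv
  simp only [norm_mul_cexp_neg_mul, hre]
  rw [norm_cpow_eq_rpow_re_of_pos hv]
  simp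

/-- `Γ` in terms of its shift by `n` to the right. -/
lemma Gamma_add_nat (s : ℂ) (n : ℕ) (hs : ∀ i < n, s + i ≠ 0) :
    Gamma (s + n) = (∏ i ∈ Finset.range n, (s + i)) * Gamma s := by
  induction n with
  | zero => simp
  | succ n ih =>
    rw [Finset.prod_range_succ, Nat.cast_succ, ← add_assoc, Gamma_add_one _ (hs n n.lt_succ_self),
      ih fun i hi => hs i (hi.trans n.lt_succ_self)]
    ring

lemma exists_norm_Gamma_le (X : ℝ) {y₀ θ : ℝ} (hy₀ : 0 < y₀) (h0 : 0 ≤ θ)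
    (h1 : θ < Real.pi / 2) :
    ∃ C : ℝ, 0 < C ∧ ∀ s : ℂ, |s.re| ≤ X → y₀ ≤ |s.im| → ‖Gamma s‖ ≤ C * Real.exp (-θ * |s.im|) := by
  obtain ⟨n, hn⟩ := exists_nat_gt (X + 1)
  have hcpos : 0 < Real.cos θ := Real.cos_pos_of_mem_Ioo ⟨by linarith [Real.pi_pos], h1⟩
  have hcont : ContinuousOn (fun x : ℝ => (Real.cos θ) ^ (-x) * Real.Gamma x)
      (Icc 1 (n + X)) := by
    refine ContinuousOn.mul ?_ ?_
    · exact (Continuous.rpow continuous_const continuous_neg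
        (fun _ => Or.inl hcpos.ne')).continuousOn
    · intro x hx
      refine (Real.differentiableAt_Gamma fun m hm => ?_).continuousAt.continuousWithinAt
      have := hx.1
      rw [hm] at this
      linarith [(Nat.cast_nonneg m : (0 : ℝ) ≤ m)]
  obtain ⟨C, hC⟩ := isCompact_Icc.exists_bound_of_continuousOn hcont
  refine ⟨(|C| + 1) / y₀ ^ n, by positivity, fun s hs hy => ?_⟩
  have hne : ∀ i < n, s + (i : ℂ) ≠ 0 := by
    intro i _ h
    have := congrArg Complex.im h
    simp only [add_im, natCast_im, add_zero, zero_im] at this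
    rw [this, abs_zero] at hy
    linarith
  have hsre : -X ≤ s.re ∧ s.re ≤ X := abs_le.1 hs
  have hre : (s + n : ℂ).re = s.re + n := by simp
  have him : (s + n : ℂ).im = s.im := by simp
  have hG := norm_Gamma_le_of_re_pos (s := s + n) (by rw [hre]; linarith) h0 h1
  rw [him, hre, Gamma_add_nat s n hne, norm_mul] at hG
  have hprod : y₀ ^ n ≤ ‖∏ i ∈ Finset.range n, (s + (i : ℂ))‖ := by
    rw [norm_prod]
    calc y₀ ^ n = ∏ i ∈ Finset.range n, y₀ := by simp
      _ ≤ _ := Finset.prod_le_prod (fun _ _ => hy₀.le) fun i _ => by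
        have := abs_im_le_norm (s + (i : ℂ))
        simp only [add_im, natCast_im, add_zero] at this
        linarith
  have hC' := hC (s.re + n) ⟨by linarith, by linarith⟩
  have hC2 : (Real.cos θ) ^ (-(s.re + n)) * Real.Gamma (s.re + n) ≤ |C| + 1 :=
    (le_abs_self _).trans (hC'.trans ((le_abs_self C).trans (by linarith)))
  rw [div_mul_eq_mul_div, le_div_iff₀ (by positivity)]
  calc ‖Gamma s‖ * y₀ ^ n ≤ ‖Gamma s‖ * ‖∏ i ∈ Finset.range n, (s + (i : ℂ))‖ := by gcongr
    _ ≤ (Real.cos θ) ^ (-(s.re + n)) * Real.Gamma (s.re + n) * Real.exp (-θ * |s.im|) := by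
      rw [mul_comm]; exact hG
    _ ≤ (|C| + 1) * Real.exp (-θ * |s.im|) := by gcongr

lemma norm_sin_le (z : ℂ) : ‖sin z‖ ≤ Real.exp |z.im| := by
  have h1 : ‖cexp (-z * I)‖ ≤ Real.exp |z.im| := by
    rw [norm_exp]; apply Real.exp_le_exp.2; simp [le_abs_self]
  have h2 : ‖cexp (z * I)‖ ≤ Real.exp |z.im| := by
    rw [norm_exp]; apply Real.exp_le_exp.2; simp [neg_le_abs]
  rw [sin, norm_div, norm_mul, norm_I, mul_one]
  have h3 := norm_sub_le (cexp (-z * I)) (cexp (z * I))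
  have h4 : ‖(2 : ℂ)‖ = 2 := by simp
  rw [h4, div_le_iff₀ two_pos]
  linarith

lemma inv_Gamma_one_sub (s : ℂ) (hs : Gamma s ≠ 0) (hs' : sin (Real.pi * s) ≠ 0) :
    (Gamma (1 - s))⁻¹ = Gamma s * sin (Real.pi * s) / Real.pi := by
  have h := Gamma_mul_Gamma_one_sub s
  rw [eq_div_iff hs'] at h
  rw [inv_eq_iff_eq_inv, inv_div, eq_div_iff (mul_ne_zero hs hs')]
  linear_combination h

lemma sin_pi_mul_ne_zero_of_im_ne_zero {s : ℂ} (hs : s.im ≠ 0) : sin (Real.pi * s) ≠ 0 := by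
  intro h
  rw [sin_eq_zero_iff] at h
  obtain ⟨k, hk⟩ := h
  have hpi : (Real.pi : ℂ) ≠ 0 := ofReal_ne_zero.2 Real.pi_ne_zero
  have : s = k := by
    apply mul_left_cancel₀ hpi
    rw [hk]; ring
  rw [this] at hs
  simp at hs

lemma exists_norm_inv_Gamma_le (X : ℝ) {y₀ θ : ℝ} (hy₀ : 0 < y₀) (h0 : 0 ≤ θ)
    (h1 : θ < Real.pi / 2) :
    ∃ C : ℝ, 0 < C ∧ ∀ s : ℂ, |s.re| ≤ X → y₀ ≤ |s.im| →
      ‖(Gamma s)⁻¹‖ ≤ C * Real.exp ((Real.pi - θ) * |s.im|) := by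
  obtain ⟨C, hC0, hC⟩ := exists_norm_Gamma_le (X + 1) hy₀ h0 h1
  refine ⟨C, hC0, fun s hs hy => ?_⟩
  have him : (1 - s).im = -s.im := by simp
  have hsim : s.im ≠ 0 := by
    intro h; rw [h, abs_zero] at hy; linarith
  have hGne : Gamma (1 - s) ≠ 0 := by
    apply Gamma_ne_zero
    intro m h
    have := congrArg Complex.im h
    simp at this
    exact hsim this
  have e := inv_Gamma_one_sub (1 - s) hGne
    (sin_pi_mul_ne_zero_of_im_ne_zero (by rw [him]; exact neg_ne_zero.2 hsim))
  rw [sub_sub_cancel] at e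
  rw [e, norm_div, norm_mul]
  have hpi : (1 : ℝ) ≤ ‖(Real.pi : ℂ)‖ := by
    rw [norm_real, Real.norm_of_nonneg Real.pi_pos.le]; linarith [Real.pi_gt_three]
  have h2 := hC (1 - s) (by
      rw [sub_re, one_re]
      calc |1 - s.re| ≤ |(1 : ℝ)| + |s.re| := abs_sub _ _
        _ ≤ X + 1 := by rw [abs_one]; linarith) (by rwa [him, abs_neg])
  have h3 := norm_sin_le (Real.pi * (1 - s))
  have h4 : ((Real.pi : ℂ) * (1 - s)).im = -(Real.pi * s.im) := by
    rw [im_ofReal_mul, him]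
    ring
  rw [h4, abs_neg, abs_mul, abs_of_pos Real.pi_pos] at h3
  rw [him, abs_neg] at h2
  calc ‖Gamma (1 - s)‖ * ‖sin (Real.pi * (1 - s))‖ / ‖(Real.pi : ℂ)‖
      ≤ ‖Gamma (1 - s)‖ * ‖sin (Real.pi * (1 - s))‖ / 1 := by gcongr
    _ ≤ C * Real.exp (-θ * |s.im|) * Real.exp (Real.pi * |s.im|) := by
      rw [div_one]; gcongr
    _ = C * Real.exp ((Real.pi - θ) * |s.im|) := by
      rw [mul_assoc, ← Real.exp_add]; congr 2; ring

/-! ### The Mellin–Barnes integrand -/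

/-- The quotient `Γ(1 - s) / ∏ⱼ Γ(1 - qⱼ s)` with `qⱼ = wⱼ / d`. At `s = -d (n + P)` it is, up to a
factor which does not depend on the integral part of `n`, the coefficient of index `n` of the
Gromov–Witten `I`-function. -/
def gammaQuotient {N : ℕ} (w : Fin N → ℕ) (d : ℕ) (s : ℂ) : ℂ :=
  Gamma (1 - s) * ∏ j, (Gamma (1 - (w j : ℂ) / d * s))⁻¹

/-- The `d`-periodic kernel with simple poles at the points `s ∈ -(a + d P) + d ℤ`; it tends to `-1`
as `Im s → ∞` and decays like `exp (-2 π |Im s| / d)` as `Im s → -∞`. -/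
def periodicKernel (d a : ℕ) (P s : ℂ) : ℂ :=
  (cexp (2 * Real.pi * I * ((s + a + d * P) / d)) - 1)⁻¹

/-- The integrand `t ^ s Γ(1 - s) / ∏ⱼ Γ(1 - qⱼ s)`, multiplied by the periodic kernel. -/
def mellinIntegrand {N : ℕ} (w : Fin N → ℕ) (d a : ℕ) (P t s : ℂ) : ℂ :=
  cexp (s * log t) * gammaQuotient w d s * periodicKernel d a P s

/-- The opening sector: `π (2 - κ) / (2 d) < arg t < π (2 + κ) / (2 d)` with `κ = d - ∑ⱼ wⱼ`. -/
def goodSector {N : ℕ} (w : Fin N → ℕ) (d : ℕ) : Set ℂ :=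
  sector (Real.pi * (2 - (d - ∑ j, (w j : ℝ))) / (2 * d))
    (Real.pi * (2 + (d - ∑ j, (w j : ℝ))) / (2 * d))

section Bounds

variable {N : ℕ} {w : Fin N → ℕ} {d : ℕ}

lemma differentiableAt_gammaQuotient {s : ℂ} (hs : ∀ m : ℕ, s ≠ m + 1) :
    DifferentiableAt ℂ (gammaQuotient w d) s := by
  unfold gammaQuotient
  refine DifferentiableAt.mul ?_ ?_
  · refine (differentiableAt_Gamma (1 - s) fun m h => hs m ?_).comp s (by fun_prop)
    linear_combination -h
  · refine DifferentiableAt.fun_finsetProd fun j _ => ?_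
    exact (differentiable_one_div_Gamma (1 - (w j : ℂ) / d * s)).comp s
      (f := fun s => 1 - (w j : ℂ) / d * s) (by fun_prop)

lemma cexp_kernel_eq_one_iff (hd : 0 < d) {a : ℕ} {P s : ℂ} :
    cexp (2 * Real.pi * I * ((s + a + d * P) / d)) = 1 ↔ ∃ n : ℤ, s = d * n - a - d * P := by
  have hd' : (d : ℂ) ≠ 0 := Nat.cast_ne_zero.2 hd.ne'
  rw [exp_eq_one_iff]
  refine exists_congr fun n => ?_
  have hpi : (2 * Real.pi * I : ℂ) ≠ 0 := two_pi_I_ne_zero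
  rw [mul_comm (n : ℂ), mul_right_inj' hpi, div_eq_iff hd']
  constructor
  · intro h; linear_combination h
  · intro h; linear_combination h

lemma differentiableAt_periodicKernel (hd : 0 < d) {a : ℕ} {P s : ℂ}
    (h : ∀ n : ℤ, s ≠ d * n - a - d * P) : DifferentiableAt ℂ (periodicKernel d a P) s := by
  unfold periodicKernel
  refine DifferentiableAt.inv (by fun_prop) ?_
  rw [sub_ne_zero, Ne, cexp_kernel_eq_one_iff hd]
  push Not
  exact h

lemma periodicKernel_add_mul (hd : 0 < d) (a : ℕ) (P s : ℂ) (m : ℤ) :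
    periodicKernel d a P (s + d * m) = periodicKernel d a P s := by
  have hd' : (d : ℂ) ≠ 0 := Nat.cast_ne_zero.2 hd.ne'
  unfold periodicKernel
  have : 2 * Real.pi * I * ((s + d * m + a + d * P) / d) =
      2 * Real.pi * I * ((s + a + d * P) / d) + m * (2 * Real.pi * I) := by
    field_simp; ring
  rw [this, exp_periodic.int_mul m]

lemma norm_cexp_kernel (hd : 0 < d) (a : ℕ) (P s : ℂ) :
    ‖cexp (2 * Real.pi * I * ((s + a + d * P) / d))‖ =
      Real.exp (-(2 * Real.pi * (s.im / d + P.im))) := by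
  have hd' : (d : ℝ) ≠ 0 := Nat.cast_ne_zero.2 hd.ne'
  have e : 2 * Real.pi * I * ((s + a + d * P) / d) =
      ((2 * Real.pi : ℝ) : ℂ) * (((s + a + d * P) / (d : ℝ)) * I) := by push_cast; ring
  rw [norm_exp, e, re_ofReal_mul, mul_I_re, div_ofReal_im]
  congr 1
  have : (s + a + d * P).im = s.im + d * P.im := by simp
  rw [this]
  field_simp

lemma norm_periodicKernel_le_aux (hd : 0 < d) (a : ℕ) {P s : ℂ} (hP : d * ‖P‖ ≤ 1 / 4)
    (hs : (d : ℝ) ≤ |s.im|) :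
    ‖periodicKernel d a P s‖ ≤ 2 * Real.exp (2 * Real.pi) *
      min 1 (Real.exp (2 * Real.pi * s.im / d)) := by
  have hd' : (0 : ℝ) < d := Nat.cast_pos.2 hd
  have hd1 : (1 : ℝ) ≤ d := by exact_mod_cast hd
  have hpi := Real.pi_gt_three
  have hPim : |P.im| ≤ 1 / 4 := by
    have h1 := abs_im_le_norm P
    nlinarith [norm_nonneg P]
  obtain ⟨hP1, hP2⟩ := abs_le.1 hPim
  set v := cexp (2 * Real.pi * I * ((s + a + d * P) / d)) with hv
  have hnv := norm_cexp_kernel hd a P s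
  rw [← hv] at hnv
  have he2 : (2 : ℝ) ≤ Real.exp (3 / 2 * Real.pi) := by
    linarith [Real.add_one_le_exp (3 / 2 * Real.pi)]
  have hepi : (1 : ℝ) ≤ Real.exp (2 * Real.pi) := Real.one_le_exp (by positivity)
  unfold periodicKernel
  rw [← hv, norm_inv]
  rcases le_abs.1 hs with h | h
  · have hq : 1 ≤ s.im / d := by rwa [le_div_iff₀ hd', one_mul]
    have hv2 : ‖v‖ ≤ 1 / 2 := by
      rw [hnv, Real.exp_neg, one_div]
      apply inv_anti₀ two_pos
      refine he2.trans (Real.exp_le_exp.2 ?_)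
      nlinarith
    have h1 : 1 / 2 ≤ ‖v - 1‖ := by
      have := norm_sub_norm_le 1 v
      rw [norm_sub_rev v 1]
      rw [norm_one] at this
      linarith
    have hmin : min 1 (Real.exp (2 * Real.pi * s.im / d)) = 1 := by
      apply min_eq_left
      apply Real.one_le_exp
      rw [mul_div_assoc]
      positivity
    rw [hmin, mul_one]
    calc ‖v - 1‖⁻¹ ≤ (1 / 2)⁻¹ := inv_anti₀ (by norm_num) h1
      _ ≤ 2 * Real.exp (2 * Real.pi) := by rw [one_div, inv_inv]; linarith
  · have hq : s.im / d ≤ -1 := by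
      rw [div_le_iff₀ hd']; linarith
    have hv2 : 2 ≤ ‖v‖ := by
      rw [hnv]
      refine he2.trans (Real.exp_le_exp.2 ?_)
      nlinarith
    have h1 : ‖v‖ / 2 ≤ ‖v - 1‖ := by
      have := norm_sub_norm_le v 1
      rw [norm_one] at this
      linarith
    have hmin : min 1 (Real.exp (2 * Real.pi * s.im / d)) = Real.exp (2 * Real.pi * s.im / d) := by
      apply min_eq_right
      rw [Real.exp_le_one_iff, mul_div_assoc]
      nlinarith
    rw [hmin]
    calc ‖v - 1‖⁻¹ ≤ (‖v‖ / 2)⁻¹ := inv_anti₀ (by positivity) h1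
      _ = 2 * Real.exp (2 * Real.pi * (s.im / d + P.im)) := by
        rw [hnv, inv_div, div_eq_mul_inv, ← Real.exp_neg, neg_neg]
      _ ≤ 2 * (Real.exp (2 * Real.pi) * Real.exp (2 * Real.pi * s.im / d)) := by
        rw [← Real.exp_add]
        gcongr
        rw [mul_div_assoc]
        nlinarith
      _ = _ := by ring

/-- The vertical lines on which the integrals are taken contain no pole of the kernel. -/
lemma ne_pole_of_re_eq {a : ℕ} {P s : ℂ} (hP : d * ‖P‖ ≤ 1 / 4) {m : ℤ}
    (hs : s.re = 1 / 2 + d * m) (n : ℤ) : s ≠ d * n - a - d * P := by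
  rintro rfl
  have h1 : |d * P.re| ≤ 1 / 4 := by
    rw [abs_mul, abs_of_nonneg (Nat.cast_nonneg d)]
    exact (mul_le_mul_of_nonneg_left (abs_re_le_norm P) (Nat.cast_nonneg d)).trans hP
  obtain ⟨h2, h3⟩ := abs_le.1 h1
  simp only [sub_re, mul_re, natCast_re, intCast_re, natCast_im, zero_mul, sub_zero] at hs
  have h4 : ((d * n - a - d * m : ℤ) : ℝ) = 1 / 2 + d * P.re := by
    push_cast; linarith
  have h5 : (0 : ℝ) < ((d * n - a - d * m : ℤ) : ℝ) := by rw [h4]; linarith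
  have h6 : ((d * n - a - d * m : ℤ) : ℝ) < 1 := by rw [h4]; linarith
  have h7 : (0 : ℤ) < d * n - a - d * m := by exact_mod_cast h5
  have h8 : (d * n - a - d * m : ℤ) < 1 := by exact_mod_cast h6
  omega

lemma exists_norm_periodicKernel_le (hd : 0 < d) (a : ℕ) :
    ∃ C : ℝ, 0 < C ∧ ∀ P s : ℂ, d * ‖P‖ ≤ 1 / 4 →
      ((d : ℝ) ≤ |s.im| ∨ ∃ m : ℤ, s.re = 1 / 2 + d * m) →
      ‖periodicKernel d a P s‖ ≤ C * min 1 (Real.exp (2 * Real.pi * s.im / d)) := by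
  have hd' : (0 : ℝ) < d := Nat.cast_pos.2 hd
  have hcont : ContinuousOn (fun q : ℝ × ℂ => periodicKernel d a q.2 ((1 / 2 : ℝ) + q.1 * I))
      (Icc (-(d : ℝ)) d ×ˢ Metric.closedBall (0 : ℂ) (1 / (4 * d))) := by
    unfold periodicKernel
    refine ContinuousOn.inv₀ (by fun_prop) ?_
    rintro ⟨y, P⟩ ⟨_, hP⟩
    rw [sub_ne_zero, Ne, cexp_kernel_eq_one_iff hd]
    push Not
    refine ne_pole_of_re_eq (m := 0) ?_ (by simp)
    rw [mem_closedBall_zero_iff, le_div_iff₀ (by positivity)] at hP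
    simp only at hP ⊢
    linarith
  obtain ⟨C, hC⟩ := (isCompact_Icc.prod (isCompact_closedBall _ _)).exists_bound_of_continuousOn
    hcont
  refine ⟨2 * Real.exp (2 * Real.pi) + |C| * Real.exp (2 * Real.pi), by positivity, ?_⟩
  intro P s hP hs
  by_cases hy : (d : ℝ) ≤ |s.im|
  · refine (norm_periodicKernel_le_aux hd a hP hy).trans ?_
    gcongr
    have : 0 ≤ |C| * Real.exp (2 * Real.pi) := by positivity
    linarith
  · obtain ⟨m, hm⟩ := hs.resolve_left hy
    push Not at hy
    obtain ⟨hy1, hy2⟩ := abs_lt.1 hy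
    have hs' : s = ((1 / 2 : ℝ) + s.im * I) + d * m := by
      apply Complex.ext
      · rw [hm]; simp
      · simp
    have h1 := hC (s.im, P) ⟨⟨hy1.le, hy2.le⟩, by
      rw [mem_closedBall_zero_iff, le_div_iff₀ (by positivity)]; linarith⟩
    have h2 : Real.exp (-(2 * Real.pi)) ≤ min 1 (Real.exp (2 * Real.pi * s.im / d)) := by
      apply le_min
      · rw [Real.exp_le_one_iff]; linarith [Real.pi_pos]
      · apply Real.exp_le_exp.2
        rw [mul_div_assoc]
        have : -1 ≤ s.im / d := by rw [le_div_iff₀ hd']; linarith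
        nlinarith [Real.pi_pos]
    rw [hs', periodicKernel_add_mul hd, ← hs']
    calc ‖periodicKernel d a P ((1 / 2 : ℝ) + s.im * I)‖ ≤ |C| := h1.trans (le_abs_self C)
      _ = (|C| * Real.exp (2 * Real.pi)) * Real.exp (-(2 * Real.pi)) := by
        rw [mul_assoc, ← Real.exp_add]; simp
      _ ≤ (2 * Real.exp (2 * Real.pi) + |C| * Real.exp (2 * Real.pi)) *
          min 1 (Real.exp (2 * Real.pi * s.im / d)) := by
        gcongr
        have : 0 ≤ Real.exp (2 * Real.pi) := by positivity
        linarith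

/-- The decay rate `π (κ - 1) / (2 d)` of the Gamma quotient on vertical lines used below: the true
rate is `π κ / (2 d)`. -/
def decayRate {N : ℕ} (w : Fin N → ℕ) (d : ℕ) : ℝ :=
  Real.pi * ((d - ∑ j, (w j : ℝ)) - 1) / (2 * d)

/-- By Stirling-type bounds the numerator contributes the rate `π / 2` and each factor of the
denominator takes away `π qⱼ / 2`, up to an arbitrarily small loss. -/
lemma exists_norm_gammaQuotient_le (hw : ∀ j, 0 < w j) (hκ : ∑ j, w j < d) (X : ℝ) :
    ∃ C : ℝ, 0 < C ∧ ∀ s : ℂ, |s.re| ≤ X → 1 ≤ |s.im| →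
      ‖gammaQuotient w d s‖ ≤ C * Real.exp (-decayRate w d * |s.im|) := by
  have hd : 0 < d := by omega
  have hd' : (0 : ℝ) < d := Nat.cast_pos.2 hd
  have hd1 : (1 : ℝ) ≤ d := by exact_mod_cast hd
  have hpi := Real.pi_pos
  have hsum : ∑ j, (w j : ℝ) ≤ d := by exact_mod_cast hκ.le
  set δ : ℝ := Real.pi / (4 * d) with hδ
  have hδ0 : 0 < δ := by positivity
  have hδ1 : δ ≤ Real.pi / 4 := by
    rw [hδ]; gcongr; linarith
  set θ : ℝ := Real.pi / 2 - δ with hθ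
  obtain ⟨C₀, hC₀, h₀⟩ := exists_norm_Gamma_le (X + 1) (y₀ := 1) (θ := θ) one_pos
    (by linarith) (by linarith)
  have hq0 : ∀ j, (0 : ℝ) < (w j : ℝ) / d := fun j => div_pos (Nat.cast_pos.2 (hw j)) hd'
  have hq1 : ∀ j, (w j : ℝ) / d ≤ 1 := fun j => by
    rw [div_le_one hd']
    have : w j ≤ ∑ j, w j := Finset.single_le_sum (fun i _ => Nat.zero_le (w i)) (Finset.mem_univ j)
    exact_mod_cast this.trans hκ.le
  choose C hC h using fun j => exists_norm_inv_Gamma_le (X + 1) (y₀ := (w j : ℝ) / d) (θ := θ)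
    (hq0 j) (by linarith) (by linarith)
  refine ⟨C₀ * ∏ j, C j, mul_pos hC₀ (Finset.prod_pos fun j _ => hC j), fun s hs hy => ?_⟩
  have hX : 0 ≤ X := (abs_nonneg _).trans hs
  have e0 : ‖Gamma (1 - s)‖ ≤ C₀ * Real.exp (-θ * |s.im|) := by
    have := h₀ (1 - s) (by
      rw [sub_re, one_re]
      calc |1 - s.re| ≤ |(1 : ℝ)| + |s.re| := abs_sub _ _
        _ ≤ X + 1 := by rw [abs_one]; linarith) (by simpa using hy)
    simpa using this
  have ej : ∀ j, ‖(Gamma (1 - (w j : ℂ) / d * s))⁻¹‖ ≤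
      C j * Real.exp ((Real.pi - θ) * ((w j : ℝ) / d * |s.im|)) := by
    intro j
    have hre : (1 - (w j : ℂ) / d * s).re = 1 - (w j : ℝ) / d * s.re := by
      have : (w j : ℂ) / d = (((w j : ℝ) / d : ℝ) : ℂ) := by push_cast; rfl
      rw [this, sub_re, re_ofReal_mul, one_re]
    have him : |(1 - (w j : ℂ) / d * s).im| = (w j : ℝ) / d * |s.im| := by
      have : (w j : ℂ) / d = (((w j : ℝ) / d : ℝ) : ℂ) := by push_cast; rfl
      rw [this, sub_im, im_ofReal_mul, one_im, zero_sub, abs_neg, abs_mul, abs_of_pos (hq0 j)]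
    have := h j (1 - (w j : ℂ) / d * s) (by
      rw [hre]
      calc |1 - (w j : ℝ) / d * s.re| ≤ |(1 : ℝ)| + |(w j : ℝ) / d * s.re| := abs_sub _ _
        _ = 1 + (w j : ℝ) / d * |s.re| := by rw [abs_one, abs_mul, abs_of_pos (hq0 j)]
        _ ≤ 1 + 1 * X := by gcongr; exact hq1 j
        _ = X + 1 := by ring) (by
      rw [him]
      exact le_mul_of_one_le_right (hq0 j).le hy)
    rwa [him] at this
  unfold gammaQuotient
  rw [norm_mul, norm_prod]
  calc ‖Gamma (1 - s)‖ * ∏ j, ‖(Gamma (1 - (w j : ℂ) / d * s))⁻¹‖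
      ≤ (C₀ * Real.exp (-θ * |s.im|)) *
        ∏ j, (C j * Real.exp ((Real.pi - θ) * ((w j : ℝ) / d * |s.im|))) := by
        gcongr with j
        exact ej j
    _ = (C₀ * ∏ j, C j) * Real.exp (-θ * |s.im| +
        ∑ j, (Real.pi - θ) * ((w j : ℝ) / d * |s.im|)) := by
        rw [Finset.prod_mul_distrib, Real.exp_add, Real.exp_sum]; ring
    _ ≤ (C₀ * ∏ j, C j) * Real.exp (-decayRate w d * |s.im|) := by
        have hpos : 0 < C₀ * ∏ j, C j := mul_pos hC₀ (Finset.prod_pos fun j _ => hC j)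
        gcongr
        rw [← Finset.mul_sum, ← Finset.sum_mul, ← Finset.sum_div]
        unfold decayRate
        have e : -θ * |s.im| + (Real.pi - θ) * ((∑ j, (w j : ℝ)) / d * |s.im|) =
            (-θ + (Real.pi - θ) * ((∑ j, (w j : ℝ)) / d)) * |s.im| := by ring
        rw [e]
        gcongr
        rw [hθ, hδ, ← sub_nonneg]
        have e2 : -(Real.pi * ((d - ∑ j, (w j : ℝ)) - 1) / (2 * d)) -
            (-(Real.pi / 2 - Real.pi / (4 * d)) +
              (Real.pi - (Real.pi / 2 - Real.pi / (4 * d))) * ((∑ j, (w j : ℝ)) / d)) =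
            Real.pi / (4 * d) * (1 - (∑ j, (w j : ℝ)) / d) := by
          field_simp; ring
        rw [e2]
        have : (∑ j, (w j : ℝ)) / d ≤ 1 := by rwa [div_le_one hd']
        exact mul_nonneg hδ0.le (by linarith)

lemma ne_nat_add_one_of_re_eq {s : ℂ} {m : ℤ} (hs : s.re = 1 / 2 + d * m) (n : ℕ) :
    s ≠ n + 1 := by
  rintro rfl
  simp only [add_re, natCast_re, one_re] at hs
  have h1 : (2 : ℝ) * (n + 1) = 1 + 2 * (d * m) := by linarith
  have h2 : (2 : ℤ) * (n + 1) = 1 + 2 * (d * m) := by exact_mod_cast h1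
  omega

lemma exists_norm_gammaQuotient_le_line (hw : ∀ j, 0 < w j) (hκ : ∑ j, w j < d) (m : ℤ) :
    ∃ C : ℝ, 0 < C ∧ ∀ s : ℂ, s.re = 1 / 2 + d * m →
      ‖gammaQuotient w d s‖ ≤ C * Real.exp (-decayRate w d * |s.im|) := by
  obtain ⟨C, hC, h⟩ := exists_norm_gammaQuotient_le hw hκ |1 / 2 + d * (m : ℝ)|
  have hcont : ContinuousOn (fun y : ℝ => gammaQuotient w d (((1 / 2 + d * m : ℝ) : ℂ) + y * I))
      (Icc (-1) 1) := by
    intro y _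
    refine ContinuousAt.continuousWithinAt ?_
    refine (differentiableAt_gammaQuotient (w := w) (d := d) (ne_nat_add_one_of_re_eq (m := m)
      (d := d) ?_)).continuousAt.comp (f := fun y : ℝ => (((1 / 2 + d * m : ℝ) : ℂ) + y * I))
      (by fun_prop)
    simp
  obtain ⟨K, hK⟩ := isCompact_Icc.exists_bound_of_continuousOn hcont
  have hrate : 0 ≤ decayRate w d := by
    unfold decayRate
    have : (∑ j, (w j : ℝ)) + 1 ≤ d := by exact_mod_cast hκ
    have h2 : 0 ≤ (d - ∑ j, (w j : ℝ)) - 1 := by linarith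
    positivity
  refine ⟨C + |K| * Real.exp (decayRate w d), by positivity, fun s hs => ?_⟩
  rcases le_total 1 |s.im| with hy | hy
  · refine (h s (by rw [hs]) hy).trans ?_
    gcongr
    have : 0 ≤ |K| * Real.exp (decayRate w d) := by positivity
    linarith
  · have hs' : s = ((1 / 2 + d * m : ℝ) : ℂ) + s.im * I := by
      rw [← hs, re_add_im]
    have h1 := hK s.im (abs_le.1 hy)
    rw [← hs'] at h1
    calc ‖gammaQuotient w d s‖ ≤ |K| := h1.trans (le_abs_self _)
      _ = |K| * Real.exp (decayRate w d) * Real.exp (-decayRate w d) := by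
        rw [mul_assoc, ← Real.exp_add]; simp
      _ ≤ (C + |K| * Real.exp (decayRate w d)) * Real.exp (-decayRate w d * |s.im|) := by
        gcongr
        · linarith
        · nlinarith

lemma norm_le_norm_add_ofReal {s : ℂ} {r : ℝ} (hs : 0 ≤ s.re) (hr : 0 ≤ r) :
    ‖s‖ ≤ ‖s + r‖ := by
  apply le_of_sq_le_sq _ (norm_nonneg _)
  rw [Complex.sq_norm, Complex.sq_norm, normSq_apply, normSq_apply]
  simp only [add_re, ofReal_re, add_im, ofReal_im, add_zero]
  nlinarith [mul_nonneg hs hr]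

lemma inv_Gamma_eq_prod_mul (z : ℂ) (n : ℕ) :
    (Gamma z)⁻¹ = (∏ i ∈ Finset.range n, (z + i)) * (Gamma (z + n))⁻¹ := by
  induction n with
  | zero => simp
  | succ n ih =>
    rw [ih, one_div_Gamma_eq_self_mul_one_div_Gamma_add_one (z + n), Finset.prod_range_succ,
      Nat.cast_succ, add_assoc z (n : ℂ) 1]
    ring

/-- Shifting `s` by `d` multiplies the Gamma quotient by a rational function of degree `-κ`. -/
lemma norm_gammaQuotient_add_le (hκ : ∑ j, w j < d)
    {s : ℂ} (hs : 1 ≤ s.re) :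
    ‖gammaQuotient w d (s + d)‖ ≤ (1 + d) ^ d / s.re * ‖gammaQuotient w d s‖ := by
  have hd : 0 < d := by omega
  have hd' : (d : ℂ) ≠ 0 := Nat.cast_ne_zero.2 hd.ne'
  have hns : s.re ≤ ‖s‖ := (le_abs_self _).trans (abs_re_le_norm s)
  have hns1 : 1 ≤ ‖s‖ := hs.trans hns
  have h1 : Gamma (1 - s) = (∏ i ∈ Finset.range d, (1 - (s + d) + i)) * Gamma (1 - (s + d)) := by
    rw [← Gamma_add_nat]
    · congr 1; ring
    · intro i hi h
      have hle : i + 1 ≤ d := hi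
      apply_fun Complex.re at h
      simp only [add_re, sub_re, one_re, natCast_re, zero_re] at h
      have : (i : ℝ) + 1 ≤ d := by exact_mod_cast hle
      linarith
  have hprod : ‖s‖ ^ d ≤ ‖∏ i ∈ Finset.range d, (1 - (s + d) + (i : ℂ))‖ := by
    rw [norm_prod]
    calc ‖s‖ ^ d = ∏ i ∈ Finset.range d, ‖s‖ := by simp
      _ ≤ _ := Finset.prod_le_prod (fun _ _ => norm_nonneg s) fun i hi => ?_
    have hle : i + 1 ≤ d := Finset.mem_range.1 hi
    have hle' : (i : ℝ) + 1 ≤ d := by exact_mod_cast hle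
    have e : (1 - (s + d) + (i : ℂ)) = -(s + ((d - i - 1 : ℝ) : ℂ)) := by push_cast; ring
    rw [e, norm_neg]
    exact norm_le_norm_add_ofReal (by linarith) (by linarith)
  have h2 : ∀ j, ‖(Gamma (1 - (w j : ℂ) / d * (s + d)))⁻¹‖ ≤
      (‖s‖ + d) ^ w j * ‖(Gamma (1 - (w j : ℂ) / d * s))⁻¹‖ := by
    intro j
    have hwd : w j ≤ d :=
      (Finset.single_le_sum (fun i _ => Nat.zero_le (w i)) (Finset.mem_univ j)).trans hκ.le
    have hq1 : (w j : ℝ) / d ≤ 1 := by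
      rw [div_le_one (by exact_mod_cast hd)]; exact_mod_cast hwd
    rw [inv_Gamma_eq_prod_mul _ (w j), norm_mul]
    have e : 1 - (w j : ℂ) / d * (s + d) + w j = 1 - (w j : ℂ) / d * s := by
      field_simp; ring
    rw [e]
    gcongr
    rw [norm_prod]
    calc _ ≤ ∏ i ∈ Finset.range (w j), (‖s‖ + d) :=
          Finset.prod_le_prod (fun _ _ => norm_nonneg _) fun i hi => ?_
      _ = _ := by simp
    have hle : i + 1 ≤ w j := Finset.mem_range.1 hi
    have hle' : (i : ℝ) + 1 ≤ w j := by exact_mod_cast hle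
    have hwd' : (w j : ℝ) ≤ d := by exact_mod_cast hwd
    have e2 : 1 - (w j : ℂ) / d * (s + d) + i =
        -((((w j : ℝ) / d : ℝ) : ℂ) * s + (((w j : ℝ) - i - 1 : ℝ) : ℂ)) := by
      push_cast; field_simp; ring
    rw [e2, norm_neg]
    refine (norm_add_le _ _).trans (add_le_add ?_ ?_)
    · rw [norm_mul, norm_real, Real.norm_of_nonneg (by positivity)]
      exact mul_le_of_le_one_left (norm_nonneg s) hq1
    · rw [norm_real, Real.norm_of_nonneg (by linarith)]
      have : (0 : ℝ) ≤ i := Nat.cast_nonneg i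
      linarith
  have hP0 : 0 < ‖s‖ ^ d := by positivity
  have h3 : ‖Gamma (1 - (s + d))‖ ≤ ‖Gamma (1 - s)‖ / ‖s‖ ^ d := by
    rw [le_div_iff₀ hP0, h1, norm_mul, mul_comm]
    gcongr
  unfold gammaQuotient
  rw [norm_mul, norm_prod, norm_mul, norm_prod]
  calc ‖Gamma (1 - (s + d))‖ * ∏ j, ‖(Gamma (1 - (w j : ℂ) / d * (s + d)))⁻¹‖
      ≤ (‖Gamma (1 - s)‖ / ‖s‖ ^ d) *
          ∏ j, ((‖s‖ + d) ^ w j * ‖(Gamma (1 - (w j : ℂ) / d * s))⁻¹‖) := by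
        gcongr with j
        exact h2 j
    _ = (‖s‖ + d) ^ (∑ j, w j) / ‖s‖ ^ d *
          (‖Gamma (1 - s)‖ * ∏ j, ‖(Gamma (1 - (w j : ℂ) / d * s))⁻¹‖) := by
        rw [Finset.prod_mul_distrib, Finset.prod_pow_eq_pow_sum]; ring
    _ ≤ (1 + d) ^ d / s.re * _ := by
        gcongr ?_ * _
        rw [div_le_div_iff₀ hP0 (by linarith)]
        obtain ⟨k, hk⟩ : ∃ k, d = ∑ j, w j + (k + 1) := ⟨d - ∑ j, w j - 1, by omega⟩
        have hb : ‖s‖ + d ≤ (1 + d) * ‖s‖ := by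
          have : (0 : ℝ) ≤ d := Nat.cast_nonneg d
          nlinarith
        calc (‖s‖ + d) ^ (∑ j, w j) * s.re ≤ ((1 + d) * ‖s‖) ^ (∑ j, w j) * ‖s‖ := by gcongr
          _ = (1 + d) ^ (∑ j, w j) * ‖s‖ ^ (∑ j, w j + 1) := by
            rw [mul_pow, pow_succ]; ring
          _ ≤ (1 + d) ^ d * ‖s‖ ^ d := by
            have hd0 : (1 : ℝ) ≤ 1 + d := by simp
            have h5 := pow_le_pow_right₀ hd0 hκ.le
            have h6 := pow_le_pow_right₀ hns1 (Nat.succ_le_of_lt hκ)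
            gcongr

/-- Far to the right, the Gamma quotient decays faster than any geometric sequence. -/
lemma exists_norm_gammaQuotient_le_factorial (hw : ∀ j, 0 < w j) (hκ : ∑ j, w j < d) :
    ∃ C : ℝ, 0 < C ∧ ∀ (m : ℕ) (s : ℂ), s.re = 1 / 2 + d * (m + 1 : ℕ) →
      ‖gammaQuotient w d s‖ ≤
        C * (((1 + d) ^ d) ^ m / m !) * Real.exp (-decayRate w d * |s.im|) := by
  have hd1 : (1 : ℝ) ≤ d := by
    have : 1 ≤ d := by omega
    exact_mod_cast this
  obtain ⟨C, hC, h⟩ := exists_norm_gammaQuotient_le_line hw hκ 1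
  refine ⟨C, hC, fun m => ?_⟩
  induction m with
  | zero =>
    intro s hs
    simpa using h s (by simpa using hs)
  | succ m ih =>
    intro s hs
    have hs1 : (s - d).re = 1 / 2 + d * (m + 1 : ℕ) := by
      rw [sub_re, hs, natCast_re]; push_cast; ring
    have hre : (m : ℝ) + 1 ≤ (s - d).re := by
      rw [hs1]; push_cast
      have : (0 : ℝ) ≤ m := Nat.cast_nonneg m
      nlinarith
    have h1 := norm_gammaQuotient_add_le hκ (s := s - d)
      (le_trans (by linarith [(Nat.cast_nonneg m : (0 : ℝ) ≤ m)]) hre)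
    rw [sub_add_cancel] at h1
    have h2 := ih (s - d) hs1
    have him : (s - d).im = s.im := by simp
    rw [him] at h2
    calc _ ≤ _ := h1
      _ ≤ (1 + d) ^ d / (m + 1) *
          (C * (((1 + d) ^ d) ^ m / m !) * Real.exp (-decayRate w d * |s.im|)) := by gcongr
      _ = _ := by
        rw [Nat.factorial_succ]
        push_cast
        field_simp
        ring

end Bounds

section Integrand

variable {N : ℕ} {w : Fin N → ℕ} {d : ℕ}

lemma norm_cexp_mul_log {t : ℂ} (ht : t ≠ 0) (s : ℂ) :
    ‖cexp (s * log t)‖ = ‖t‖ ^ s.re * Real.exp (-(s.im * t.arg)) := by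
  rw [norm_exp, mul_re, log_re, log_im, sub_eq_add_neg, Real.exp_add,
    Real.rpow_def_of_pos (norm_pos_iff.2 ht)]
  ring_nf

/-- On the sector, `t ^ s` compensates the decay of the two other factors up to a rest of
`exp (-π |Im s| / (2 d))`, in both directions. -/
lemma norm_cexp_mul_le (hd : 0 < d) {t : ℂ} (ht : t ∈ goodSector w d) (s : ℂ) :
    ‖cexp (s * log t)‖ * (Real.exp (-decayRate w d * |s.im|) *
      min 1 (Real.exp (2 * Real.pi * s.im / d))) ≤
      ‖t‖ ^ s.re * Real.exp (-(Real.pi / (2 * d)) * |s.im|) := by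
  obtain ⟨ht0, ha, hb⟩ := ht
  have hd' : (0 : ℝ) < d := Nat.cast_pos.2 hd
  rw [norm_cexp_mul_log ht0, mul_assoc]
  gcongr
  set κ : ℝ := d - ∑ j, (w j : ℝ) with hκ
  rcases le_total 0 s.im with h | h
  · calc _ ≤ Real.exp (-(s.im * t.arg)) * (Real.exp (-decayRate w d * |s.im|) * 1) := by
          gcongr; exact min_le_left _ _
      _ ≤ _ := by
        rw [mul_one, ← Real.exp_add]
        apply Real.exp_le_exp.2
        rw [abs_of_nonneg h, decayRate, ← hκ]
        have e : -(Real.pi / (2 * d)) * s.im - (-(s.im * t.arg) +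
          -(Real.pi * (κ - 1) / (2 * d)) * s.im) =
          s.im * (t.arg - Real.pi * (2 - κ) / (2 * d)) := by
          field_simp; ring
        have : 0 ≤ s.im * (t.arg - Real.pi * (2 - κ) / (2 * d)) :=
          mul_nonneg h (by linarith)
        linarith
  · calc _ ≤ Real.exp (-(s.im * t.arg)) * (Real.exp (-decayRate w d * |s.im|) *
            Real.exp (2 * Real.pi * s.im / d)) := by
          gcongr; exact min_le_right _ _
      _ ≤ _ := by
        rw [← Real.exp_add, ← Real.exp_add]
        apply Real.exp_le_exp.2
        rw [abs_of_nonpos h, decayRate, ← hκ]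
        have e : -(Real.pi / (2 * d)) * -s.im - (-(s.im * t.arg) +
          (-(Real.pi * (κ - 1) / (2 * d)) * -s.im + 2 * Real.pi * s.im / d)) =
          -s.im * (Real.pi * (2 + κ) / (2 * d) - t.arg) := by
          field_simp; ring
        have : 0 ≤ -s.im * (Real.pi * (2 + κ) / (2 * d) - t.arg) :=
          mul_nonneg (by linarith) (by linarith)
        linarith

lemma norm_mellinIntegrand_le (hd : 0 < d) {a : ℕ} {P t s : ℂ} (ht : t ∈ goodSector w d)
    {C₁ C₂ : ℝ} (hC₁ : 0 < C₁) (hC₂ : 0 < C₂)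
    (h₁ : ‖gammaQuotient w d s‖ ≤ C₁ * Real.exp (-decayRate w d * |s.im|))
    (h₂ : ‖periodicKernel d a P s‖ ≤ C₂ * min 1 (Real.exp (2 * Real.pi * s.im / d))) :
    ‖mellinIntegrand w d a P t s‖ ≤
      C₁ * C₂ * ‖t‖ ^ s.re * Real.exp (-(Real.pi / (2 * d)) * |s.im|) := by
  have h := norm_cexp_mul_le hd ht s
  unfold mellinIntegrand
  rw [norm_mul, norm_mul]
  calc ‖cexp (s * log t)‖ * ‖gammaQuotient w d s‖ * ‖periodicKernel d a P s‖
      ≤ ‖cexp (s * log t)‖ * (C₁ * Real.exp (-decayRate w d * |s.im|)) *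
        (C₂ * min 1 (Real.exp (2 * Real.pi * s.im / d))) := by gcongr
    _ = C₁ * C₂ * (‖cexp (s * log t)‖ * (Real.exp (-decayRate w d * |s.im|) *
      min 1 (Real.exp (2 * Real.pi * s.im / d)))) := by ring
    _ ≤ C₁ * C₂ * (‖t‖ ^ s.re * Real.exp (-(Real.pi / (2 * d)) * |s.im|)) := by gcongr
    _ = _ := by ring

lemma differentiableAt_mellinIntegrand (hd : 0 < d) {a : ℕ} {P t s : ℂ}
    (h₁ : ∀ m : ℕ, s ≠ m + 1) (h₂ : ∀ n : ℤ, s ≠ d * n - a - d * P) :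
    DifferentiableAt ℂ (mellinIntegrand w d a P t) s := by
  unfold mellinIntegrand
  exact ((by fun_prop : DifferentiableAt ℂ (fun s => cexp (s * log t)) s).mul
    (differentiableAt_gammaQuotient h₁)).mul (differentiableAt_periodicKernel hd h₂)

lemma integrable_exp_neg_mul_abs {c : ℝ} (hc : 0 < c) :
    Integrable fun y : ℝ => Real.exp (-c * |y|) := by
  apply Integrable.of_integral_ne_zero
  rw [integral_comp_abs (f := fun y => Real.exp (-c * y)),
    integral_exp_mul_Ioi (by linarith : -c < 0)]
  simp [hc.ne']

lemma continuous_mellinIntegrand_line (hd : 0 < d) {a : ℕ} {P t : ℂ} (hP : d * ‖P‖ ≤ 1 / 4)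
    (m : ℤ) : Continuous fun y : ℝ =>
      mellinIntegrand w d a P t (((1 / 2 + d * m : ℝ) : ℂ) + y * I) := by
  rw [continuous_iff_continuousAt]
  intro y
  have hre : (((1 / 2 + d * m : ℝ) : ℂ) + y * I).re = 1 / 2 + d * m := by simp
  exact (differentiableAt_mellinIntegrand (w := w) hd (ne_nat_add_one_of_re_eq hre)
    (ne_pole_of_re_eq hP hre)).continuousAt.comp
      (f := fun y : ℝ => (((1 / 2 + d * m : ℝ) : ℂ) + y * I)) (by fun_prop)

lemma integrable_and_norm_integral_le (hd : 0 < d) {a : ℕ} {P t : ℂ} (hP : d * ‖P‖ ≤ 1 / 4)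
    (ht : t ∈ goodSector w d) {m : ℤ} {C₁ C₂ : ℝ} (hC₁ : 0 < C₁) (hC₂ : 0 < C₂)
    (h₁ : ∀ s : ℂ, s.re = 1 / 2 + d * m →
      ‖gammaQuotient w d s‖ ≤ C₁ * Real.exp (-decayRate w d * |s.im|))
    (h₂ : ∀ s : ℂ, s.re = 1 / 2 + d * m →
      ‖periodicKernel d a P s‖ ≤ C₂ * min 1 (Real.exp (2 * Real.pi * s.im / d))) :
    Integrable (fun y : ℝ => mellinIntegrand w d a P t (((1 / 2 + d * m : ℝ) : ℂ) + y * I)) ∧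
    ‖∫ y : ℝ, mellinIntegrand w d a P t (((1 / 2 + d * m : ℝ) : ℂ) + y * I)‖ ≤
      C₁ * C₂ * (∫ y : ℝ, Real.exp (-(Real.pi / (2 * d)) * |y|)) *
        ‖t‖ ^ (1 / 2 + d * m : ℝ) := by
  have hc : 0 < Real.pi / (2 * d) := by
    have : (0 : ℝ) < d := Nat.cast_pos.2 hd
    positivity
  have hb : ∀ y : ℝ, ‖mellinIntegrand w d a P t (((1 / 2 + d * m : ℝ) : ℂ) + y * I)‖ ≤
      C₁ * C₂ * ‖t‖ ^ (1 / 2 + d * m : ℝ) * Real.exp (-(Real.pi / (2 * d)) * |y|) := by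
    intro y
    have hre : (((1 / 2 + d * m : ℝ) : ℂ) + y * I).re = 1 / 2 + d * m := by simp
    have him : (((1 / 2 + d * m : ℝ) : ℂ) + y * I).im = y := by simp
    have := norm_mellinIntegrand_le hd ht hC₁ hC₂ (h₁ _ hre) (h₂ _ hre)
    rwa [hre, him] at this
  have hint := (integrable_exp_neg_mul_abs hc).const_mul (C₁ * C₂ * ‖t‖ ^ (1 / 2 + d * m : ℝ))
  refine ⟨hint.mono' (continuous_mellinIntegrand_line hd hP m).aestronglyMeasurable
    (Eventually.of_forall hb), ?_⟩
  refine (norm_integral_le_of_norm_le hint (Eventually.of_forall hb)).trans_eq ?_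
  rw [integral_const_mul]
  ring

end Integrand

/-! ### Residues of the Mellin–Barnes integrand -/

lemma tendsto_sub_mul_inv_of_hasDerivAt {h : ℂ → ℂ} {c p : ℂ} (hh : HasDerivAt h c p)
    (h0 : h p = 0) (hc : c ≠ 0) :
    Tendsto (fun s => (s - p) * (h s)⁻¹) (𝓝[≠] p) (𝓝 c⁻¹) := by
  have h1 := (hasDerivAt_iff_tendsto_slope.1 hh).inv₀ hc
  refine h1.congr fun s => ?_
  rw [slope_def_field, h0, sub_zero, inv_div, div_eq_mul_inv]

lemma tendsto_sub_mul_periodicKernel {d : ℕ} (hd : 0 < d) (a : ℕ) (P : ℂ) (n : ℤ) :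
    Tendsto (fun s => (s - (d * n - a - d * P)) * periodicKernel d a P s)
      (𝓝[≠] (d * n - a - d * P)) (𝓝 (d / (2 * Real.pi * I))) := by
  have hd' : (d : ℂ) ≠ 0 := Nat.cast_ne_zero.2 hd.ne'
  set p : ℂ := d * n - a - d * P with hp
  have h1 : cexp (2 * Real.pi * I * ((p + a + d * P) / d)) = 1 :=
    (cexp_kernel_eq_one_iff hd).2 ⟨n, hp⟩
  have h2 : HasDerivAt (fun s : ℂ => cexp (2 * Real.pi * I * ((s + a + d * P) / d)) - 1)
      (2 * Real.pi * I / d) p := by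
    have h3 : HasDerivAt (fun s : ℂ => 2 * Real.pi * I * ((s + a + d * P) / d))
        (2 * Real.pi * I * (1 / d)) p :=
      ((((hasDerivAt_id p).add_const _).add_const _).div_const _).const_mul _
    have h4 := h3.cexp.sub_const 1
    rw [h1, one_mul, mul_one_div] at h4
    exact h4
  have h5 := tendsto_sub_mul_inv_of_hasDerivAt h2 (by rw [h1, sub_self])
    (div_ne_zero two_pi_I_ne_zero hd')
  rw [inv_div] at h5
  exact h5

/-- The residue of `Γ(1 - s)` at `s = m + 1`. -/
lemma tendsto_sub_mul_Gamma_one_sub (m : ℕ) :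
    Tendsto (fun s : ℂ => (s - (m + 1)) * Gamma (1 - s)) (𝓝[≠] ((m : ℂ) + 1))
      (𝓝 ((-1) ^ (m + 1) / (m ! : ℂ))) := by
  set p : ℂ := (m : ℂ) + 1 with hp
  have hpi : (Real.pi : ℂ) ≠ 0 := ofReal_ne_zero.2 Real.pi_ne_zero
  have hs : sin (Real.pi * p) = 0 := by
    rw [hp, sin_eq_zero_iff]
    exact ⟨(m + 1 : ℕ), by push_cast; ring⟩
  have hcos : cos (Real.pi * p) = (-1) ^ (m + 1) := by
    rw [hp, mul_comm]
    have := congrArg (fun x : ℝ => (x : ℂ)) (Real.cos_nat_mul_pi (m + 1))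
    push_cast at this
    exact this
  have hcos0 : cos (Real.pi * p) ≠ 0 := by
    rw [hcos]; exact pow_ne_zero _ (by norm_num)
  have h1 : HasDerivAt (fun s : ℂ => sin (Real.pi * s)) (cos (Real.pi * p) * Real.pi) p := by
    have h3 : HasDerivAt (fun s : ℂ => (Real.pi : ℂ) * s) (Real.pi * 1) p :=
      (hasDerivAt_id p).const_mul _
    simpa using h3.csin
  have h2 := tendsto_sub_mul_inv_of_hasDerivAt h1 hs (mul_ne_zero hcos0 hpi)
  have hG : ContinuousAt (fun s : ℂ => (Gamma s)⁻¹) p :=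
    (differentiable_one_div_Gamma p).continuousAt
  have h3 := (h2.mul (hG.tendsto.mono_left nhdsWithin_le_nhds)).mul_const (Real.pi : ℂ)
  have hval : (cos (Real.pi * p) * Real.pi)⁻¹ * (Gamma p)⁻¹ * (Real.pi : ℂ) =
      (-1) ^ (m + 1) / (m ! : ℂ) := by
    rw [hcos, hp, Gamma_nat_eq_factorial]
    have hm : (m ! : ℂ) ≠ 0 := Nat.cast_ne_zero.2 m.factorial_ne_zero
    have hsq : ((-1 : ℂ) ^ (m + 1)) * (-1) ^ (m + 1) = 1 := by
      rw [← mul_pow]; norm_num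
    have hne : ((-1 : ℂ) ^ (m + 1)) ≠ 0 := pow_ne_zero _ (by norm_num)
    field_simp
    linear_combination -hsq
  rw [hval] at h3
  refine h3.congr' ?_
  have hre : ∀ᶠ s : ℂ in 𝓝[≠] p, 0 < s.re := by
    have hp0 : p ∈ {s : ℂ | 0 < s.re} := by
      rw [hp, mem_ofPred_eq, add_re, natCast_re, one_re]; positivity
    exact mem_nhdsWithin_of_mem_nhds (isOpen_re_pos.mem_nhds hp0)
  filter_upwards [hre] with s hs0
  have hΓ : Gamma s ≠ 0 := Gamma_ne_zero_of_re_pos hs0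
  have hrefl := Gamma_mul_Gamma_one_sub s
  have : Gamma (1 - s) = Real.pi * (sin (Real.pi * s))⁻¹ * (Gamma s)⁻¹ := by
    rw [eq_mul_inv_iff_mul_eq₀ hΓ, mul_comm, hrefl, div_eq_mul_inv]
  rw [this]
  ring

section Shift

variable {N : ℕ} (w : Fin N → ℕ) (d : ℕ)

/-- The function `t ^ s Γ(1 - s) / ∏ⱼ Γ(1 - qⱼ s)`, whose values at `s = -d (n + P)` are the terms
of the Gromov–Witten `I`-function. -/
def gwFunction (t s : ℂ) : ℂ := cexp (s * log t) * gammaQuotient w d s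

/-- The residue of the Mellin–Barnes integrand at the pole `s = m + 1` of `Γ(1 - s)`. -/
def narrowResidue (a : ℕ) (P t : ℂ) (m : ℕ) : ℂ :=
  cexp ((m + 1) * log t) * ((-1) ^ (m + 1) / (m ! : ℂ)) *
    (∏ j, (Gamma (1 - (w j : ℂ) / d * (m + 1)))⁻¹) * periodicKernel d a P (m + 1)

variable {w d}

lemma int_mul_sub_ne_nat {a : ℕ} {P : ℂ} (hP0 : P ≠ 0) (hd : 0 < d) (hP : d * ‖P‖ ≤ 1 / 4) (n : ℤ)
    (m : ℤ) : (d * n - a - d * P : ℂ) ≠ m := by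
  intro h
  have hd' : (d : ℂ) ≠ 0 := Nat.cast_ne_zero.2 hd.ne'
  have h1 : d * P = ((d * n - a - m : ℤ) : ℂ) := by push_cast; linear_combination -h
  have h2 : ‖d * P‖ ≤ 1 / 4 := by simpa using hP
  rw [h1, norm_intCast] at h2
  have h3 : |(d * n - a - m : ℤ)| < 1 := by
    have : (|(d * n - a - m : ℤ)| : ℝ) < 1 := by
      rw [← Int.cast_abs] at h2 ⊢
      linarith
    exact_mod_cast this
  rw [Int.abs_lt_one_iff] at h3
  rw [h3, Int.cast_zero] at h1
  exact (mul_ne_zero hd' hP0) h1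

lemma tendsto_sub_mul_mellinIntegrand_kernel (hd : 0 < d) {a : ℕ} {P : ℂ} (t : ℂ) (hP0 : P ≠ 0)
    (hP : d * ‖P‖ ≤ 1 / 4) (n : ℤ) :
    Tendsto (fun s => (s - (d * n - a - d * P)) * mellinIntegrand w d a P t s)
      (𝓝[≠] (d * n - a - d * P))
      (𝓝 (d / (2 * Real.pi * I) * gwFunction w d t (d * n - a - d * P))) := by
  set p : ℂ := d * n - a - d * P with hp
  have h1 := tendsto_sub_mul_periodicKernel hd a P n
  have h2 : ContinuousAt (gwFunction w d t) p := by
    refine DifferentiableAt.continuousAt (𝕜 := ℂ) ?_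
    refine (by fun_prop : DifferentiableAt ℂ (fun s => cexp (s * log t)) p).mul
      (differentiableAt_gammaQuotient fun m => ?_)
    have := int_mul_sub_ne_nat (a := a) hP0 hd hP n ((m + 1 : ℕ) : ℤ)
    push_cast at this
    exact this
  refine (h1.mul (h2.tendsto.mono_left nhdsWithin_le_nhds)).congr fun s => ?_
  unfold mellinIntegrand gwFunction
  ring

lemma tendsto_sub_mul_mellinIntegrand_nat (hd : 0 < d) {a : ℕ} {P : ℂ} (t : ℂ) (hP0 : P ≠ 0)
    (hP : d * ‖P‖ ≤ 1 / 4) (m : ℕ) :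
    Tendsto (fun s => (s - (m + 1)) * mellinIntegrand w d a P t s)
      (𝓝[≠] ((m : ℂ) + 1)) (𝓝 (narrowResidue w d a P t m)) := by
  set p : ℂ := (m : ℂ) + 1 with hp
  have h1 := tendsto_sub_mul_Gamma_one_sub m
  have h2 : ContinuousAt (fun s => cexp (s * log t) *
      (∏ j, (Gamma (1 - (w j : ℂ) / d * s))⁻¹) * periodicKernel d a P s) p := by
    refine DifferentiableAt.continuousAt (𝕜 := ℂ) ?_
    refine ((by fun_prop : DifferentiableAt ℂ (fun s => cexp (s * log t)) p).mul ?_).mul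
      (differentiableAt_periodicKernel hd fun n h => ?_)
    · refine DifferentiableAt.fun_finsetProd fun j _ => ?_
      exact (differentiable_one_div_Gamma (1 - (w j : ℂ) / d * p)).comp p
        (f := fun s => 1 - (w j : ℂ) / d * s) (by fun_prop)
    · have := int_mul_sub_ne_nat (a := a) hP0 hd hP n ((m + 1 : ℕ) : ℤ)
      push_cast at this
      exact this h.symm
  have h3 := h1.mul (h2.tendsto.mono_left nhdsWithin_le_nhds)
  have e : (-1) ^ (m + 1) / (m ! : ℂ) * (cexp (p * log t) *
      (∏ j, (Gamma (1 - (w j : ℂ) / d * p))⁻¹) * periodicKernel d a P p) =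
      narrowResidue w d a P t m := by
    unfold narrowResidue
    ring
  rw [e] at h3
  refine h3.congr fun s => ?_
  unfold mellinIntegrand gammaQuotient
  ring

/-- The integral of the Mellin–Barnes integrand along the line `Re s = 1 / 2 + d m`. -/
def lineIntegral (w : Fin N → ℕ) (d a : ℕ) (P t : ℂ) (m : ℤ) : ℂ :=
  ∫ y : ℝ, mellinIntegrand w d a P t (((1 / 2 + d * m : ℝ) : ℂ) + y * I)

lemma integrable_mellinIntegrand (hw : ∀ j, 0 < w j) (hκ : ∑ j, w j < d) (a : ℕ) {P t : ℂ}
    (hP : d * ‖P‖ ≤ 1 / 4) (ht : t ∈ goodSector w d) (m : ℤ) :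
    Integrable fun y : ℝ => mellinIntegrand w d a P t (((1 / 2 + d * m : ℝ) : ℂ) + y * I) := by
  have hd : 0 < d := by omega
  obtain ⟨C₁, hC₁, h₁⟩ := exists_norm_gammaQuotient_le_line hw hκ m
  obtain ⟨C₂, hC₂, h₂⟩ := exists_norm_periodicKernel_le hd a
  exact (integrable_and_norm_integral_le hd hP ht hC₁ hC₂ h₁
    fun s hs => h₂ P s hP (Or.inr ⟨m, hs⟩)).1

lemma exists_norm_mellinIntegrand_strip_le (hw : ∀ j, 0 < w j) (hκ : ∑ j, w j < d) (a : ℕ)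
    {P t : ℂ} (hP : d * ‖P‖ ≤ 1 / 4) (ht : t ∈ goodSector w d) (x₁ x₂ : ℝ) :
    ∃ C : ℝ, ∀ x y : ℝ, x ∈ Icc x₁ x₂ → (d : ℝ) ≤ |y| →
      ‖mellinIntegrand w d a P t (x + y * I)‖ ≤ C * Real.exp (-(Real.pi / (2 * d)) * |y|) := by
  have hd : 0 < d := by omega
  have hd1 : (1 : ℝ) ≤ d := by exact_mod_cast hd
  obtain ⟨C₁, hC₁, h₁⟩ := exists_norm_gammaQuotient_le hw hκ (max |x₁| |x₂|)
  obtain ⟨C₂, hC₂, h₂⟩ := exists_norm_periodicKernel_le hd a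
  have hcont : ContinuousOn (fun x : ℝ => ‖t‖ ^ x) (Icc x₁ x₂) :=
    (Continuous.rpow continuous_const continuous_id
      fun _ => Or.inl (norm_ne_zero_iff.2 ht.1)).continuousOn
  obtain ⟨K, hK⟩ := isCompact_Icc.exists_bound_of_continuousOn hcont
  refine ⟨C₁ * C₂ * K, fun x y hx hy => ?_⟩
  have hre : ((x : ℂ) + y * I).re = x := by simp
  have him : ((x : ℂ) + y * I).im = y := by simp
  have h3 := norm_mellinIntegrand_le (a := a) (P := P) hd ht hC₁ hC₂
    (h₁ ((x : ℂ) + y * I) (by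
      rw [hre]; exact abs_le_max_abs_abs hx.1 hx.2) (by rw [him]; linarith))
    (h₂ P ((x : ℂ) + y * I) hP (Or.inl (by rwa [him])))
  rw [hre, him] at h3
  refine h3.trans ?_
  have h4 := (le_abs_self _).trans (hK x hx)
  gcongr

/-- Shifting the contour from `Re s = 1 / 2 - d L` to `Re s = 1 / 2 + d L'`. -/
theorem sum_residues_eq (hw : ∀ j, 0 < w j) (hκ : ∑ j, w j < d) {a : ℕ} (ha : a < d) {P t : ℂ}
    (hP0 : P ≠ 0) (hP : d * ‖P‖ ≤ 1 / 4) (ht : t ∈ goodSector w d) (L L' : ℕ) :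
    (∑ l ∈ Finset.range L, gwFunction w d t (-(a + d * l : ℕ) - d * P)) +
      (∑ l ∈ Finset.range L', gwFunction w d t (d * (l + 1 : ℕ) - a - d * P)) +
      2 * Real.pi * I / d * ∑ m ∈ Finset.range (d * L'), narrowResidue w d a P t m =
    I / d * (lineIntegral w d a P t L' - lineIntegral w d a P t (-L)) := by
  classical
  have hd : 0 < d := by omega
  have hd' : (d : ℂ) ≠ 0 := Nat.cast_ne_zero.2 hd.ne'
  have hdr : (0 : ℝ) < d := Nat.cast_pos.2 hd
  set f : ℂ → ℂ := mellinIntegrand w d a P t with hf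
  set pole : ℤ → ℂ := fun n => d * n - a - d * P with hpole
  set nat : ℕ → ℂ := fun m => m + 1 with hnat
  have hpole_inj : Function.Injective pole := by
    intro n n' h
    simp only [hpole] at h
    have : (d : ℂ) * n = d * n' := by linear_combination h
    exact_mod_cast mul_left_cancel₀ hd' this
  have hnat_inj : Function.Injective nat := by
    intro m m' h
    simp only [hnat] at h
    exact_mod_cast add_right_cancel h
  have hne : ∀ n m, pole n ≠ nat m := by
    intro n m
    have := int_mul_sub_ne_nat (a := a) hP0 hd hP n ((m + 1 : ℕ) : ℤ)
    push_cast at this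
    exact this
  set S₁ : Finset ℂ := (Finset.Ico (1 - L : ℤ) (L' + 1)).image pole with hS₁
  set S₂ : Finset ℂ := (Finset.range (d * L')).image nat with hS₂
  have hdisj : Disjoint S₁ S₂ := by
    rw [Finset.disjoint_left]
    intro z h1 h2
    simp only [hS₁, hS₂, Finset.mem_image] at h1 h2
    obtain ⟨n, _, rfl⟩ := h1
    obtain ⟨m, _, h⟩ := h2
    exact hne n m h.symm
  set res : ℂ → ℂ := fun p => if ∃ m, p = nat m then limUnder (𝓝[≠] p) (fun s => (s - p) * f s)
    else d / (2 * Real.pi * I) * gwFunction w d t p with hres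
  have hres₁ : ∀ n, res (pole n) = d / (2 * Real.pi * I) * gwFunction w d t (pole n) := by
    intro n
    simp only [hres]
    rw [if_neg]
    rintro ⟨m, h⟩
    exact hne n m h
  have hres₂ : ∀ m, res (nat m) = narrowResidue w d a P t m := by
    intro m
    simp only [hres]
    rw [if_pos ⟨m, rfl⟩]
    exact (tendsto_sub_mul_mellinIntegrand_nat hd t hP0 hP m).limUnder_eq
  have hPre : |d * P.re| ≤ 1 / 4 := by
    rw [abs_mul, abs_of_nonneg (Nat.cast_nonneg d)]
    exact (mul_le_mul_of_nonneg_left (abs_re_le_norm P) (Nat.cast_nonneg d)).trans hP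
  obtain ⟨hP1, hP2⟩ := abs_le.1 hPre
  have hpre : ∀ n, (pole n).re = ((d * n - a : ℤ) : ℝ) - d * P.re := by
    intro n; simp [hpole]
  have hpole_mem : ∀ n : ℤ, 1 / 2 + d * ((-L : ℤ) : ℝ) ≤ (pole n).re →
      (pole n).re ≤ 1 / 2 + d * ((L' : ℤ) : ℝ) → n ∈ Finset.Ico (1 - L : ℤ) (L' + 1) := by
    intro n h1 h2
    rw [hpre] at h1 h2
    have h3 : (-1 : ℝ) < ((d * n - a - d * (-L) - 1 : ℤ) : ℝ) := by push_cast at h1 ⊢; linarith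
    have h4 : ((d * n - a - d * L' : ℤ) : ℝ) < 1 := by push_cast at h2 ⊢; linarith
    have h5 : (-1 : ℤ) < d * n - a - d * (-L) - 1 := by exact_mod_cast h3
    have h6 : (d * n - a - d * L' : ℤ) < 1 := by exact_mod_cast h4
    rw [Finset.mem_Ico]
    have ha' : (a : ℤ) < d := by exact_mod_cast ha
    have ha0 : (0 : ℤ) ≤ a := by positivity
    constructor
    · by_contra hcon
      push Not at hcon
      nlinarith
    · by_contra hcon
      push Not at hcon
      nlinarith
  have key := integral_sub_integral_eq_sum_residues (x₁ := 1 / 2 + d * ((-L : ℤ) : ℝ))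
    (x₂ := 1 / 2 + d * ((L' : ℤ) : ℝ)) (by push_cast; nlinarith [(Nat.cast_nonneg L : (0:ℝ) ≤ L),
      (Nat.cast_nonneg L' : (0:ℝ) ≤ L')]) res (S₁ ∪ S₂) f ?_ ?_ ?_
    (integrable_mellinIntegrand hw hκ a hP ht (-L)) (integrable_mellinIntegrand hw hκ a hP ht L')
    (fun y => (exists_norm_mellinIntegrand_strip_le hw hκ a hP ht (1 / 2 + d * ((-L : ℤ) : ℝ))
      (1 / 2 + d * ((L' : ℤ) : ℝ))).choose * Real.exp (-(Real.pi / (2 * d)) * y)) ?_ d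
    (exists_norm_mellinIntegrand_strip_le hw hκ a hP ht (1 / 2 + d * ((-L : ℤ) : ℝ))
      (1 / 2 + d * ((L' : ℤ) : ℝ))).choose_spec
  · rw [Finset.sum_union hdisj, hS₁, hS₂, Finset.sum_image (fun _ _ _ _ h => hpole_inj h),
      Finset.sum_image (fun _ _ _ _ h => hnat_inj h)] at key
    simp only [hres₁, hres₂] at key
    have hsplit : ∑ n ∈ Finset.Ico (1 - L : ℤ) (L' + 1), gwFunction w d t (pole n) =
        (∑ l ∈ Finset.range L, gwFunction w d t (-(a + d * l : ℕ) - d * P)) +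
        (∑ l ∈ Finset.range L', gwFunction w d t (d * (l + 1 : ℕ) - a - d * P)) := by
      have hunion : Finset.Ico (1 - L : ℤ) (L' + 1) =
          (Finset.range L).image (fun l : ℕ => -(l : ℤ)) ∪
          (Finset.range L').image (fun l : ℕ => (l : ℤ) + 1) := by
        ext n
        simp only [Finset.mem_Ico, Finset.mem_union, Finset.mem_image, Finset.mem_range]
        constructor
        · intro h
          rcases le_or_gt n 0 with h0 | h0
          · exact Or.inl ⟨n.natAbs, by omega, by omega⟩
          · exact Or.inr ⟨n.natAbs - 1, by omega, by omega⟩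
        · rintro (⟨l, hl, rfl⟩ | ⟨l, hl, rfl⟩) <;> omega
      rw [hunion, Finset.sum_union, Finset.sum_image, Finset.sum_image]
      · refine congrArg₂ _ (Finset.sum_congr rfl fun l _ => congrArg _ ?_)
          (Finset.sum_congr rfl fun l _ => congrArg _ ?_)
        · simp only [hpole]; push_cast; ring
        · simp only [hpole]; push_cast; ring
      · intro l _ l' _ h; simp only at h; omega
      · intro l _ l' _ h; simp only at h; omega
      · rw [Finset.disjoint_left]
        simp only [Finset.mem_image, Finset.mem_range]
        rintro n ⟨l, hl, rfl⟩ ⟨l', hl', h⟩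
        omega
    rw [← Finset.mul_sum, hsplit] at key
    unfold lineIntegral
    rw [key]
    have hpi : (Real.pi : ℂ) ≠ 0 := ofReal_ne_zero.2 Real.pi_ne_zero
    have hI := I_ne_zero
    field_simp
  · intro p hp
    rw [Finset.mem_union] at hp
    rcases hp with hp | hp
    · obtain ⟨n, hn, rfl⟩ := Finset.mem_image.1 hp
      rw [Finset.mem_Ico] at hn
      rw [hpre]
      have ha' : (a : ℤ) < d := by exact_mod_cast ha
      have h1 : (1 : ℤ) ≤ d * n - a - d * (-L) := by nlinarith
      have h2 : (d * n - a - d * L' : ℤ) ≤ 0 := by nlinarith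
      have h3 : (1 : ℝ) ≤ ((d * n - a - d * (-L) : ℤ) : ℝ) := by exact_mod_cast h1
      have h4 : ((d * n - a - d * L' : ℤ) : ℝ) ≤ 0 := by exact_mod_cast h2
      push_cast at h3 h4 ⊢
      constructor <;> linarith
    · obtain ⟨m, hm, rfl⟩ := Finset.mem_image.1 hp
      rw [Finset.mem_range] at hm
      have h1 : (m : ℝ) + 1 ≤ d * L' := by exact_mod_cast hm
      have h2 : (0 : ℝ) ≤ d * L := by positivity
      have h3 : (0 : ℝ) ≤ m := by positivity
      simp only [hnat, add_re, natCast_re, one_re]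
      push_cast
      constructor <;> linarith
  · intro s hs
    refine (differentiableAt_mellinIntegrand hd ?_ ?_).differentiableWithinAt
    · rintro m rfl
      apply hs.2
      rw [Finset.mem_coe, Finset.mem_union]
      right
      refine Finset.mem_image.2 ⟨m, ?_, rfl⟩
      have h2 : ((m : ℂ) + 1).re ≤ 1 / 2 + d * ((L' : ℤ) : ℝ) := hs.1.2
      simp only [add_re, natCast_re, one_re] at h2
      push_cast at h2
      rw [Finset.mem_range]
      have : (m : ℝ) < d * L' := by linarith
      exact_mod_cast this
    · rintro n rfl
      apply hs.2
      rw [Finset.mem_coe, Finset.mem_union]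
      left
      exact Finset.mem_image.2 ⟨n, hpole_mem n hs.1.1 hs.1.2, rfl⟩
  · intro p hp
    rw [Finset.mem_union] at hp
    rcases hp with hp | hp
    · obtain ⟨n, hn, rfl⟩ := Finset.mem_image.1 hp
      rw [hres₁]
      exact tendsto_sub_mul_mellinIntegrand_kernel hd t hP0 hP n
    · obtain ⟨m, hm, rfl⟩ := Finset.mem_image.1 hp
      rw [hres₂]
      exact tendsto_sub_mul_mellinIntegrand_nat hd t hP0 hP m
  · have hc : -(Real.pi / (2 * d)) < 0 := by
      have : 0 < Real.pi / (2 * d) := by positivity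
      linarith
    have h1 : Tendsto (fun y : ℝ => Real.exp (-(Real.pi / (2 * d)) * y)) atTop (𝓝 0) :=
      Real.tendsto_exp_atBot.comp (tendsto_id.const_mul_atTop_of_neg hc)
    simpa using h1.const_mul (exists_norm_mellinIntegrand_strip_le hw hκ a hP ht
      (1 / 2 + d * ((-L : ℤ) : ℝ)) (1 / 2 + d * ((L' : ℤ) : ℝ))).choose

/-- The contour shift with its error estimate, uniform in `P` and `t`: the contribution of the line
on the left is of the size of the first omitted term, that of the line on the right tends to zero
as `m → ∞`. -/
theorem exists_norm_sum_residues_le (hw : ∀ j, 0 < w j) (hκ : ∑ j, w j < d) {a : ℕ} (ha : a < d)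
    (L : ℕ) : ∃ C : ℝ, 0 < C ∧ ∀ (m : ℕ) (P t : ℂ), P ≠ 0 → d * ‖P‖ ≤ 1 / 4 →
      t ∈ goodSector w d →
      ‖(∑ l ∈ Finset.range L, gwFunction w d t (-(a + d * l : ℕ) - d * P)) +
        (∑ l ∈ Finset.range (m + 1), gwFunction w d t (d * (l + 1 : ℕ) - a - d * P)) +
        2 * Real.pi * I / d * ∑ i ∈ Finset.range (d * (m + 1)), narrowResidue w d a P t i‖ ≤
      C * ‖t‖ ^ (1 / 2 - d * L : ℝ) +
        C * (((1 + d) ^ d) ^ m / m !) * ‖t‖ ^ (1 / 2 + d * (m + 1 : ℕ) : ℝ) := by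
  have hd : 0 < d := by omega
  have hd1 : (1 : ℝ) ≤ d := by exact_mod_cast hd
  obtain ⟨C₂, hC₂, h₂⟩ := exists_norm_periodicKernel_le hd a
  obtain ⟨C₁, hC₁, h₁⟩ := exists_norm_gammaQuotient_le_line hw hκ (-L : ℤ)
  obtain ⟨C₃, hC₃, h₃⟩ := exists_norm_gammaQuotient_le_factorial hw hκ
  set J : ℝ := ∫ y : ℝ, Real.exp (-(Real.pi / (2 * d)) * |y|) with hJ
  have hJ0 : 0 ≤ J := integral_nonneg fun y => (Real.exp_pos _).le
  refine ⟨C₁ * C₂ * J + C₃ * C₂ * J + 1, by positivity, fun m P t hP0 hP ht => ?_⟩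
  rw [sum_residues_eq hw hκ ha hP0 hP ht]
  have ht0 : 0 < ‖t‖ := norm_pos_iff.2 ht.1
  have hK : (0 : ℝ) < ((1 + d) ^ d) ^ m / m ! := by positivity
  have e1 : ‖lineIntegral w d a P t (-L)‖ ≤ C₁ * C₂ * J * ‖t‖ ^ (1 / 2 - d * L : ℝ) := by
    have := (integrable_and_norm_integral_le hd hP ht hC₁ hC₂ h₁
      fun s hs => h₂ P s hP (Or.inr ⟨(-L : ℤ), hs⟩)).2
    unfold lineIntegral
    refine this.trans_eq ?_
    congr 2
    push_cast; ring
  have e2 : ‖lineIntegral w d a P t (m + 1 : ℕ)‖ ≤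
      C₃ * (((1 + d) ^ d) ^ m / m !) * C₂ * J * ‖t‖ ^ (1 / 2 + d * (m + 1 : ℕ) : ℝ) := by
    have := (integrable_and_norm_integral_le hd hP ht (m := (m + 1 : ℕ)) (mul_pos hC₃ hK) hC₂
      (fun s hs => h₃ m s (by rw [hs]; push_cast; ring))
      fun s hs => h₂ P s hP (Or.inr ⟨(m + 1 : ℕ), hs⟩)).2
    unfold lineIntegral
    exact this
  have hId : ‖I / (d : ℂ)‖ ≤ 1 := by
    rw [norm_div, norm_I, norm_natCast]
    exact div_le_one_of_le₀ hd1 (by positivity)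
  have hp1 : 0 ≤ ‖t‖ ^ (1 / 2 - d * L : ℝ) := by positivity
  have hp2 : 0 ≤ (((1 + d) ^ d : ℝ) ^ m / m !) * ‖t‖ ^ (1 / 2 + d * (m + 1 : ℕ) : ℝ) := by
    positivity
  have hc1 : 0 ≤ C₁ * C₂ * J := by positivity
  have hc2 : 0 ≤ C₃ * C₂ * J := by positivity
  calc ‖I / (d : ℂ) * (lineIntegral w d a P t ((m + 1 : ℕ) : ℤ) - lineIntegral w d a P t (-L))‖
      ≤ 1 * (‖lineIntegral w d a P t ((m + 1 : ℕ) : ℤ)‖ + ‖lineIntegral w d a P t (-L)‖) := by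
        rw [norm_mul]
        gcongr
        exact norm_sub_le _ _
    _ ≤ C₃ * (((1 + d) ^ d) ^ m / m !) * C₂ * J * ‖t‖ ^ (1 / 2 + d * (m + 1 : ℕ) : ℝ) +
        C₁ * C₂ * J * ‖t‖ ^ (1 / 2 - d * L : ℝ) := by
        rw [one_mul]; exact add_le_add e2 e1
    _ ≤ _ := by
      nlinarith [mul_nonneg hc1 hp1, mul_nonneg hc1 hp2, mul_nonneg hc2 hp1, mul_nonneg hc2 hp2]

end Shift

/-! ### Taylor series and coefficient extraction in the variable `P` -/

/-- The Taylor series at `0` of a function which is analytic there. -/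
def taylor (g : ℂ → ℂ) : PowerSeries ℂ := PowerSeries.mk fun r => iteratedDeriv r g 0 / (r ! : ℂ)

lemma coeff_taylor (g : ℂ → ℂ) (r : ℕ) :
    PowerSeries.coeff r (taylor g) = iteratedDeriv r g 0 / (r ! : ℂ) := by
  simp [taylor]

lemma taylor_congr {g h : ℂ → ℂ} (hgh : g =ᶠ[𝓝 0] h) : taylor g = taylor h := by
  ext r
  rw [coeff_taylor, coeff_taylor, hgh.iteratedDeriv_eq]

lemma taylor_mul {g h : ℂ → ℂ} (hg : AnalyticAt ℂ g 0) (hh : AnalyticAt ℂ h 0) :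
    taylor (fun P => g P * h P) = taylor g * taylor h := by
  ext r
  rw [coeff_taylor, iteratedDeriv_fun_mul hg.contDiffAt hh.contDiffAt, PowerSeries.coeff_mul,
    Finset.Nat.sum_antidiagonal_eq_sum_range_succ_mk, Finset.sum_div]
  refine Finset.sum_congr rfl fun i hi => ?_
  have hi' : i ≤ r := Nat.lt_succ_iff.1 (Finset.mem_range.1 hi)
  simp only [coeff_taylor]
  have h1 : (i ! : ℂ) ≠ 0 := Nat.cast_ne_zero.2 i.factorial_ne_zero
  have h2 : ((r - i)! : ℂ) ≠ 0 := Nat.cast_ne_zero.2 (r - i).factorial_ne_zero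
  have h3 : (r ! : ℂ) ≠ 0 := Nat.cast_ne_zero.2 r.factorial_ne_zero
  have h4 : (r.choose i : ℂ) * (i ! : ℂ) * ((r - i)! : ℂ) = (r ! : ℂ) := by
    exact_mod_cast Nat.choose_mul_factorial_mul_factorial hi'
  field_simp
  linear_combination (iteratedDeriv i g 0 * iteratedDeriv (r - i) h 0) * h4

lemma taylor_const (b : ℂ) : taylor (fun _ => b) = PowerSeries.C b := by
  ext r
  rw [coeff_taylor, iteratedDeriv_const, PowerSeries.coeff_C]
  split_ifs with h
  · simp [h]
  · simp

lemma taylor_linear (c b : ℂ) :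
    taylor (fun P => c * P + b) = c • PowerSeries.X + PowerSeries.C b := by
  ext r
  rw [coeff_taylor]
  rcases r with _ | _ | r
  · simp
  · have : deriv (fun P => c * P + b) = fun _ => c := by ext P; simp
    simp [iteratedDeriv_one, this, PowerSeries.coeff_X]
  · have : deriv (fun P => c * P + b) = fun _ => c := by ext P; simp
    rw [iteratedDeriv_succ', this, iteratedDeriv_const]
    simp [PowerSeries.coeff_X]

lemma taylor_prod {ι : Type*} (s : Finset ι) (g : ι → ℂ → ℂ) (hg : ∀ i ∈ s, AnalyticAt ℂ (g i) 0) :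
    taylor (fun P => ∏ i ∈ s, g i P) = ∏ i ∈ s, taylor (g i) := by
  classical
  induction s using Finset.induction_on with
  | empty => simpa using taylor_const 1
  | insert i s hi ih =>
    simp only [Finset.prod_insert hi]
    rw [taylor_mul (hg i (Finset.mem_insert_self i s))
      (Finset.analyticAt_fun_prod s fun j hj => hg j (Finset.mem_insert_of_mem hj)),
      ih fun j hj => hg j (Finset.mem_insert_of_mem hj)]

lemma taylor_exp (a : ℂ) : taylor (fun P => cexp (a * P)) = expSeries a := by
  ext r
  rw [coeff_taylor, expSeries, PowerSeries.coeff_mk]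
  congr 1
  simp

/-- The coefficient of `P ^ r` of a function of `P`, as a contour integral over `|P| = ρ`. -/
def circleCoeff (ρ : ℝ) (r : ℕ) (g : ℂ → ℂ) : ℂ :=
  (2 * Real.pi * I)⁻¹ * ∮ P in C(0, ρ), (1 / (P - 0) ^ (r + 1)) • g P

section CircleCoeff

variable {ρ : ℝ}

lemma circleCoeff_eq_coeff_taylor (hρ : 0 < ρ) {g : ℂ → ℂ} (r : ℕ)
    (hg : DifferentiableOn ℂ g (Metric.closedBall 0 ρ)) :
    circleCoeff ρ r g = PowerSeries.coeff r (taylor g) := by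
  rw [circleCoeff, hg.circleIntegral_one_div_sub_center_pow_smul hρ r, coeff_taylor, smul_eq_mul]
  have := two_pi_I_ne_zero
  field_simp

lemma circleIntegrable_coeff (hρ : 0 < ρ) {g : ℂ → ℂ} (r : ℕ) (hg : ContinuousOn g (Metric.sphere 0 ρ)) :
    CircleIntegrable (fun P => (1 / (P - 0) ^ (r + 1)) • g P) 0 ρ := by
  refine ContinuousOn.circleIntegrable hρ.le ?_
  refine ContinuousOn.smul (ContinuousOn.div continuousOn_const
    (by fun_prop : Continuous fun P : ℂ => (P - 0) ^ (r + 1)).continuousOn fun P hP => ?_) hg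
  have : ‖P‖ = ρ := by simpa using hP
  apply pow_ne_zero
  rw [sub_zero]
  rintro rfl
  rw [norm_zero] at this
  exact hρ.ne this

lemma circleCoeff_add (hρ : 0 < ρ) {g h : ℂ → ℂ} (r : ℕ) (hg : ContinuousOn g (Metric.sphere 0 ρ))
    (hh : ContinuousOn h (Metric.sphere 0 ρ)) :
    circleCoeff ρ r (fun P => g P + h P) = circleCoeff ρ r g + circleCoeff ρ r h := by
  unfold circleCoeff
  rw [← mul_add, ← circleIntegral.integral_add (circleIntegrable_coeff hρ r hg)
    (circleIntegrable_coeff hρ r hh)]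
  simp only [smul_add]

lemma circleCoeff_const_mul (r : ℕ) (c : ℂ) (g : ℂ → ℂ) :
    circleCoeff ρ r (fun P => c * g P) = c * circleCoeff ρ r g := by
  unfold circleCoeff
  have : ∀ P : ℂ, (1 / (P - 0) ^ (r + 1)) • (c * g P) = c • ((1 / (P - 0) ^ (r + 1)) • g P) := by
    intro P; simp only [smul_eq_mul]; ring
  simp only [this]
  rw [circleIntegral.integral_smul, smul_eq_mul]
  ring

lemma circleCoeff_sum (hρ : 0 < ρ) {ι : Type*} (s : Finset ι) {g : ι → ℂ → ℂ} (r : ℕ)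
    (hg : ∀ i ∈ s, ContinuousOn (g i) (Metric.sphere 0 ρ)) :
    circleCoeff ρ r (fun P => ∑ i ∈ s, g i P) = ∑ i ∈ s, circleCoeff ρ r (g i) := by
  classical
  induction s using Finset.induction_on with
  | empty => simp [circleCoeff, circleIntegral]
  | insert i s hi ih =>
    simp only [Finset.sum_insert hi]
    rw [circleCoeff_add hρ r (hg i (Finset.mem_insert_self i s))
      (continuousOn_finsetSum s fun j hj => hg j (Finset.mem_insert_of_mem hj)),
      ih fun j hj => hg j (Finset.mem_insert_of_mem hj)]

lemma circleCoeff_congr (hρ : 0 < ρ) {g h : ℂ → ℂ} (r : ℕ) (hgh : ∀ P, ‖P‖ = ρ → g P = h P) :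
    circleCoeff ρ r g = circleCoeff ρ r h := by
  unfold circleCoeff
  congr 1
  refine circleIntegral.integral_congr hρ.le fun P hP => ?_
  rw [hgh P (by simpa using hP)]

lemma norm_circleCoeff_le (hρ : 0 < ρ) {g : ℂ → ℂ} (r : ℕ) {B : ℝ} (hB : ∀ P, ‖P‖ = ρ → ‖g P‖ ≤ B) :
    ‖circleCoeff ρ r g‖ ≤ B / ρ ^ r := by
  have h1 : ∀ P ∈ Metric.sphere (0 : ℂ) ρ, ‖(1 / (P - 0) ^ (r + 1)) • g P‖ ≤ B / ρ ^ (r + 1) := by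
    intro P hP
    have hP' : ‖P‖ = ρ := by simpa using hP
    rw [sub_zero, norm_smul, norm_div, norm_one, norm_pow, hP', one_div_mul_eq_div]
    gcongr
    exact hB P hP'
  have h2 := circleIntegral.norm_integral_le_of_norm_le_const hρ.le h1
  unfold circleCoeff
  rw [norm_mul]
  have h3 : ‖(2 * Real.pi * I : ℂ)⁻¹‖ = (2 * Real.pi)⁻¹ := by
    rw [norm_inv, norm_mul, norm_mul, norm_I, norm_real, Real.norm_of_nonneg Real.pi_pos.le]
    simp
  rw [h3]
  calc (2 * Real.pi)⁻¹ * ‖∮ P in C(0, ρ), (1 / (P - 0) ^ (r + 1)) • g P‖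
      ≤ (2 * Real.pi)⁻¹ * (2 * Real.pi * ρ * (B / ρ ^ (r + 1))) := by gcongr
    _ = B / ρ ^ r := by
      have := Real.pi_pos
      rw [pow_succ]
      field_simp

/-- Functions with a zero of order greater than `r` have no coefficient of `P ^ r`. -/
lemma circleCoeff_pow_mul_eq_zero (hρ : 0 < ρ) {g : ℂ → ℂ} {r n : ℕ} (hrn : r < n)
    (hg : DifferentiableOn ℂ g (Metric.closedBall 0 ρ)) :
    circleCoeff ρ r (fun P => P ^ n * g P) = 0 := by
  obtain ⟨k, rfl⟩ : ∃ k, n = r + 1 + k := ⟨n - r - 1, by omega⟩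
  have hz : ∮ P in C(0, ρ), P ^ k * g P = 0 := by
    refine DiffContOnCl.circleIntegral_eq_zero hρ.le ?_
    apply DifferentiableOn.diffContOnCl
    rw [closure_ball _ hρ.ne']
    exact (differentiable_pow k).differentiableOn.mul hg
  unfold circleCoeff
  rw [circleIntegral.integral_congr (g := fun P => P ^ k * g P) hρ.le, hz, mul_zero]
  intro P hP
  have hP' : ‖P‖ = ρ := by simpa using hP
  have hP0 : P ≠ 0 := by
    rintro rfl
    rw [norm_zero] at hP'
    exact hρ.ne hP'
  simp only [sub_zero, smul_eq_mul]
  rw [one_div, pow_add P (r + 1) k, mul_assoc, inv_mul_cancel_left₀ (pow_ne_zero _ hP0)]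

end CircleCoeff

/-! ### The Gromov–Witten terms as Taylor coefficients -/

/-- The function of `P` with Taylor series `hyperFactor c x 1`. -/
def hyperEval (c : ℕ) (x : ℚ) (P : ℂ) : ℂ :=
  ∏ i ∈ Finset.range ⌈x⌉₊, ((c : ℂ) * P + ((x - i : ℚ) : ℂ))

lemma analyticAt_hyperEval (c : ℕ) (x : ℚ) (P : ℂ) : AnalyticAt ℂ (hyperEval c x) P := by
  unfold hyperEval
  apply Differentiable.analyticAt
  fun_prop

lemma taylor_hyperEval (c : ℕ) (x : ℚ) : taylor (hyperEval c x) = hyperFactor c x 1 := by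
  unfold hyperEval hyperFactor
  rw [taylor_prod]
  · refine Finset.prod_congr rfl fun i _ => ?_
    rw [taylor_linear, mul_one]
  · intro i _
    apply Differentiable.analyticAt
    fun_prop

lemma hyperEval_zero_ne_zero (c : ℕ) (x : ℚ) : hyperEval c x 0 ≠ 0 := by
  unfold hyperEval
  rw [Finset.prod_ne_zero_iff]
  intro i hi
  have h := (Nat.lt_ceil).1 (Finset.mem_range.1 hi)
  rw [mul_zero, zero_add]
  exact_mod_cast (sub_pos.2 h).ne'

lemma Gamma_eq_hyperEval_mul (c : ℕ) {x : ℚ} {P : ℂ}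
    (hP : 0 < (1 + ((x - ⌈x⌉₊ : ℚ) : ℂ) + c * P).re) :
    Gamma (1 + x + c * P) = hyperEval c x P * Gamma (1 + ((x - ⌈x⌉₊ : ℚ) : ℂ) + c * P) := by
  set z : ℂ := 1 + ((x - ⌈x⌉₊ : ℚ) : ℂ) + c * P with hz
  have h1 : (1 + x + c * P : ℂ) = z + ⌈x⌉₊ := by rw [hz]; push_cast; ring
  rw [h1, Gamma_add_nat]
  · congr 1
    unfold hyperEval
    rw [← Finset.prod_range_reflect]
    refine Finset.prod_congr rfl fun i hi => ?_
    have hi' : i + 1 ≤ ⌈x⌉₊ := Finset.mem_range.1 hi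
    rw [show ⌈x⌉₊ - 1 - i = ⌈x⌉₊ - (i + 1) by omega, Nat.cast_sub hi', hz]
    push_cast
    ring
  · intro i _ h
    have := congrArg Complex.re h
    rw [add_re, natCast_re, zero_re] at this
    have hi : (0 : ℝ) ≤ i := Nat.cast_nonneg i
    linarith

section Weight

variable {N : ℕ} (w : Fin N → ℕ) (d : ℕ)

/-- The radius of the circle in the `P`-plane on which coefficients are extracted. -/
def coeffRadius : ℝ := 1 / (4 * (d : ℝ) ^ 2)

/-- The normalisation `∏ⱼ Γ(1 + n wⱼ - ⌈n wⱼ⌉ + wⱼ P) / Γ(1 + d P)`, for `n = a / d`, which turns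
the products of the Gromov–Witten `I`-function into quotients of Gamma functions. -/
def gammaWeight (a : ℕ) (P : ℂ) : ℂ :=
  (∏ j, Gamma (1 + (((a : ℚ) / d * w j - ⌈(a : ℚ) / d * w j⌉₊ : ℚ) : ℂ) + w j * P)) *
    (Gamma (1 + d * P))⁻¹

/-- The term of index `n` of the Gromov–Witten `I`-function at `q = t ^ (-d)` and `z = 1`, as a
function of a complex number `P`. -/
def gwEval (t : ℂ) (n : ℚ) (P : ℂ) : ℂ :=
  cexp (-(d * (n + P)) * log t) * hyperEval d (n * d) P *
    (∏ j, hyperEval (w j) (n * w j) P)⁻¹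

variable {w d}

lemma coeffRadius_pos (hd : 0 < d) : 0 < coeffRadius d := by
  have : (0 : ℝ) < d := Nat.cast_pos.2 hd
  unfold coeffRadius
  positivity

lemma mul_norm_le_of_le_coeffRadius (hd : 0 < d) {c : ℕ} (hc : c ≤ d) {P : ℂ}
    (hP : ‖P‖ ≤ coeffRadius d) : c * ‖P‖ ≤ 1 / (4 * d) := by
  have hd' : (0 : ℝ) < d := Nat.cast_pos.2 hd
  have hc' : (c : ℝ) ≤ d := by exact_mod_cast hc
  calc c * ‖P‖ ≤ d * (1 / (4 * (d : ℝ) ^ 2)) := by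
        unfold coeffRadius at hP
        gcongr
    _ = 1 / (4 * d) := by field_simp

lemma mul_norm_le_quarter (hd : 0 < d) {P : ℂ} (hP : ‖P‖ ≤ coeffRadius d) : d * ‖P‖ ≤ 1 / 4 := by
  have hd1 : (1 : ℝ) ≤ d := by exact_mod_cast hd
  refine (mul_norm_le_of_le_coeffRadius hd le_rfl hP).trans ?_
  apply one_div_le_one_div_of_le <;> linarith

lemma re_add_mul_pos (hd : 0 < d) {c : ℕ} (hc : c ≤ d) {P : ℂ} (hP : ‖P‖ ≤ coeffRadius d) {b : ℂ}
    (hb : 1 / (d : ℝ) ≤ b.re) : 0 < (b + c * P).re := by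
  have hd' : (0 : ℝ) < d := Nat.cast_pos.2 hd
  have h1 := mul_norm_le_of_le_coeffRadius hd hc hP
  have h2 : |c * P.re| ≤ 1 / (4 * d) := by
    rw [abs_mul, abs_of_nonneg (Nat.cast_nonneg c)]
    exact (mul_le_mul_of_nonneg_left (abs_re_le_norm P) (Nat.cast_nonneg c)).trans h1
  have h3 := (abs_le.1 h2).1
  have h4 : 1 / (4 * d) < 1 / (d : ℝ) := by
    apply one_div_lt_one_div_of_lt hd'; linarith
  have h5 : (b + c * P).re = b.re + c * P.re := by simp
  rw [h5]
  linarith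

lemma one_div_le_sub_of_lt_ceil (hd : 0 < d) (m c : ℕ) {i : ℕ} (hi : i < ⌈(m : ℚ) / d * c⌉₊) :
    (1 : ℚ) / d ≤ (m : ℚ) / d * c - i := by
  have hd' : (0 : ℚ) < d := Nat.cast_pos.2 hd
  have h1 := Nat.lt_ceil.1 hi
  rw [div_mul_eq_mul_div, lt_div_iff₀ hd'] at h1
  have h2 : i * d + 1 ≤ m * c := by exact_mod_cast h1
  have h3 : (i : ℚ) * d + 1 ≤ m * c := by exact_mod_cast h2
  rw [le_sub_iff_add_le, div_mul_eq_mul_div, le_div_iff₀ hd', add_mul, one_div_mul_cancel hd'.ne']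
  linarith

lemma one_div_le_one_add_sub_ceil (hd : 0 < d) (m c : ℕ) :
    (1 : ℚ) / d ≤ 1 + ((m : ℚ) / d * c - ⌈(m : ℚ) / d * c⌉₊) := by
  have hd' : (0 : ℚ) < d := Nat.cast_pos.2 hd
  have h1 := Nat.ceil_lt_add_one (a := (m : ℚ) / d * c) (by positivity)
  rw [div_mul_eq_mul_div] at h1 ⊢
  have h1' : (⌈(m : ℚ) * c / d⌉₊ : ℚ) * d < m * c + d := by
    calc _ < ((m : ℚ) * c / d + 1) * d := by gcongr
      _ = _ := by field_simp
  have h2 : ⌈(m : ℚ) * c / d⌉₊ * d + 1 ≤ m * c + d := by exact_mod_cast h1'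
  have h3 : (⌈(m : ℚ) * c / d⌉₊ : ℚ) * d + 1 ≤ m * c + d := by exact_mod_cast h2
  rw [div_le_iff₀ hd']
  have : (1 + ((m : ℚ) * c / d - ⌈(m : ℚ) * c / d⌉₊)) * d =
    m * c + d - (⌈(m : ℚ) * c / d⌉₊ : ℚ) * d := by field_simp; ring
  rw [this]
  linarith

lemma re_shift_pos (hd : 0 < d) (m : ℕ) {c : ℕ} (hc : c ≤ d) {P : ℂ} (hP : ‖P‖ ≤ coeffRadius d) :
    0 < (1 + (((m : ℚ) / d * c - ⌈(m : ℚ) / d * c⌉₊ : ℚ) : ℂ) + c * P).re := by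
  apply re_add_mul_pos hd hc hP
  have h := one_div_le_one_add_sub_ceil hd m c
  have h' : ((1 : ℚ) / d : ℝ) ≤ ((1 + ((m : ℚ) / d * c - ⌈(m : ℚ) / d * c⌉₊) : ℚ) : ℝ) := by
    exact_mod_cast h
  rw [add_re, one_re, ratCast_re]
  push_cast at h' ⊢
  exact h'

lemma hyperEval_ne_zero (hd : 0 < d) (m : ℕ) {c : ℕ} (hc : c ≤ d) {P : ℂ}
    (hP : ‖P‖ ≤ coeffRadius d) : hyperEval c ((m : ℚ) / d * c) P ≠ 0 := by
  unfold hyperEval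
  rw [Finset.prod_ne_zero_iff]
  intro i hi h
  have h1 := one_div_le_sub_of_lt_ceil hd m c (Finset.mem_range.1 hi)
  have h1' : ((1 : ℚ) / d : ℝ) ≤ (((m : ℚ) / d * c - i : ℚ) : ℝ) := by exact_mod_cast h1
  have h2 := re_add_mul_pos hd hc hP (b := (((m : ℚ) / d * c - i : ℚ) : ℂ)) (by
    rw [ratCast_re]; push_cast at h1' ⊢; exact h1')
  rw [add_comm, h] at h2
  simp at h2

lemma differentiableOn_hyperEval (c : ℕ) (x : ℚ) (s : Set ℂ) :
    DifferentiableOn ℂ (hyperEval c x) s := fun P _ =>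
  (analyticAt_hyperEval c x P).differentiableAt.differentiableWithinAt

lemma differentiableOn_gwEval (hd : 0 < d) (hw : ∀ j, w j ≤ d) (t : ℂ) (m : ℕ) :
    DifferentiableOn ℂ (gwEval w d t ((m : ℚ) / d)) (Metric.closedBall 0 (coeffRadius d)) := by
  unfold gwEval
  refine DifferentiableOn.mul (DifferentiableOn.mul (by fun_prop)
    (differentiableOn_hyperEval _ _ _)) (DifferentiableOn.inv ?_ ?_)
  · exact DifferentiableOn.fun_finsetProd fun j _ => differentiableOn_hyperEval _ _ _
  · intro P hP
    rw [Finset.prod_ne_zero_iff]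
    exact fun j _ => hyperEval_ne_zero hd m (hw j) (by simpa using hP)

lemma differentiableOn_gammaWeight (hd : 0 < d) (hw : ∀ j, w j ≤ d) (a : ℕ) :
    DifferentiableOn ℂ (gammaWeight w d a) (Metric.closedBall 0 (coeffRadius d)) := by
  unfold gammaWeight
  refine DifferentiableOn.mul (DifferentiableOn.fun_finsetProd fun j _ => ?_) ?_
  · intro P hP
    refine DifferentiableAt.differentiableWithinAt ?_
    have hpos := re_shift_pos hd a (hw j) (P := P) (by simpa using hP)
    refine (differentiableAt_Gamma _ fun m hm => ?_).comp P
      (f := fun P => 1 + (((a : ℚ) / d * w j - ⌈(a : ℚ) / d * w j⌉₊ : ℚ) : ℂ) + w j * P)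
      (by fun_prop)
    rw [hm] at hpos
    simp only [neg_re, natCast_re] at hpos
    linarith [(Nat.cast_nonneg m : (0 : ℝ) ≤ m)]
  · exact ((differentiable_one_div_Gamma).comp
      (by fun_prop : Differentiable ℂ fun P : ℂ => 1 + (d : ℂ) * P)).differentiableOn

/-- The values of the Mellin–Barnes integrand at its left poles are the Gromov–Witten terms. -/
lemma gwFunction_mul_gammaWeight (hd : 0 < d) (hw : ∀ j, w j ≤ d) (t : ℂ) (a l : ℕ) {P : ℂ}
    (hP : ‖P‖ ≤ coeffRadius d) :
    gwFunction w d t (-(a + d * l : ℕ) - d * P) * gammaWeight w d a P =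
      gwEval w d t (((a + d * l : ℕ) : ℚ) / d) P := by
  have hdc : (d : ℂ) ≠ 0 := Nat.cast_ne_zero.2 hd.ne'
  have hdq : (d : ℚ) ≠ 0 := Nat.cast_ne_zero.2 hd.ne'
  set m : ℕ := a + d * l with hm
  have hxd : (m : ℚ) / d * d = m := by field_simp
  have h1 : Gamma (1 + m + d * P) = hyperEval d ((m : ℚ) / d * d) P * Gamma (1 + d * P) := by
    have h := Gamma_eq_hyperEval_mul d (re_shift_pos hd m le_rfl hP)
    rw [hxd, Nat.ceil_natCast, sub_self] at h
    rw [hxd]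
    simpa using h
  have hΓ : Gamma (1 + d * P) ≠ 0 := by
    apply Gamma_ne_zero_of_re_pos
    apply re_add_mul_pos hd le_rfl hP
    rw [one_re, div_le_one (Nat.cast_pos.2 hd)]
    exact_mod_cast hd
  have h2 : ∀ j, (Gamma (1 - (w j : ℂ) / d * (-(m : ℂ) - d * P)))⁻¹ *
      Gamma (1 + (((a : ℚ) / d * w j - ⌈(a : ℚ) / d * w j⌉₊ : ℚ) : ℂ) + w j * P) =
      (hyperEval (w j) ((m : ℚ) / d * w j) P)⁻¹ := by
    intro j
    have hx : (m : ℚ) / d * w j = (a : ℚ) / d * w j + (l * w j : ℕ) := by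
      rw [hm]; push_cast; field_simp
    have hceil : ⌈(m : ℚ) / d * w j⌉₊ = ⌈(a : ℚ) / d * w j⌉₊ + l * w j := by
      rw [hx, Nat.ceil_add_natCast (by positivity)]
    have hsh : (m : ℚ) / d * w j - ⌈(m : ℚ) / d * w j⌉₊ =
        (a : ℚ) / d * w j - ⌈(a : ℚ) / d * w j⌉₊ := by
      rw [hceil, hx]; push_cast; ring
    have hpos := re_shift_pos hd m (hw j) hP
    have h := Gamma_eq_hyperEval_mul (w j) hpos
    have hne := Gamma_ne_zero_of_re_pos hpos
    rw [hsh] at h hne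
    have e : 1 - (w j : ℂ) / d * (-(m : ℂ) - d * P) = 1 + (((m : ℚ) / d * w j : ℚ) : ℂ) + w j * P := by
      push_cast; field_simp; ring
    rw [e, h, mul_inv, mul_assoc, inv_mul_cancel₀ hne, mul_one]
  unfold gwFunction gammaQuotient gammaWeight gwEval
  have e1 : (1 : ℂ) - (-(m : ℂ) - d * P) = 1 + m + d * P := by ring
  have e2 : (-(m : ℂ) - d * P) * log t = -(d * (((m : ℚ) / d : ℚ) + P)) * log t := by
    push_cast; field_simp; ring
  rw [e1, h1, e2]
  simp only [← Finset.prod_inv_distrib, ← h2, Finset.prod_mul_distrib]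
  generalize (∏ j, (Gamma (1 - (w j : ℂ) / d * (-(m : ℂ) - d * P)))⁻¹) = A
  generalize (∏ j, Gamma (1 + (((a : ℚ) / d * w j - ⌈(a : ℚ) / d * w j⌉₊ : ℚ) : ℂ) + w j * P)) = B
  field_simp

lemma taylor_gwEval (hd : 0 < d) (hw : ∀ j, w j ≤ d) (t : ℂ) (m : ℕ) :
    taylor (gwEval w d t ((m : ℚ) / d)) =
      PowerSeries.C (1 * cexp (((m : ℚ) / d : ℚ) * (-(d : ℂ) * log t))) *
        expSeries (-(d : ℂ) * log t / 1) * hyperFactor d ((m : ℚ) / d * d) 1 *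
        (∏ j, hyperFactor (w j) ((m : ℚ) / d * w j) 1)⁻¹ := by
  have hρ := coeffRadius_pos hd
  set n : ℚ := (m : ℚ) / d with hn
  have hden : ∀ P, ‖P‖ ≤ coeffRadius d → ∏ j, hyperEval (w j) (n * w j) P ≠ 0 := fun P hP =>
    Finset.prod_ne_zero_iff.2 fun j _ => hyperEval_ne_zero hd m (hw j) hP
  have hconst : PowerSeries.constantCoeff (∏ j, hyperFactor (w j) (n * w j) 1) ≠ 0 := by
    have h1 := hden 0 (by rw [norm_zero]; exact hρ.le)
    have h2 : ∀ j, PowerSeries.constantCoeff (hyperFactor (w j) (n * w j) 1) =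
        hyperEval (w j) (n * w j) 0 := by
      intro j
      rw [← taylor_hyperEval, ← PowerSeries.coeff_zero_eq_constantCoeff_apply, coeff_taylor]
      simp
    rw [map_prod]
    simpa only [h2] using h1
  rw [PowerSeries.eq_mul_inv_iff_mul_eq hconst]
  have hana : AnalyticAt ℂ (gwEval w d t n) 0 :=
    (differentiableOn_gwEval hd hw t m).analyticAt (Metric.closedBall_mem_nhds 0 hρ)
  have hprod : AnalyticAt ℂ (fun P => ∏ j, hyperEval (w j) (n * w j) P) 0 :=
    Finset.analyticAt_fun_prod _ fun j _ => analyticAt_hyperEval _ _ _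
  have h1 : taylor (fun P => ∏ j, hyperEval (w j) (n * w j) P) =
      ∏ j, hyperFactor (w j) (n * w j) 1 := by
    rw [taylor_prod _ _ fun j _ => analyticAt_hyperEval _ _ _]
    exact Finset.prod_congr rfl fun j _ => taylor_hyperEval _ _
  rw [← h1, ← taylor_mul hana hprod, ← taylor_hyperEval, ← taylor_const, ← taylor_exp]
  have hexp : AnalyticAt ℂ (fun P : ℂ => cexp (-(d : ℂ) * log t / 1 * P)) 0 := by
    apply Differentiable.analyticAt
    fun_prop
  have hmul : AnalyticAt ℂ (fun P : ℂ => 1 * cexp (n * (-(d : ℂ) * log t)) *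
      cexp (-(d : ℂ) * log t / 1 * P)) 0 := analyticAt_const.mul hexp
  rw [← taylor_mul analyticAt_const hexp, ← taylor_mul hmul (analyticAt_hyperEval _ _ _)]
  apply taylor_congr
  filter_upwards [Metric.closedBall_mem_nhds (0 : ℂ) hρ] with P hP
  have hP' := hden P (by simpa using hP)
  unfold gwEval
  rw [mul_assoc, inv_mul_cancel₀ hP', mul_one, one_mul, ← Complex.exp_add]
  congr 2
  ring

/-- The coordinates of the Gromov–Witten terms as contour integrals. -/
lemma gwTerm_apply_eq (hd : 0 < d) (hw : ∀ j, w j ≤ d) (W : MvPolynomial (Fin N) ℂ) (t : ℂ) (m : ℕ)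
    (p : AmbientIndex w W) :
    gwTerm w d W (-(d : ℂ) * log t) 1 ((m : ℚ) / d) p =
      if p.1.1 = Int.fract (-((m : ℚ) / d)) then
        circleCoeff (coeffRadius d) p.2 (gwEval w d t ((m : ℚ) / d)) else 0 := by
  unfold gwTerm ambientClass
  rw [circleCoeff_eq_coeff_taylor (coeffRadius_pos hd) _ (differentiableOn_gwEval hd hw t m),
    taylor_gwEval hd hw]

end Weight

/-! ### Extraction of coefficients from the contour shift -/

section Extraction

variable {N : ℕ} {w : Fin N → ℕ} {d : ℕ}

lemma exists_eq_mul_of_inv_Gamma (c : ℂ) (K : ℕ) :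
    ∃ g : ℂ → ℂ, Differentiable ℂ g ∧ ∀ P, (Gamma (-K + c * P))⁻¹ = P * g P := by
  set f : ℂ → ℂ := fun P => (Gamma (-K + c * P))⁻¹ with hf
  have hd : Differentiable ℂ f :=
    differentiable_one_div_Gamma.comp (by fun_prop : Differentiable ℂ fun P : ℂ => -(K : ℂ) + c * P)
  refine ⟨dslope f 0, ?_, fun P => ?_⟩
  · have := (differentiableOn_dslope (f := f) (s := univ) (c := 0) univ_mem).2 hd.differentiableOn
    exact differentiableOn_univ.1 this
  · have h1 := sub_smul_dslope f 0 P
    have h0 : f 0 = 0 := by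
      simp only [hf, mul_zero, add_zero]
      rw [Gamma_neg_nat_eq_zero, inv_zero]
    rw [h0, sub_zero, sub_zero, smul_eq_mul] at h1
    rw [h1]

lemma exists_mul_Gamma_eq (hd : 0 < d) (k : ℕ) :
    ∃ g : ℂ → ℂ, DifferentiableOn ℂ g (Metric.closedBall 0 (coeffRadius d)) ∧
      ∀ P, P ≠ 0 → ‖P‖ ≤ coeffRadius d → P * Gamma (-k + d * P) = g P := by
  have hdc : (d : ℂ) ≠ 0 := Nat.cast_ne_zero.2 hd.ne'
  have hne : ∀ P : ℂ, ‖P‖ ≤ coeffRadius d → ∀ i < k, (-k + d * P + i : ℂ) ≠ 0 := by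
    intro P hP i hi h
    have h1 := mul_norm_le_quarter hd hP
    have h2 : d * P = ((k - i : ℕ) : ℂ) := by
      rw [Nat.cast_sub hi.le]; linear_combination h
    have h3 : ‖d * P‖ = ((k - i : ℕ) : ℝ) := by rw [h2, norm_natCast]
    rw [norm_mul, norm_natCast] at h3
    have h4 : (1 : ℝ) ≤ ((k - i : ℕ) : ℝ) := by
      have : 1 ≤ k - i := by omega
      exact_mod_cast this
    linarith
  refine ⟨fun P => Gamma (1 + d * P) * (d * ∏ i ∈ Finset.range k, (-k + d * P + i : ℂ))⁻¹, ?_, ?_⟩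
  · refine DifferentiableOn.mul ?_ (DifferentiableOn.inv (by fun_prop) ?_)
    · intro P hP
      refine DifferentiableAt.differentiableWithinAt ?_
      refine (differentiableAt_Gamma _ fun m hm => ?_).comp P (f := fun P => 1 + (d : ℂ) * P)
        (by fun_prop)
      have hpos : 0 < (1 + d * P : ℂ).re := by
        apply re_add_mul_pos hd le_rfl (by simpa using hP)
        rw [one_re, div_le_one (Nat.cast_pos.2 hd)]
        exact_mod_cast hd
      rw [hm] at hpos
      simp only [neg_re, natCast_re] at hpos
      linarith [(Nat.cast_nonneg m : (0 : ℝ) ≤ m)]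
    · intro P hP
      exact mul_ne_zero hdc (Finset.prod_ne_zero_iff.2 fun i hi =>
        hne P (by simpa using hP) i (Finset.mem_range.1 hi))
  · intro P hP0 hP
    have h1 := Gamma_add_nat (-k + d * P) (k + 1) (by
      intro i hi
      rcases Nat.lt_succ_iff_lt_or_eq.1 hi with h | rfl
      · exact hne P hP i h
      · rw [add_right_comm, neg_add_cancel, zero_add]
        exact mul_ne_zero hdc hP0)
    rw [Finset.prod_range_succ] at h1
    have e1 : (-k + d * P + (k + 1 : ℕ) : ℂ) = 1 + d * P := by push_cast; ring
    have e2 : (-k + d * P + k : ℂ) = d * P := by ring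
    rw [e1, e2] at h1
    have hprod : ∏ i ∈ Finset.range k, (-k + d * P + i : ℂ) ≠ 0 :=
      Finset.prod_ne_zero_iff.2 fun i hi => hne P hP i (Finset.mem_range.1 hi)
    simp only
    generalize (∏ i ∈ Finset.range k, (-k + d * P + i : ℂ)) = A at h1 hprod ⊢
    rw [h1]
    generalize Gamma (-k + d * P) = G
    field_simp

/-- The poles of the kernel on the right do not contribute to the low coefficients: there the
function has a zero of order at least `#{j | d ∣ M wⱼ} - 1` in `P`. -/
lemma circleCoeff_gwFunction_right (hd : 0 < d) (hwd : ∀ j, w j ≤ d) (a : ℕ) (t : ℂ)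
    (k r : ℕ) (hr : r + 2 ≤ (Finset.univ.filter fun j => d ∣ (k + 1) * w j).card)
    (hw : ∀ j, 0 < w j) :
    circleCoeff (coeffRadius d) r
      (fun P => gammaWeight w d a P * gwFunction w d t ((k + 1 : ℕ) - d * P)) = 0 := by
  have hρ := coeffRadius_pos hd
  have hdc : (d : ℂ) ≠ 0 := Nat.cast_ne_zero.2 hd.ne'
  set S := Finset.univ.filter fun j => d ∣ (k + 1) * w j with hS
  obtain ⟨e, he, he'⟩ := exists_mul_Gamma_eq hd k
  have hg : ∀ j, ∃ g : ℂ → ℂ, Differentiable ℂ g ∧ ∀ P : ℂ,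
      (Gamma (1 - (w j : ℂ) / d * ((k + 1 : ℕ) - d * P)))⁻¹ = (if j ∈ S then P else 1) * g P := by
    intro j
    split_ifs with hj
    · obtain ⟨K, hK⟩ := (Finset.mem_filter.1 hj).2
      have hK0 : 0 < K := by
        rcases Nat.eq_zero_or_pos K with rfl | h
        · have : 0 < (k + 1) * w j := Nat.mul_pos (Nat.succ_pos k) (hw j)
          rw [mul_zero] at hK
          omega
        · exact h
      obtain ⟨g, hg, hg'⟩ := exists_eq_mul_of_inv_Gamma (w j) (K - 1)
      refine ⟨g, hg, fun P => ?_⟩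
      rw [← hg']
      congr 2
      have hKc : ((k : ℂ) + 1) * w j = d * K := by exact_mod_cast hK
      rw [Nat.cast_sub hK0]
      push_cast
      field_simp
      linear_combination -hKc
    · refine ⟨fun P => (Gamma (1 - (w j : ℂ) / d * ((k + 1 : ℕ) - d * P)))⁻¹, ?_, fun P => by simp⟩
      exact differentiable_one_div_Gamma.comp
        (by fun_prop : Differentiable ℂ fun P : ℂ => 1 - (w j : ℂ) / d * ((k + 1 : ℕ) - d * P))
  choose g hg hg' using hg
  have hd' : DifferentiableOn ℂ (fun P => gammaWeight w d a P *
      (cexp (((k + 1 : ℕ) - d * P) * log t) * (e P * ∏ j, g j P)))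
      (Metric.closedBall 0 (coeffRadius d)) := by
    refine (differentiableOn_gammaWeight hd hwd a).mul (DifferentiableOn.mul (by fun_prop)
      (he.mul ?_))
    exact DifferentiableOn.fun_finsetProd fun j _ => (hg j).differentiableOn
  rw [← circleCoeff_pow_mul_eq_zero hρ (r := r) (n := S.card - 1) (by omega) hd']
  refine circleCoeff_congr hρ r fun P hP => ?_
  have hP0 : P ≠ 0 := by
    rintro rfl
    rw [norm_zero] at hP
    exact hρ.ne hP
  unfold gwFunction gammaQuotient
  have e1 : (1 - (((k + 1 : ℕ) : ℂ) - d * P)) = -k + d * P := by push_cast; ring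
  have hprod : ∏ j, (Gamma (1 - (w j : ℂ) / d * ((k + 1 : ℕ) - d * P)))⁻¹ =
      P ^ S.card * ∏ j, g j P := by
    simp only [hg', Finset.prod_mul_distrib]
    congr 1
    rw [Finset.prod_ite]
    simp
  rw [e1, hprod, ← he' P hP0 hP.le]
  obtain ⟨n, hn⟩ : ∃ n, S.card = n + 1 := ⟨S.card - 1, by omega⟩
  rw [hn, Nat.add_sub_cancel]
  ring

/-- The residue of the Mellin–Barnes integrand at `s = m + 1` without the factor coming from the
kernel. -/
def narrowCoeff (w : Fin N → ℕ) (d : ℕ) (t : ℂ) (m : ℕ) : ℂ :=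
  cexp ((m + 1) * log t) * ((-1) ^ (m + 1) / (m ! : ℂ)) *
    (∏ j, (Gamma (1 - (w j : ℂ) / d * (m + 1)))⁻¹)

/-- The coefficient of `P ^ r` of the weighted kernel at `s = m + 1`. -/
def kernelCoeff (w : Fin N → ℕ) (d a r m : ℕ) : ℂ :=
  circleCoeff (coeffRadius d) r fun P => gammaWeight w d a P * periodicKernel d a P (m + 1)

lemma kernelCoeff_add_mul (hd : 0 < d) (a r k l : ℕ) :
    kernelCoeff w d a r (d * l + k) = kernelCoeff w d a r k := by
  unfold kernelCoeff
  refine circleCoeff_congr (coeffRadius_pos hd) r fun P _ => ?_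
  congr 1
  rw [← periodicKernel_add_mul hd a P (k + 1) l]
  congr 1
  push_cast
  ring

lemma ne_zero_of_mem_sphere (hd : 0 < d) {P : ℂ} (hP : P ∈ Metric.sphere (0 : ℂ) (coeffRadius d)) :
    P ≠ 0 := by
  rintro rfl
  have := coeffRadius_pos hd
  simp at hP
  linarith

lemma continuousOn_gwFunction_mul (hd : 0 < d) (hwd : ∀ j, w j ≤ d) (a : ℕ) (t : ℂ) (n : ℤ) :
    ContinuousOn (fun P => gammaWeight w d a P * gwFunction w d t (d * n - a - d * P))
      (Metric.sphere 0 (coeffRadius d)) := by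
  refine ((differentiableOn_gammaWeight hd hwd a).continuousOn.mono
    Metric.sphere_subset_closedBall).mul fun P hP => ContinuousAt.continuousWithinAt ?_
  have hP0 := ne_zero_of_mem_sphere hd hP
  have hP' : ‖P‖ ≤ coeffRadius d := by
    rw [mem_sphere_zero_iff_norm] at hP; exact hP.le
  have h1 : DifferentiableAt ℂ (gwFunction w d t) (d * n - a - d * P) := by
    refine (by fun_prop : DifferentiableAt ℂ (fun s => cexp (s * log t)) _).mul
      (differentiableAt_gammaQuotient fun m => ?_)
    have := int_mul_sub_ne_nat (a := a) hP0 hd (mul_norm_le_quarter hd hP') n ((m + 1 : ℕ) : ℤ)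
    push_cast at this
    exact this
  exact h1.continuousAt.comp (f := fun P : ℂ => (d * n - a - d * P : ℂ)) (by fun_prop)

lemma continuousOn_kernel_mul (hd : 0 < d) (hwd : ∀ j, w j ≤ d) (a m : ℕ) :
    ContinuousOn (fun P => gammaWeight w d a P * periodicKernel d a P (m + 1))
      (Metric.sphere 0 (coeffRadius d)) := by
  refine ((differentiableOn_gammaWeight hd hwd a).continuousOn.mono
    Metric.sphere_subset_closedBall).mul ?_
  unfold periodicKernel
  refine ContinuousOn.inv₀ (by fun_prop) fun P hP => ?_
  rw [sub_ne_zero, Ne, cexp_kernel_eq_one_iff hd]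
  rintro ⟨n, hn⟩
  have hP' : ‖P‖ ≤ coeffRadius d := by
    rw [mem_sphere_zero_iff_norm] at hP; exact hP.le
  have := int_mul_sub_ne_nat (a := a) (ne_zero_of_mem_sphere hd hP) hd
    (mul_norm_le_quarter hd hP') n ((m + 1 : ℕ) : ℤ)
  push_cast at this
  exact this hn.symm

/-- The coefficient of `P ^ r` of the contour shift. -/
theorem exists_norm_coeff_sum_le (hw : ∀ j, 0 < w j) (hκ : ∑ j, w j < d) {a : ℕ} (ha : a < d)
    {r : ℕ} (hr : r + 2 ≤ (Finset.univ.filter fun j => d ∣ a * w j).card) (L : ℕ) :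
    ∃ C : ℝ, 0 < C ∧ ∀ (m : ℕ) (t : ℂ), t ∈ goodSector w d →
      ‖(∑ l ∈ Finset.range L, circleCoeff (coeffRadius d) r
          (gwEval w d t (((a + d * l : ℕ) : ℚ) / d))) +
        2 * Real.pi * I / d * ∑ i ∈ Finset.range (d * (m + 1)),
          narrowCoeff w d t i * kernelCoeff w d a r i‖ ≤
      C * ‖t‖ ^ (1 / 2 - d * L : ℝ) +
        C * (((1 + d) ^ d) ^ m / m !) * ‖t‖ ^ (1 / 2 + d * (m + 1 : ℕ) : ℝ) := by
  have hd : 0 < d := by omega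
  have hwd : ∀ j, w j ≤ d := fun j =>
    (Finset.single_le_sum (fun i _ => Nat.zero_le (w i)) (Finset.mem_univ j)).trans hκ.le
  have hρ := coeffRadius_pos hd
  obtain ⟨C, hC, h⟩ := exists_norm_sum_residues_le hw hκ ha L
  obtain ⟨B, hB⟩ := (isCompact_sphere (0 : ℂ) (coeffRadius d)).exists_bound_of_continuousOn
    ((differentiableOn_gammaWeight hd hwd a).continuousOn.mono Metric.sphere_subset_closedBall)
  refine ⟨(|B| + 1) * C / coeffRadius d ^ r, by positivity, fun m t ht => ?_⟩
  set G₁ : ℕ → ℂ → ℂ := fun l P =>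
    gammaWeight w d a P * gwFunction w d t (-(a + d * l : ℕ) - d * P) with hG₁
  set G₂ : ℕ → ℂ → ℂ := fun l P =>
    gammaWeight w d a P * gwFunction w d t (d * (l + 1 : ℕ) - a - d * P) with hG₂
  set G₃ : ℕ → ℂ → ℂ := fun i P =>
    narrowCoeff w d t i * (gammaWeight w d a P * periodicKernel d a P (i + 1)) with hG₃
  have c₁ : ∀ l, ContinuousOn (G₁ l) (Metric.sphere 0 (coeffRadius d)) := by
    intro l
    convert continuousOn_gwFunction_mul hd hwd a t (-l) using 4
    push_cast; ring
  have c₂ : ∀ l, ContinuousOn (G₂ l) (Metric.sphere 0 (coeffRadius d)) := by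
    intro l
    convert continuousOn_gwFunction_mul hd hwd a t (l + 1 : ℕ) using 4
    push_cast; ring
  have c₃ : ∀ i, ContinuousOn (G₃ i) (Metric.sphere 0 (coeffRadius d)) := fun i =>
    continuousOn_const.mul (continuousOn_kernel_mul hd hwd a i)
  have v₁ : ∀ l, circleCoeff (coeffRadius d) r (G₁ l) =
      circleCoeff (coeffRadius d) r (gwEval w d t (((a + d * l : ℕ) : ℚ) / d)) := by
    intro l
    refine circleCoeff_congr hρ r fun P hP => ?_
    simp only [hG₁]
    rw [mul_comm, gwFunction_mul_gammaWeight hd hwd t a l hP.le]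
  have v₂ : ∀ l, circleCoeff (coeffRadius d) r (G₂ l) = 0 := by
    intro l
    have hal : a < d * (l + 1) := lt_of_lt_of_le ha (Nat.le_mul_of_pos_right d (Nat.succ_pos l))
    set k := d * (l + 1) - a - 1 with hk
    have hk1 : k + 1 = d * (l + 1) - a := by omega
    rw [← circleCoeff_gwFunction_right hd hwd a t k r ?_ hw]
    · refine circleCoeff_congr hρ r fun P _ => ?_
      simp only [hG₂, hk1]
      rw [Nat.cast_sub hal.le]
      push_cast
      rfl
    · refine hr.trans_eq (congrArg Finset.card (Finset.filter_congr fun j _ => ?_))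
      rw [hk1, Nat.sub_mul, mul_assoc]
      refine (Nat.dvd_sub_iff_right ?_ (Dvd.intro _ rfl)).symm
      rw [← mul_assoc]
      exact Nat.mul_le_mul_right _ hal.le
  have v₃ : ∀ i, circleCoeff (coeffRadius d) r (G₃ i) =
      narrowCoeff w d t i * kernelCoeff w d a r i := fun i => circleCoeff_const_mul r _ _
  have key : circleCoeff (coeffRadius d) r (fun P => (∑ l ∈ Finset.range L, G₁ l P) +
      (∑ l ∈ Finset.range (m + 1), G₂ l P) +
      2 * Real.pi * I / d * ∑ i ∈ Finset.range (d * (m + 1)), G₃ i P) =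
      (∑ l ∈ Finset.range L, circleCoeff (coeffRadius d) r
          (gwEval w d t (((a + d * l : ℕ) : ℚ) / d))) +
        2 * Real.pi * I / d * ∑ i ∈ Finset.range (d * (m + 1)),
          narrowCoeff w d t i * kernelCoeff w d a r i := by
    have s₁ := continuousOn_finsetSum (Finset.range L) fun l _ => c₁ l
    have s₂ := continuousOn_finsetSum (Finset.range (m + 1)) fun l _ => c₂ l
    have s₃ := continuousOn_finsetSum (Finset.range (d * (m + 1))) fun l _ => c₃ l
    have k₁ := circleCoeff_add hρ r (g := fun P => (∑ l ∈ Finset.range L, G₁ l P) +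
      (∑ l ∈ Finset.range (m + 1), G₂ l P))
      (h := fun P => 2 * Real.pi * I / d * ∑ i ∈ Finset.range (d * (m + 1)), G₃ i P)
      (s₁.add s₂) (continuousOn_const.mul s₃)
    have k₂ := circleCoeff_add hρ r s₁ s₂
    refine k₁.trans ?_
    rw [k₂, circleCoeff_const_mul, circleCoeff_sum hρ _ r fun l _ => c₁ l,
      circleCoeff_sum hρ _ r fun l _ => c₂ l, circleCoeff_sum hρ _ r fun l _ => c₃ l]
    simp only [v₁, v₂, v₃, Finset.sum_const_zero, add_zero]
  rw [← key]
  refine (norm_circleCoeff_le hρ r (B := (|B| + 1) * (C * ‖t‖ ^ (1 / 2 - d * L : ℝ) +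
        C * (((1 + d) ^ d) ^ m / m !) * ‖t‖ ^ (1 / 2 + d * (m + 1 : ℕ) : ℝ))) ?_).trans_eq ?_
  · intro P hP
    have hPs : P ∈ Metric.sphere (0 : ℂ) (coeffRadius d) := by simpa using hP
    have h1 := h m P t (ne_zero_of_mem_sphere hd hPs) (mul_norm_le_quarter hd hP.le) ht
    have h2 : ‖gammaWeight w d a P‖ ≤ |B| + 1 :=
      (hB P hPs).trans ((le_abs_self B).trans (by linarith))
    have e : (∑ l ∈ Finset.range L, G₁ l P) + (∑ l ∈ Finset.range (m + 1), G₂ l P) +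
        2 * Real.pi * I / d * ∑ i ∈ Finset.range (d * (m + 1)), G₃ i P =
        gammaWeight w d a P *
        ((∑ l ∈ Finset.range L, gwFunction w d t (-(a + d * l : ℕ) - d * P)) +
        (∑ l ∈ Finset.range (m + 1), gwFunction w d t (d * (l + 1 : ℕ) - a - d * P)) +
        2 * Real.pi * I / d * ∑ i ∈ Finset.range (d * (m + 1)), narrowResidue w d a P t i) := by
      have e3 : ∀ i, G₃ i P = gammaWeight w d a P * narrowResidue w d a P t i := by
        intro i
        simp only [hG₃, narrowCoeff, narrowResidue]
        ring
      simp only [e3, hG₁, hG₂, ← Finset.mul_sum]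
      ring
    rw [e, norm_mul]
    gcongr
  · ring

end Extraction

/-! ### The narrow sectors and the coefficients of the FJRW `I`-function -/

lemma rootOfUnity_pow_eq_one_iff {M d c : ℕ} (hd : 0 < d) :
    rootOfUnity ((M : ℚ) / d) ^ c = 1 ↔ d ∣ M * c := by
  have hdc : (d : ℂ) ≠ 0 := Nat.cast_ne_zero.2 hd.ne'
  unfold rootOfUnity
  rw [← exp_nat_mul, exp_eq_one_iff]
  constructor
  · rintro ⟨n, hn⟩
    have h1 : (2 * Real.pi * I) * ((M : ℂ) * c - n * d) = 0 := by
      push_cast at hn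
      field_simp at hn
      linear_combination (2 * Real.pi * I) * hn
    have h2 := (mul_eq_zero.1 h1).resolve_left two_pi_I_ne_zero
    have h3 : ((M * c : ℕ) : ℤ) = d * n := by
      have : ((M : ℂ) * c) = d * n := by linear_combination h2
      exact_mod_cast this
    exact Int.natCast_dvd_natCast.1 ⟨n, h3⟩
  · rintro ⟨n, hn⟩
    refine ⟨n, ?_⟩
    have h1 : (M : ℂ) * c = d * n := by exact_mod_cast hn
    push_cast
    field_simp
    linear_combination h1

lemma fixedSpace_eq_bot_iff {N : ℕ} (w : Fin N → ℕ) (lam : ℂ) :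
    fixedSpace w lam = ⊥ ↔ ∀ j, lam ^ w j ≠ 1 := by
  rw [Submodule.eq_bot_iff]
  constructor
  · intro h j hj
    have := h (Pi.single j 1) (by
      intro i
      rcases eq_or_ne i j with rfl | hij
      · rw [hj, one_mul]
      · rw [Pi.single_eq_of_ne hij, mul_zero])
    have := congrFun this j
    simp at this
  · intro h x hx
    funext j
    have h1 : (lam ^ w j - 1) * x j = 0 := by rw [sub_mul, hx j, one_mul, sub_self]
    exact (mul_eq_zero.1 h1).resolve_left (sub_ne_zero.2 (h j))

section FJRW

variable {N : ℕ} {w : Fin N → ℕ} {d : ℕ}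

lemma fixedSpace_eq_bot_iff_not_dvd (hd : 0 < d) (k : ℕ) :
    fixedSpace w (rootOfUnity ((k + 1 : ℚ) / d)) = ⊥ ↔ ∀ j, ¬ d ∣ (k + 1) * w j := by
  rw [fixedSpace_eq_bot_iff]
  refine forall_congr' fun j => not_congr ?_
  have := rootOfUnity_pow_eq_one_iff (M := k + 1) (c := w j) hd
  push_cast at this
  exact this

instance : Finite (Nar w d) := inferInstanceAs (Finite (Subtype _))

instance : Fintype (Nar w d) := Fintype.ofFinite _

lemma Nar.not_dvd (hd : 0 < d) (k : Nar w d) (j : Fin N) : ¬ d ∣ ((k.1 : ℕ) + 1) * w j :=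
  (fixedSpace_eq_bot_iff_not_dvd hd k.1).1 k.2 j

lemma sum_range_eq_sum_nar (hd : 0 < d) (f : ℕ → ℂ)
    (hf : ∀ k < d, (∃ j, d ∣ (k + 1) * w j) → f k = 0) :
    ∑ k ∈ Finset.range d, f k = ∑ k : Nar w d, f k.1 := by
  classical
  rw [Finset.sum_range]
  have h1 : ∑ k : Nar w d, f k.1 =
      ∑ k ∈ Finset.univ.filter (fun k : Fin d => ∀ j, ¬ d ∣ ((k : ℕ) + 1) * w j), f k :=
    (Finset.sum_subtype (Finset.univ.filter fun k : Fin d => ∀ j, ¬ d ∣ ((k : ℕ) + 1) * w j)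
      (p := fun k : Fin d => fixedSpace w (rootOfUnity (((k : ℕ) + 1 : ℚ) / d)) = ⊥)
      (F := inferInstanceAs (Fintype (Nar w d)))
      (fun _ => by rw [fixedSpace_eq_bot_iff_not_dvd hd]; simp) fun k => f k).symm
  rw [h1, Finset.sum_filter]
  refine Finset.sum_congr rfl fun k _ => ?_
  split_ifs with h
  · rfl
  · push Not at h
    exact hf k k.2 h

/-- The absolute value of the coefficient of `t ^ M` in the FJRW `I`-function, up to a factor which
depends on the sector only. -/
def fjrwCoeff (w : Fin N → ℕ) (d M : ℕ) : ℝ :=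
  (∏ j, Real.Gamma ((w j : ℝ) / d * M)) / ((M - 1)! : ℝ)

/-- The factor of the FJRW `I`-function which depends on the sector only. -/
def fjrwPhase (w : Fin N → ℕ) (d k : ℕ) : ℂ :=
  -(-1) ^ k * ∏ j, ((-1) ^ ⌊charge w d j * k⌋₊ /
    Gamma ((charge w d j + Int.fract (charge w d j * k) : ℚ) : ℂ))

lemma fjrwPhase_ne_zero (hd : 0 < d) (hw : ∀ j, 0 < w j) (k : ℕ) : fjrwPhase w d k ≠ 0 := by
  unfold fjrwPhase
  refine mul_ne_zero (by simp) (Finset.prod_ne_zero_iff.2 fun j _ => div_ne_zero (by simp) ?_)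
  apply Gamma_ne_zero_of_re_pos
  rw [ratCast_re]
  have h1 : 0 < charge w d j := div_pos (Nat.cast_pos.2 (hw j)) (Nat.cast_pos.2 hd)
  exact_mod_cast add_pos_of_pos_of_nonneg h1 (Int.fract_nonneg _)

lemma fjrwCoeff_pos (hd : 0 < d) (hw : ∀ j, 0 < w j) {M : ℕ} (hM : 0 < M) :
    0 < fjrwCoeff w d M := by
  refine div_pos (Finset.prod_pos fun j _ => Real.Gamma_pos_of_pos ?_)
    (Nat.cast_pos.2 (Nat.factorial_pos _))
  have := hw j
  positivity

lemma fjrwTerm_eq (hd : 0 < d) (t : ℂ) (k l : ℕ) :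
    fjrwTerm w d t (-1) k l = fjrwPhase w d k *
      (((-1) ^ (d + ∑ j, w j)) ^ l * t ^ (d * l + k + 1) * fjrwCoeff w d (d * l + k + 1)) := by
  have hdq : (d : ℚ) ≠ 0 := Nat.cast_ne_zero.2 hd.ne'
  have hfl : ∀ j, ⌊charge w d j * (d * l + k : ℕ)⌋₊ = w j * l + ⌊charge w d j * k⌋₊ := by
    intro j
    have : charge w d j * (d * l + k : ℕ) = charge w d j * k + (w j * l : ℕ) := by
      unfold charge; push_cast; field_simp; ring
    rw [this, Nat.floor_add_natCast (by unfold charge; positivity), add_comm]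
  have hG : ∀ j, Gamma ((charge w d j * (d * l + k + 1 : ℕ) : ℚ) : ℂ) =
      (Real.Gamma ((w j : ℝ) / d * (d * l + k + 1 : ℕ)) : ℝ) := by
    intro j
    rw [← Gamma_ofReal]
    congr 1
    unfold charge
    push_cast
    ring
  unfold fjrwTerm fjrwPhase fjrwCoeff
  simp only [hfl, hG, pow_add, pow_mul, Finset.prod_mul_distrib, Finset.prod_div_distrib,
    Nat.add_sub_cancel, ofReal_div, ofReal_prod, ofReal_natCast]
  have hprod : ∏ j, ((-1 : ℂ) ^ w j) ^ l = ((-1) ^ ∑ j, w j) ^ l := by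
    rw [Finset.prod_pow, Finset.prod_pow_eq_pow_sum]
  have h1 : ∀ n : ℕ, ((-1 : ℂ) ^ n)⁻¹ = (-1) ^ n := fun n => by
    rw [← inv_pow, inv_neg, inv_one]
  have h2 : (((-1 : ℂ) ^ d) ^ l)⁻¹ = ((-1) ^ d) ^ l := by rw [← inv_pow, h1]
  rw [hprod]
  simp only [div_eq_mul_inv, mul_inv, h1, h2, mul_pow]
  ring

lemma narrowCoeff_eq_zero (hd : 0 < d) (hw : ∀ j, 0 < w j) (t : ℂ) {k : ℕ}
    (hk : ∃ j, d ∣ (k + 1) * w j) : narrowCoeff w d t k = 0 := by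
  obtain ⟨j, n, hn⟩ := hk
  have hdc : (d : ℂ) ≠ 0 := Nat.cast_ne_zero.2 hd.ne'
  have hn0 : 0 < n := by
    rcases Nat.eq_zero_or_pos n with rfl | h
    · have : 0 < (k + 1) * w j := Nat.mul_pos (Nat.succ_pos k) (hw j)
      omega
    · exact h
  unfold narrowCoeff
  refine mul_eq_zero_of_right _ (Finset.prod_eq_zero (Finset.mem_univ j) ?_)
  have : (1 - (w j : ℂ) / d * (k + 1)) = -((n - 1 : ℕ) : ℂ) := by
    have h1 : ((k : ℂ) + 1) * w j = d * n := by exact_mod_cast hn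
    rw [Nat.cast_sub hn0]
    push_cast
    field_simp
    linear_combination -h1
  rw [this, Gamma_neg_nat_eq_zero, inv_zero]

/-- The ratio of the residues of the Mellin–Barnes integrand to the terms of the FJRW
`I`-function. -/
def matchCoeff (w : Fin N → ℕ) (d k : ℕ) : ℂ :=
  (-1) ^ (k + 1) * (∏ j, (sin (Real.pi * ((w j : ℂ) / d * (k + 1))) / Real.pi)) /
    fjrwPhase w d k

lemma sin_pi_mul_div_ne_zero (hd : 0 < d) {k c : ℕ} (h : ¬ d ∣ (k + 1) * c) :
    sin (Real.pi * ((c : ℂ) / d * (k + 1))) ≠ 0 := by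
  have hdc : (d : ℂ) ≠ 0 := Nat.cast_ne_zero.2 hd.ne'
  have hpi : (Real.pi : ℂ) ≠ 0 := ofReal_ne_zero.2 Real.pi_ne_zero
  rw [sin_ne_zero_iff]
  intro n hn
  apply h
  have h1 : ((k : ℂ) + 1) * c = d * n := by
    field_simp at hn
    linear_combination hn
  have h2 : (((k + 1) * c : ℕ) : ℤ) = d * n := by exact_mod_cast h1
  exact Int.natCast_dvd_natCast.1 ⟨n, h2⟩

lemma narrowCoeff_eq_matchCoeff_mul (hd : 0 < d) (hw : ∀ j, 0 < w j) {t : ℂ} (ht : t ≠ 0) {k : ℕ}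
    (hk : ∀ j, ¬ d ∣ (k + 1) * w j) (l : ℕ) :
    narrowCoeff w d t (d * l + k) = matchCoeff w d k * fjrwTerm w d t (-1) k l := by
  have hdc : (d : ℂ) ≠ 0 := Nat.cast_ne_zero.2 hd.ne'
  have hph := fjrwPhase_ne_zero hd hw k
  rw [fjrwTerm_eq hd]
  have hsin : ∀ j, sin (Real.pi * ((w j : ℂ) / d * ((d * l + k : ℕ) + 1))) =
      ((-1) ^ w j) ^ l * sin (Real.pi * ((w j : ℂ) / d * (k + 1))) := by
    intro j
    have : Real.pi * ((w j : ℂ) / d * ((d * l + k : ℕ) + 1)) =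
        Real.pi * ((w j : ℂ) / d * (k + 1)) + (w j * l : ℕ) * Real.pi := by
      push_cast; field_simp; ring
    rw [this, sin_antiperiodic.add_nat_mul_eq, pow_mul]
  have hG : ∀ j, (Gamma (1 - (w j : ℂ) / d * ((d * l + k : ℕ) + 1)))⁻¹ =
      (Real.Gamma ((w j : ℝ) / d * (d * l + k + 1 : ℕ)) : ℝ) * ((-1) ^ w j) ^ l *
        (sin (Real.pi * ((w j : ℂ) / d * (k + 1))) / Real.pi) := by
    intro j
    have e : (w j : ℂ) / d * ((d * l + k : ℕ) + 1) =
        (((w j : ℝ) / d * (d * l + k + 1 : ℕ) : ℝ) : ℂ) := by push_cast; ring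
    have hpos : 0 < (w j : ℝ) / d * (d * l + k + 1 : ℕ) := by have := hw j; positivity
    rw [inv_Gamma_one_sub, hsin, e, Gamma_ofReal]
    · ring
    · rw [e, Gamma_ofReal]
      exact ofReal_ne_zero.2 (Real.Gamma_pos_of_pos hpos).ne'
    · rw [hsin]
      exact mul_ne_zero (by simp) (sin_pi_mul_div_ne_zero hd (hk j))
  unfold narrowCoeff matchCoeff fjrwCoeff
  have hexp : cexp (((d * l + k : ℕ) + 1) * log t) = t ^ (d * l + k + 1) := by
    rw [← Nat.cast_succ, exp_nat_mul, exp_log ht]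
  rw [hexp]
  simp only [hG, Finset.prod_mul_distrib, Nat.add_sub_cancel, ofReal_div, ofReal_prod,
    ofReal_natCast, Finset.prod_pow, Finset.prod_pow_eq_pow_sum]
  rw [div_mul_eq_mul_div, mul_left_comm _ (fjrwPhase w d k), mul_div_cancel_left₀ _ hph]
  rw [pow_add (-1 : ℂ) d, mul_pow, pow_succ (-1 : ℂ) (d * l + k), pow_add (-1 : ℂ) (d * l), pow_mul,
    pow_succ (-1 : ℂ) k]
  ring

/-- Since `κ > 0`, consecutive coefficients in a residue class have ratio tending to zero; this is why
the FJRW `I`-function is entire. -/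
lemma fjrwCoeff_add_le (hd : 0 < d) (hw : ∀ j, 0 < w j) (hκ : ∑ j, w j < d) {M : ℕ} (hM : 0 < M) :
    fjrwCoeff w d (M + d) ≤ (1 + d) ^ d / M * fjrwCoeff w d M := by
  have hdr : (0 : ℝ) < d := Nat.cast_pos.2 hd
  have hMr : (1 : ℝ) ≤ M := by exact_mod_cast hM
  have h1 : ∏ j, Real.Gamma ((w j : ℝ) / d * (M + d : ℕ)) ≤
      (∏ j, Real.Gamma ((w j : ℝ) / d * M)) * ((M : ℝ) * (1 + d)) ^ ∑ j, w j := by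
    rw [← Finset.prod_pow_eq_pow_sum, ← Finset.prod_mul_distrib]
    have hx : ∀ j, 0 < (w j : ℝ) / d * M := fun j => by have := hw j; positivity
    refine Finset.prod_le_prod (fun j _ => ?_) fun j _ => ?_
    · exact (Real.Gamma_pos_of_pos (by have := hw j; positivity)).le
    · have hwd : (w j : ℝ) ≤ d := by
        have := (Finset.single_le_sum (fun i _ => Nat.zero_le (w i)) (Finset.mem_univ j)).trans hκ.le
        exact_mod_cast this
      have e : (w j : ℝ) / d * (M + d : ℕ) = (w j : ℝ) / d * M + w j := by
        push_cast; field_simp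
      have h2 : ∀ n : ℕ, n ≤ w j → Real.Gamma ((w j : ℝ) / d * M + n) ≤
          Real.Gamma ((w j : ℝ) / d * M) * ((M : ℝ) * (1 + d)) ^ n := by
        intro n
        induction n with
        | zero => simp
        | succ n ih =>
          intro hn
          have hxn : 0 < (w j : ℝ) / d * M + n := by have := hx j; positivity
          rw [Nat.cast_succ, ← add_assoc, Real.Gamma_add_one hxn.ne', pow_succ, mul_comm, ← mul_assoc]
          refine mul_le_mul (ih (by omega)) ?_ hxn.le (by
            have := Real.Gamma_pos_of_pos (hx j)
            positivity)
          have h3 : (w j : ℝ) / d * M ≤ M := by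
            have : (w j : ℝ) / d ≤ 1 := (div_le_one hdr).2 hwd
            nlinarith
          have h4 : (n : ℝ) ≤ d := by
            have : (n : ℝ) + 1 ≤ w j := by exact_mod_cast hn
            linarith
          nlinarith
      rw [e]
      exact h2 (w j) le_rfl
  have h2 : (((M - 1)! : ℕ) : ℝ) * (M : ℝ) ^ d ≤ ((M + d - 1)! : ℕ) := by
    have := Nat.factorial_mul_pow_le_factorial (m := M - 1) (n := d)
    rw [Nat.sub_add_cancel hM, show M - 1 + d = M + d - 1 by omega] at this
    exact_mod_cast this
  have h3 : ((M : ℝ) * (1 + d)) ^ ∑ j, w j ≤ (M : ℝ) ^ d * ((1 + d) ^ d / M) := by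
    calc ((M : ℝ) * (1 + d)) ^ ∑ j, w j ≤ ((M : ℝ) * (1 + d)) ^ (d - 1) :=
          pow_le_pow_right₀ (by nlinarith) (by omega)
      _ = M ^ (d - 1) * (1 + d) ^ (d - 1) := mul_pow _ _ _
      _ ≤ M ^ (d - 1) * (1 + d) ^ d := by
          gcongr
          · linarith
          · omega
      _ = _ := by
          have : (M : ℝ) ^ d = M ^ (d - 1) * M := by rw [← pow_succ, Nat.sub_add_cancel hd]
          rw [this]
          field_simp
  unfold fjrwCoeff
  have hf : (0 : ℝ) < ((M - 1)! : ℕ) := Nat.cast_pos.2 (Nat.factorial_pos _)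
  rw [div_le_iff₀ (Nat.cast_pos.2 (Nat.factorial_pos _))]
  have hG : 0 ≤ ∏ j, Real.Gamma ((w j : ℝ) / d * M) := Finset.prod_nonneg fun j _ =>
    (Real.Gamma_pos_of_pos (by have := hw j; positivity)).le
  calc _ ≤ (∏ j, Real.Gamma ((w j : ℝ) / d * M)) * ((M : ℝ) ^ d * ((1 + d) ^ d / M)) :=
        h1.trans (mul_le_mul_of_nonneg_left h3 hG)
    _ = (1 + d) ^ d / M * ((∏ j, Real.Gamma ((w j : ℝ) / d * M)) / ((M - 1)! : ℕ)) *
        (((M - 1)! : ℕ) * (M : ℝ) ^ d) := by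
        generalize (∏ j, Real.Gamma ((w j : ℝ) / d * M)) = A
        field_simp
    _ ≤ _ := by
        gcongr

lemma summable_fjrwCoeff (hd : 0 < d) (hw : ∀ j, 0 < w j) (hκ : ∑ j, w j < d) (x : ℝ) (k : ℕ) :
    Summable fun l : ℕ => x ^ (d * l + k + 1) * fjrwCoeff w d (d * l + k + 1) := by
  refine summable_of_ratio_norm_eventually_le (r := 1 / 2) (by norm_num) ?_
  filter_upwards [eventually_ge_atTop ⌈2 * |x| ^ d * (1 + d) ^ d⌉₊] with l hl
  have hl' := (Nat.le_ceil _).trans (Nat.cast_le.2 hl : _ ≤ (l : ℝ))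
  have hM : (l : ℝ) ≤ (d * l + k + 1 : ℕ) := by
    have : l ≤ d * l + k + 1 := by nlinarith
    exact_mod_cast this
  set M := d * l + k + 1 with hMdef
  have hM0 : 0 < M := by omega
  have e : d * (l + 1) + k + 1 = M + d := by rw [hMdef]; ring
  have h0 := fjrwCoeff_pos hd hw hM0
  have hMr : (0 : ℝ) < M := Nat.cast_pos.2 hM0
  rw [e, norm_mul, norm_mul, norm_pow, norm_pow, Real.norm_eq_abs x, pow_add,
    Real.norm_of_nonneg (fjrwCoeff_pos hd hw (by omega : 0 < M + d)).le, Real.norm_of_nonneg h0.le]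
  calc |x| ^ M * |x| ^ d * fjrwCoeff w d (M + d) ≤
        |x| ^ M * |x| ^ d * ((1 + d) ^ d / M * fjrwCoeff w d M) := by
        gcongr; exact fjrwCoeff_add_le hd hw hκ hM0
    _ = |x| ^ M * fjrwCoeff w d M * (|x| ^ d * (1 + d) ^ d / M) := by ring
    _ ≤ |x| ^ M * fjrwCoeff w d M * (1 / 2) := by
        refine mul_le_mul_of_nonneg_left ?_ (by positivity)
        rw [div_le_iff₀ hMr]
        linarith
    _ = _ := by ring

lemma summable_fjrwTerm (hd : 0 < d) (hw : ∀ j, 0 < w j) (hκ : ∑ j, w j < d) (t : ℂ) (k : ℕ) :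
    Summable fun l : ℕ => fjrwTerm w d t (-1) k l := by
  simp only [fjrwTerm_eq hd]
  refine Summable.mul_left _ (Summable.of_norm ?_)
  refine (summable_fjrwCoeff hd hw hκ ‖t‖ k).congr fun l => ?_
  rw [norm_mul, norm_mul, norm_pow, norm_pow, norm_pow, norm_neg, norm_one, one_pow, one_pow, one_mul,
    norm_real, Real.norm_of_nonneg (fjrwCoeff_pos hd hw (Nat.succ_pos _)).le]

end FJRW

/-! ### The asymptotic expansion of the FJRW `I`-function -/

section Expansion

variable {N : ℕ} {w : Fin N → ℕ} {d : ℕ}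

lemma sum_range_mul_eq {E : Type*} [AddCommMonoid E] (d n : ℕ) (f : ℕ → E) :
    ∑ i ∈ Finset.range (d * n), f i = ∑ k ∈ Finset.range d, ∑ l ∈ Finset.range n, f (d * l + k) := by
  rw [Finset.sum_comm]
  induction n with
  | zero => simp
  | succ n ih => rw [Nat.mul_succ, Finset.sum_range_add, ih, Finset.sum_range_succ]

/-- The terms of the Gromov–Witten `I`-function are approximated by a linear combination of the
components of the FJRW `I`-function. -/
theorem exists_norm_sum_add_smallIFJRW_le (hw : ∀ j, 0 < w j) (hκ : ∑ j, w j < d) {a : ℕ}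
    (ha : a < d) {r : ℕ} (hr : r + 2 ≤ (Finset.univ.filter fun j => d ∣ a * w j).card) (L : ℕ) :
    ∃ C : ℝ, 0 < C ∧ ∀ t : ℂ, t ∈ goodSector w d →
      ‖(∑ l ∈ Finset.range L, circleCoeff (coeffRadius d) r
          (gwEval w d t (((a + d * l : ℕ) : ℚ) / d))) +
        2 * Real.pi * I / d * ∑ k : Nar w d, matchCoeff w d k.1 * kernelCoeff w d a r k.1 *
          smallIFJRW w d t (-1) k‖ ≤ C * ‖t‖ ^ (1 / 2 - d * L : ℝ) := by
  have hd : 0 < d := by omega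
  obtain ⟨C, hC, h⟩ := exists_norm_coeff_sum_le hw hκ ha hr L
  refine ⟨C, hC, fun t ht => ?_⟩
  have ht0 : t ≠ 0 := ht.1
  have hsum : ∀ n, ∑ i ∈ Finset.range (d * n), narrowCoeff w d t i * kernelCoeff w d a r i =
      ∑ k : Nar w d, matchCoeff w d k.1 * kernelCoeff w d a r k.1 *
        ∑ l ∈ Finset.range n, fjrwTerm w d t (-1) k.1 l := by
    intro n
    rw [sum_range_mul_eq, sum_range_eq_sum_nar hd (w := w)]
    · refine Finset.sum_congr rfl fun k _ => ?_
      rw [Finset.mul_sum]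
      refine Finset.sum_congr rfl fun l _ => ?_
      rw [kernelCoeff_add_mul hd, narrowCoeff_eq_matchCoeff_mul hd hw ht0 (k.not_dvd hd)]
      ring
    · rintro k - ⟨j, hj⟩
      refine Finset.sum_eq_zero fun l _ => ?_
      rw [narrowCoeff_eq_zero hd hw t ⟨j, ?_⟩, zero_mul]
      rw [add_assoc, add_mul, mul_assoc]
      exact (Nat.dvd_mul_right _ _).add hj
  have hlim : Tendsto (fun m : ℕ => ∑ i ∈ Finset.range (d * (m + 1)),
      narrowCoeff w d t i * kernelCoeff w d a r i) atTop
      (𝓝 (∑ k : Nar w d, matchCoeff w d k.1 * kernelCoeff w d a r k.1 *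
        smallIFJRW w d t (-1) k)) := by
    simp only [hsum]
    refine tendsto_finsetSum _ fun k _ => Tendsto.const_mul _ ?_
    exact (tendsto_add_atTop_iff_nat 1).2
      (summable_fjrwTerm hd hw hκ t k.1).hasSum.tendsto_sum_nat
  have hrhs : Tendsto (fun m : ℕ => C * ‖t‖ ^ (1 / 2 - d * L : ℝ) +
      C * (((1 + d) ^ d) ^ m / m !) * ‖t‖ ^ (1 / 2 + d * (m + 1 : ℕ) : ℝ)) atTop
      (𝓝 (C * ‖t‖ ^ (1 / 2 - d * L : ℝ) + C * ‖t‖ ^ (1 / 2 + d : ℝ) * 0)) := by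
    refine tendsto_const_nhds.add ?_
    have h1 := FloorSemiring.tendsto_pow_div_factorial_atTop (((1 + d) ^ d : ℝ) * ‖t‖ ^ d)
    refine (h1.const_mul (C * ‖t‖ ^ (1 / 2 + d : ℝ))).congr fun m => ?_
    have e : ‖t‖ ^ (1 / 2 + d * (m + 1 : ℕ) : ℝ) = ‖t‖ ^ (1 / 2 + d : ℝ) * (‖t‖ ^ d) ^ m := by
      rw [← pow_mul, ← Real.rpow_natCast, ← Real.rpow_add (norm_pos_iff.2 ht0)]
      congr 1
      push_cast
      ring
    rw [e, mul_pow]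
    ring
  rw [mul_zero, add_zero] at hrhs
  exact le_of_tendsto_of_tendsto' ((hlim.const_mul _).const_add _).norm hrhs fun m => h m t ht

lemma tendsto_norm_atInftyFrom (D : Set ℂ) :
    Tendsto (fun t : ℂ => ‖t‖) (atInftyFrom D) atTop :=
  tendsto_norm_cobounded_atTop.mono_left inf_le_left

lemma eventually_mem_atInftyFrom (D : Set ℂ) : ∀ᶠ t in atInftyFrom D, t ∈ D :=
  mem_inf_of_right (mem_principal_self D)

lemma isLittleO_inv_pow_of_norm_le {E : Type*} [NormedAddCommGroup E] {D : Set ℂ} {f : ℂ → E}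
    {C x : ℝ} {m : ℕ} (hx : x < -m) (h : ∀ t ∈ D, 1 ≤ ‖t‖ → ‖f t‖ ≤ C * ‖t‖ ^ x) :
    f =o[atInftyFrom D] fun t => (t ^ m)⁻¹ := by
  have h1 : Tendsto (fun t : ℂ => C * ‖t‖ ^ (x + m)) (atInftyFrom D) (𝓝 (C * 0)) := by
    have := (tendsto_rpow_neg_atTop (by linarith : 0 < -(x + m))).comp (tendsto_norm_atInftyFrom D)
    simp only [neg_neg] at this
    exact this.const_mul C
  rw [mul_zero] at h1
  rw [Asymptotics.isLittleO_iff]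
  intro c hc
  filter_upwards [h1.eventually_lt_const hc, eventually_mem_atInftyFrom D,
    (tendsto_norm_atInftyFrom D).eventually_ge_atTop 1] with t h2 h3 h4
  have ht : 0 < ‖t‖ := by linarith
  refine (h t h3 h4).trans ?_
  rw [norm_inv, norm_pow, ← Real.rpow_natCast, ← Real.rpow_neg ht.le]
  calc C * ‖t‖ ^ x = C * ‖t‖ ^ (x + m) * ‖t‖ ^ (-m : ℝ) := by
        rw [mul_assoc, ← Real.rpow_add ht]; ring_nf
    _ ≤ c * ‖t‖ ^ (-m : ℝ) := by gcongr

lemma isLittleO_inv_pow_succ (D : Set ℂ) (m : ℕ) :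
    (fun t : ℂ => (t ^ (m + 1))⁻¹) =o[atInftyFrom D] fun t => (t ^ m)⁻¹ := by
  refine isLittleO_inv_pow_of_norm_le (C := 1) (x := -(m + 1 : ℕ)) (by push_cast; linarith)
    fun t _ ht => ?_
  rw [norm_inv, norm_pow, one_mul, Real.rpow_neg (by linarith), Real.rpow_natCast]

/-- The term of index `m / d` of the Gromov–Witten `I`-function is of size `t ^ (-m)` up to an
arbitrarily small power of `t`. -/
lemma exists_norm_circleCoeff_gwEval_le (hd : 0 < d) (hwd : ∀ j, w j ≤ d) (r m : ℕ) :
    ∃ C : ℝ, ∀ t : ℂ, 1 ≤ ‖t‖ →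
      ‖circleCoeff (coeffRadius d) r (gwEval w d t ((m : ℚ) / d))‖ ≤ C * ‖t‖ ^ (1 / 4 - m : ℝ) := by
  have hρ := coeffRadius_pos hd
  have hdc : (d : ℂ) ≠ 0 := Nat.cast_ne_zero.2 hd.ne'
  have hcont : ContinuousOn (fun P => hyperEval d ((m : ℚ) / d * d) P *
      (∏ j, hyperEval (w j) ((m : ℚ) / d * w j) P)⁻¹) (Metric.sphere 0 (coeffRadius d)) := by
    refine ContinuousOn.mono (DifferentiableOn.continuousOn (𝕜 := ℂ) ?_)
      Metric.sphere_subset_closedBall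
    refine (differentiableOn_hyperEval _ _ _).mul (DifferentiableOn.inv ?_ ?_)
    · exact DifferentiableOn.fun_finsetProd fun j _ => differentiableOn_hyperEval _ _ _
    · intro P hP
      exact Finset.prod_ne_zero_iff.2 fun j _ => hyperEval_ne_zero hd m (hwd j) (by simpa using hP)
  obtain ⟨B, hB⟩ := (isCompact_sphere (0 : ℂ) (coeffRadius d)).exists_bound_of_continuousOn hcont
  refine ⟨Real.exp Real.pi * |B| / coeffRadius d ^ r, fun t ht => ?_⟩
  have ht0 : t ≠ 0 := norm_pos_iff.1 (by linarith)
  refine (norm_circleCoeff_le hρ r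
    (B := ‖t‖ ^ (1 / 4 - m : ℝ) * Real.exp Real.pi * |B|) fun P hP => ?_).trans_eq (by ring)
  have hq := mul_norm_le_quarter hd hP.le
  unfold gwEval
  rw [mul_assoc, norm_mul]
  refine mul_le_mul ?_ ((hB P (by simpa using hP)).trans (le_abs_self B)) (norm_nonneg _)
    (by positivity)
  have e : (-(d * (((m : ℚ) / d : ℚ) + P)) : ℂ) = -((m : ℝ) + d * P) := by
    push_cast; field_simp
  rw [e, norm_cexp_mul_log ht0]
  have hre : |d * P.re| ≤ 1 / 4 := by
    rw [abs_mul, abs_of_nonneg (Nat.cast_nonneg d)]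
    exact (mul_le_mul_of_nonneg_left (abs_re_le_norm P) (Nat.cast_nonneg d)).trans hq
  have him : |d * P.im| ≤ 1 / 4 := by
    rw [abs_mul, abs_of_nonneg (Nat.cast_nonneg d)]
    exact (mul_le_mul_of_nonneg_left (abs_im_le_norm P) (Nat.cast_nonneg d)).trans hq
  have h1 : (-((m : ℝ) + d * P) : ℂ).re = -(m + d * P.re) := by simp
  have h2 : (-((m : ℝ) + d * P) : ℂ).im = -(d * P.im) := by simp
  rw [h1, h2]
  refine mul_le_mul (Real.rpow_le_rpow_of_exponent_le ht ?_) (Real.exp_le_exp.2 ?_)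
    (Real.exp_pos _).le (by positivity)
  · linarith [(abs_le.1 hre).1]
  · have h3 : |d * P.im * t.arg| ≤ 1 / 4 * Real.pi := by
      rw [abs_mul]
      exact mul_le_mul him (abs_arg_le_pi t) (abs_nonneg _) (by norm_num)
    linarith [(abs_le.1 h3).2, Real.pi_pos]

lemma fract_neg_div_eq_iff (hd : 0 < d) {a k : ℕ} (ha : a < d) (hk : k < d) (l : ℕ) :
    Int.fract (-((a : ℚ) / d)) = Int.fract (-(((d * l + k : ℕ) : ℚ) / d)) ↔ k = a := by
  have hdq : (d : ℚ) ≠ 0 := Nat.cast_ne_zero.2 hd.ne'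
  rw [Int.fract_eq_fract]
  constructor
  · rintro ⟨z, hz⟩
    have h1 : (k : ℚ) - a = d * (z - l) := by
      push_cast at hz
      field_simp at hz
      linear_combination hz
    have h2 : (k : ℤ) - a = d * (z - l) := by exact_mod_cast h1
    have h3 : (k : ℤ) - a = 0 := by
      apply Int.eq_zero_of_abs_lt_dvd (m := d) ⟨_, h2⟩
      rw [abs_lt]
      omega
    omega
  · rintro rfl
    refine ⟨l, ?_⟩
    push_cast
    field_simp
    ring

/-- The linear map given by the residues of the Mellin–Barnes integrand; the sector with index `f`
corresponds to the residue class `A p` modulo `d`. -/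
def connectionMap (w : Fin N → ℕ) (d : ℕ) (W : MvPolynomial (Fin N) ℂ)
    (A : AmbientIndex w W → ℕ) : NarrowSpace w d →ₗ[ℂ] AmbientSpace w W :=
  LinearMap.pi fun p => -(2 * Real.pi * I / d) • ∑ k : Nar w d,
    (matchCoeff w d k.1 * kernelCoeff w d (A p) p.2 k.1) • LinearMap.proj k

/-- For all coordinates `(f, r)` the bound for the contour shift applies, because `r + 2` is at most
the dimension of the fixed space of the sector `f`. -/
theorem hasAsymptoticExpansion_connectionMap (hw : ∀ j, 0 < w j) (hκ : ∑ j, w j < d)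
    (W : MvPolynomial (Fin N) ℂ) (A : AmbientIndex w W → ℕ) (hA : ∀ p, A p < d)
    (hAf : ∀ p, p.1.1 = Int.fract (-((A p : ℚ) / d)))
    (hAc : ∀ p, (p.2 : ℕ) + 2 ≤ (Finset.univ.filter fun j => d ∣ A p * w j).card) :
    HasAsymptoticExpansion (atInftyFrom (goodSector w d)) (fun m t => (t ^ m)⁻¹)
      (fun t => connectionMap w d W A (smallIFJRW w d t (-1)))
      (fun m t => gwTerm w d W (-(d : ℂ) * log t) 1 ((m : ℚ) / (d : ℚ))) := by
  have hd : 0 < d := by omega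
  have hwd : ∀ j, w j ≤ d := fun j =>
    (Finset.single_le_sum (fun i _ => Nat.zero_le (w i)) (Finset.mem_univ j)).trans hκ.le
  refine ⟨isLittleO_inv_pow_succ _, fun m => Asymptotics.isLittleO_pi.2 fun p => ?_⟩
  set g : ℕ → ℂ → ℂ := fun i t => gwTerm w d W (-(d : ℂ) * log t) 1 ((i : ℚ) / (d : ℚ)) p with hg
  have hgi : ∀ i, m < i → g i =o[atInftyFrom (goodSector w d)] fun t => (t ^ m)⁻¹ := by
    intro i hi
    obtain ⟨C, hC⟩ := exists_norm_circleCoeff_gwEval_le hd hwd p.2 i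
    refine isLittleO_inv_pow_of_norm_le (C := |C|) (x := 1 / 4 - i) ?_ fun t _ ht => ?_
    · have : (m : ℝ) + 1 ≤ i := by exact_mod_cast hi
      linarith
    · simp only [hg, gwTerm_apply_eq hd hwd]
      split_ifs
      · refine (hC t ht).trans ?_
        gcongr
        exact le_abs_self C
      · rw [norm_zero]; positivity
  have hgA : ∀ L t, ∑ i ∈ Finset.range (d * L), g i t = ∑ l ∈ Finset.range L,
      circleCoeff (coeffRadius d) p.2 (gwEval w d t (((A p + d * l : ℕ) : ℚ) / d)) := by
    intro L t
    rw [sum_range_mul_eq, Finset.sum_eq_single (A p)]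
    · refine Finset.sum_congr rfl fun l _ => ?_
      simp only [hg]
      rw [gwTerm_apply_eq hd hwd, if_pos ((hAf p).trans
        ((fract_neg_div_eq_iff hd (hA p) (hA p) l).2 rfl)), add_comm]
    · intro k hk hkA
      refine Finset.sum_eq_zero fun l _ => ?_
      simp only [hg]
      rw [gwTerm_apply_eq hd hwd, if_neg]
      intro h
      exact hkA ((fract_neg_div_eq_iff hd (hA p) (Finset.mem_range.1 hk) l).1 ((hAf p).symm.trans h))
    · intro h
      exact absurd (Finset.mem_range.2 (hA p)) h
  obtain ⟨C, hC, h⟩ := exists_norm_sum_add_smallIFJRW_le hw hκ (hA p) (hAc p) (m + 1)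
  have h1 : (fun t => connectionMap w d W A (smallIFJRW w d t (-1)) p -
      ∑ i ∈ Finset.range (d * (m + 1)), g i t) =o[atInftyFrom (goodSector w d)]
      fun t => (t ^ m)⁻¹ := by
    refine isLittleO_inv_pow_of_norm_le (C := C) (x := 1 / 2 - d * (m + 1 : ℕ)) ?_ fun t ht _ => ?_
    · have : (1 : ℝ) ≤ d := by exact_mod_cast hd
      push_cast
      nlinarith [(Nat.cast_nonneg m : (0 : ℝ) ≤ m)]
    · refine le_trans (le_of_eq ?_) (h t ht)
      rw [hgA, ← norm_neg]
      congr 1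
      simp only [connectionMap, LinearMap.pi_apply, LinearMap.smul_apply, LinearMap.sum_apply,
        LinearMap.proj_apply, smul_eq_mul]
      ring
  have hle : m + 1 ≤ d * (m + 1) := Nat.le_mul_of_pos_left _ hd
  have h2 : (fun t => ∑ i ∈ Finset.Ico (m + 1) (d * (m + 1)), g i t) =o[atInftyFrom (goodSector w d)]
      fun t => (t ^ m)⁻¹ :=
    Asymptotics.IsLittleO.fun_sum fun i hi => hgi i (Finset.mem_Ico.1 hi).1
  refine (h1.add h2).congr_left fun t => ?_
  rw [← Finset.sum_range_add_sum_Ico _ hle, Pi.sub_apply, Finset.sum_apply]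
  simp only [hg]
  ring

end Expansion

/-! ### Growth of the Borel transform of the FJRW `I`-function -/

/-- Wendel's asymptotic ratio of Gamma functions, by logarithmic convexity. -/
lemma tendsto_Gamma_add_div {a : ℝ} (ha : 0 < a) (ha1 : a ≤ 1) :
    Tendsto (fun x : ℝ => Real.Gamma (x + a) / (Real.Gamma x * x ^ a)) atTop (𝓝 1) := by
  rcases ha1.eq_or_lt with rfl | ha1
  · refine tendsto_const_nhds.congr' ?_
    filter_upwards [eventually_gt_atTop 0] with x hx
    rw [Real.Gamma_add_one hx.ne', Real.rpow_one, mul_comm,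
      div_self (mul_ne_zero (Real.Gamma_pos_of_pos hx).ne' hx.ne')]
  have hlow : Tendsto (fun x : ℝ => (1 + a * x⁻¹) ^ (a - 1)) atTop (𝓝 1) := by
    have h1 : Tendsto (fun x : ℝ => 1 + a * x⁻¹) atTop (𝓝 (1 + a * 0)) :=
      (tendsto_inv_atTop_zero.const_mul a).const_add 1
    rw [mul_zero, add_zero] at h1
    have h2 := h1.rpow_const (p := a - 1) (Or.inl one_ne_zero)
    rwa [Real.one_rpow] at h2
  refine tendsto_of_tendsto_of_tendsto_of_le_of_le' hlow tendsto_const_nhds ?_ ?_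
  · filter_upwards [eventually_gt_atTop 0] with x hx
    have hG := Real.Gamma_pos_of_pos hx
    have hGa := Real.Gamma_pos_of_pos (by linarith : 0 < x + a)
    have hxa : 0 < x + a := by linarith
    have h1 := Real.Gamma_mul_add_mul_le_rpow_Gamma_mul_rpow_Gamma (s := x + a) (t := x + a + 1)
      (a := a) (b := 1 - a) (by linarith) (by linarith) ha (by linarith) (by ring)
    have e : a * (x + a) + (1 - a) * (x + a + 1) = x + 1 := by ring
    rw [e, Real.Gamma_add_one hx.ne', Real.Gamma_add_one hxa.ne',
      Real.mul_rpow hxa.le hGa.le, mul_left_comm, ← Real.rpow_add hGa] at h1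
    rw [add_sub_cancel, Real.rpow_one] at h1
    rw [le_div_iff₀ (by positivity)]
    have e2 : 1 + a * x⁻¹ = (x + a) / x := by field_simp
    rw [e2, Real.div_rpow hxa.le hx.le, Real.rpow_sub hx, Real.rpow_one]
    have hx' := Real.rpow_pos_of_pos hx a
    calc (x + a) ^ (a - 1) / (x ^ a / x) * (Real.Gamma x * x ^ a) =
          (x + a) ^ (a - 1) * (x * Real.Gamma x) := by field_simp
      _ ≤ (x + a) ^ (a - 1) * ((x + a) ^ (1 - a) * Real.Gamma (x + a)) := by gcongr
      _ = Real.Gamma (x + a) := by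
          rw [← mul_assoc, ← Real.rpow_add hxa]
          simp
  · filter_upwards [eventually_gt_atTop 0] with x hx
    have hG := Real.Gamma_pos_of_pos hx
    have h1 := Real.Gamma_mul_add_mul_le_rpow_Gamma_mul_rpow_Gamma (s := x) (t := x + 1)
      (a := 1 - a) (b := a) hx (by linarith) (by linarith) ha (by ring)
    have e : (1 - a) * x + a * (x + 1) = x + a := by ring
    rw [e, Real.Gamma_add_one hx.ne', Real.mul_rpow hx.le hG.le, mul_left_comm,
      ← Real.rpow_add hG, sub_add_cancel, Real.rpow_one] at h1
    rw [div_le_one (by positivity)]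
    linarith

section Borel

variable {N : ℕ} (w : Fin N → ℕ) (d K : ℕ)

/-- The `d`-th root of `∏ⱼ wⱼ ^ wⱼ * κ ^ κ / d ^ d`, the exponential growth rate of the Borel
transform of the FJRW `I`-function. -/
def borelRate : ℝ := (∏ j, ((w j : ℝ) / d) ^ ((w j : ℝ) / d)) * ((K : ℝ) / d) ^ ((K : ℝ) / d)

/-- The coefficients of the Borel–Laplace transform of the FJRW `I`-function, normalised to
subexponential growth. The shift `N + 1` in the Gamma function makes them bounded below. -/
def borelCoeff (M : ℕ) : ℝ :=
  fjrwCoeff w d M * Real.Gamma ((K : ℝ) / d * M + (N + 1)) / borelRate w d K ^ M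

variable {w d K}

lemma borelRate_pos (hw : ∀ j, 0 < w j) (hd : 0 < d) (hK : 0 < K) : 0 < borelRate w d K := by
  refine mul_pos (Finset.prod_pos fun j _ => Real.rpow_pos_of_pos ?_ _) (Real.rpow_pos_of_pos ?_ _)
  · have := hw j; positivity
  · positivity

lemma borelRate_pow (hd : 0 < d) :
    borelRate w d K ^ d = (∏ j, ((w j : ℝ) / d) ^ w j) * ((K : ℝ) / d) ^ K := by
  have hdr : (d : ℝ) ≠ 0 := Nat.cast_ne_zero.2 hd.ne'
  have h : ∀ c : ℕ, (((c : ℝ) / d) ^ ((c : ℝ) / d)) ^ d = ((c : ℝ) / d) ^ c := by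
    intro c
    rw [← Real.rpow_natCast, ← Real.rpow_mul (by positivity), div_mul_cancel₀ _ hdr,
      Real.rpow_natCast]
  unfold borelRate
  rw [mul_pow, ← Finset.prod_pow, h]
  simp only [h]

lemma borelCoeff_pos (hw : ∀ j, 0 < w j) (hd : 0 < d) (hK : 0 < K) {M : ℕ} (hM : 0 < M) :
    0 < borelCoeff w d K M := by
  refine div_pos (mul_pos (fjrwCoeff_pos hd hw hM) (Real.Gamma_pos_of_pos (by positivity)))
    (pow_pos (borelRate_pos hw hd hK) M)

lemma prod_rpow_mul_rpow (hd : 0 < d) (hsum : ∑ j, w j + K = d) {x : ℝ} (hx : 0 < x) :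
    (∏ j, ((w j : ℝ) / d * x) ^ ((w j : ℝ) / d)) * ((K : ℝ) / d * x) ^ ((K : ℝ) / d) =
      borelRate w d K * x := by
  have hdr : (d : ℝ) ≠ 0 := Nat.cast_ne_zero.2 hd.ne'
  unfold borelRate
  rw [Real.mul_rpow (by positivity) hx.le]
  have h : ∀ j, ((w j : ℝ) / d * x) ^ ((w j : ℝ) / d) =
      ((w j : ℝ) / d) ^ ((w j : ℝ) / d) * x ^ ((w j : ℝ) / d) := fun j =>
    Real.mul_rpow (by positivity) hx.le
  simp only [h, Finset.prod_mul_distrib]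
  rw [← Real.rpow_sum_of_pos hx, mul_mul_mul_comm, ← Real.rpow_add hx, ← Finset.sum_div, ← add_div]
  have : (∑ j, (w j : ℝ) + K) / d = 1 := by
    rw [div_eq_one_iff_eq hdr]; exact_mod_cast hsum
  rw [this, Real.rpow_one]

/-- The coefficients have subexponential growth, and neighbouring residue classes modulo `d` have the
same asymptotic behaviour: the arguments of the Gamma functions add up to that of the factorial. -/
lemma tendsto_borelCoeff_succ_div (hw : ∀ j, 0 < w j) (hd : 0 < d) (hK : 0 < K)
    (hsum : ∑ j, w j + K = d) :
    Tendsto (fun M => borelCoeff w d K (M + 1) / borelCoeff w d K M) atTop (𝓝 1) := by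
  have hdr : (0 : ℝ) < d := Nat.cast_pos.2 hd
  have hq0 : ∀ j, 0 < (w j : ℝ) / d := fun j => by have := hw j; positivity
  have hq1 : ∀ j, (w j : ℝ) / d ≤ 1 := fun j => by
    have h1 : w j ≤ ∑ i, w i := Finset.single_le_sum (fun i _ => Nat.zero_le (w i)) (Finset.mem_univ j)
    rw [div_le_one hdr]
    exact_mod_cast (by omega : w j ≤ d)
  set e : ℝ := (K : ℝ) / d with he
  have he0 : 0 < e := by positivity
  have he1 : e ≤ 1 := by
    rw [he, div_le_one hdr]; exact_mod_cast (by omega : K ≤ d)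
  have hcast : Tendsto (fun M : ℕ => (M : ℝ)) atTop atTop := tendsto_natCast_atTop_atTop
  have t1 : ∀ j, Tendsto (fun M : ℕ => Real.Gamma ((w j : ℝ) / d * M + (w j : ℝ) / d) /
      (Real.Gamma ((w j : ℝ) / d * M) * ((w j : ℝ) / d * M) ^ ((w j : ℝ) / d))) atTop (𝓝 1) := fun j =>
    (tendsto_Gamma_add_div (hq0 j) (hq1 j)).comp (hcast.const_mul_atTop (hq0 j))
  have t2 : Tendsto (fun M : ℕ => Real.Gamma (e * M + (N + 1) + e) /
      (Real.Gamma (e * M + (N + 1)) * (e * M + (N + 1)) ^ e)) atTop (𝓝 1) :=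
    (tendsto_Gamma_add_div he0 he1).comp
      (tendsto_atTop_add_const_right _ _ (hcast.const_mul_atTop he0))
  have t3 : Tendsto (fun M : ℕ => (1 + (N + 1) / e * (M : ℝ)⁻¹) ^ e) atTop (𝓝 1) := by
    have h1 : Tendsto (fun M : ℕ => 1 + (N + 1) / e * (M : ℝ)⁻¹) atTop
        (𝓝 (1 + (N + 1) / e * 0)) :=
      ((tendsto_inv_atTop_zero.comp hcast).const_mul _).const_add 1
    rw [mul_zero, add_zero] at h1
    have h2 := h1.rpow_const (p := e) (Or.inl one_ne_zero)
    rwa [Real.one_rpow] at h2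
  have t := ((tendsto_finsetProd Finset.univ fun j _ => t1 j).mul t2).mul t3
  simp only [Finset.prod_const_one, mul_one] at t
  refine t.congr' ?_
  filter_upwards [eventually_gt_atTop 0] with M hM
  have hMr : (0 : ℝ) < M := Nat.cast_pos.2 hM
  have hσ := borelRate_pos hw hd hK
  have hrate := prod_rpow_mul_rpow (w := w) hd hsum hMr
  have e1 : 1 + (N + 1) / e * (M : ℝ)⁻¹ = (e * M + (N + 1)) / (e * M) := by
    field_simp
  have hy : 0 < e * M + (N + 1) := by positivity
  rw [e1, Real.div_rpow hy.le (by positivity)]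
  unfold borelCoeff fjrwCoeff
  have e2 : ∀ j, (w j : ℝ) / d * (M + 1 : ℕ) = (w j : ℝ) / d * M + (w j : ℝ) / d := fun j => by
    push_cast; ring
  have e3 : e * (M + 1 : ℕ) + (N + 1) = e * M + (N + 1) + e := by push_cast; ring
  have e4 : ((M + 1 - 1)! : ℝ) = M * ((M - 1)! : ℕ) := by
    rw [Nat.add_sub_cancel]
    exact_mod_cast (Nat.mul_factorial_pred hM.ne').symm
  rw [e3, e4, pow_succ]
  simp only [e2, Finset.prod_div_distrib, Finset.prod_mul_distrib]
  have hA : 0 < ∏ j, Real.Gamma ((w j : ℝ) / d * M) := Finset.prod_pos fun j _ =>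
    Real.Gamma_pos_of_pos (by have := hq0 j; positivity)
  have hB : 0 < ∏ j, ((w j : ℝ) / d * M) ^ ((w j : ℝ) / d) := Finset.prod_pos fun j _ =>
    Real.rpow_pos_of_pos (by have := hq0 j; positivity) _
  have hC := Real.Gamma_pos_of_pos hy
  have hD := Real.rpow_pos_of_pos hy e
  have hE : 0 < (e * M) ^ e := Real.rpow_pos_of_pos (by positivity) e
  have hF : (0 : ℝ) < ((M - 1)! : ℕ) := Nat.cast_pos.2 (Nat.factorial_pos _)
  have hS := pow_pos hσ M
  generalize (∏ j, Real.Gamma ((w j : ℝ) / d * M + (w j : ℝ) / d)) = A'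
  generalize (∏ j, Real.Gamma ((w j : ℝ) / d * M)) = A at *
  generalize (∏ j, ((w j : ℝ) / d * M) ^ ((w j : ℝ) / d)) = B at *
  generalize Real.Gamma (e * M + (N + 1) + e) = C'
  generalize Real.Gamma (e * M + (N + 1)) = C at *
  generalize (e * M + (N + 1)) ^ e = D at *
  generalize (e * M) ^ e = E at *
  generalize borelRate w d K ^ M = S at *
  generalize (((M - 1)! : ℕ) : ℝ) = F at *
  field_simp
  linear_combination (-(A' * C')) * hrate

lemma tendsto_borelCoeff_add_div (hw : ∀ j, 0 < w j) (hd : 0 < d) (hK : 0 < K)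
    (hsum : ∑ j, w j + K = d) (s : ℕ) :
    Tendsto (fun M => borelCoeff w d K (M + s) / borelCoeff w d K M) atTop (𝓝 1) := by
  induction s with
  | zero =>
    refine tendsto_const_nhds.congr' ?_
    filter_upwards [eventually_gt_atTop 0] with M hM
    rw [add_zero, div_self (borelCoeff_pos hw hd hK hM).ne']
  | succ s ih =>
    have h1 := ((tendsto_borelCoeff_succ_div hw hd hK hsum).comp (tendsto_add_atTop_nat s)).mul ih
    rw [mul_one] at h1
    refine h1.congr' ?_
    filter_upwards [eventually_gt_atTop 0] with M hM
    have := (borelCoeff_pos hw hd hK hM).ne'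
    have := (borelCoeff_pos hw hd hK (by omega : 0 < M + s)).ne'
    simp only [Function.comp_apply, ← add_assoc]
    field_simp

lemma summable_borelCoeff (hw : ∀ j, 0 < w j) (hd : 0 < d) (hK : 0 < K)
    (hsum : ∑ j, w j + K = d) (k : ℕ) {x : ℝ} (hx0 : 0 < x) (hx1 : x < 1) :
    Summable fun l : ℕ => borelCoeff w d K (d * l + k + 1) * x ^ l := by
  have hpos : ∀ l, 0 < borelCoeff w d K (d * l + k + 1) := fun l =>
    borelCoeff_pos hw hd hK (Nat.succ_pos _)
  refine summable_of_ratio_test_tendsto_lt_one hx1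
    (Eventually.of_forall fun l => (mul_pos (hpos l) (pow_pos hx0 l)).ne') ?_
  have hM : Tendsto (fun l => d * l + k + 1) atTop atTop :=
    tendsto_atTop_mono (fun l => by
      have := Nat.le_mul_of_pos_left l hd
      simp only [id]
      omega) tendsto_id
  have h1 := ((tendsto_borelCoeff_add_div hw hd hK hsum d).comp hM).mul_const x
  rw [one_mul] at h1
  refine h1.congr fun l => ?_
  rw [Real.norm_of_nonneg (mul_pos (hpos _) (pow_pos hx0 _)).le,
    Real.norm_of_nonneg (mul_pos (hpos _) (pow_pos hx0 _)).le]
  simp only [Function.comp_apply]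
  rw [show d * (l + 1) + k + 1 = d * l + k + 1 + d by ring, pow_succ]
  have := (hpos l).ne'
  field_simp

lemma tendsto_borelCoeff_div (hw : ∀ j, 0 < w j) (hd : 0 < d) (hK : 0 < K)
    (hsum : ∑ j, w j + K = d) {k : ℕ} (hk : k < d) :
    Tendsto (fun l => borelCoeff w d K (d * l + k + 1) / borelCoeff w d K (d * (l + 1))) atTop
      (𝓝 1) := by
  have hM : Tendsto (fun l => d * l + k + 1) atTop atTop :=
    tendsto_atTop_mono (fun l => by
      have := Nat.le_mul_of_pos_left l hd
      simp only [id]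
      omega) tendsto_id
  have h1 := ((tendsto_borelCoeff_add_div hw hd hK hsum (d - 1 - k)).comp hM).inv₀ one_ne_zero
  rw [inv_one] at h1
  refine h1.congr fun l => ?_
  rw [Function.comp_apply, inv_div, show d * l + k + 1 + (d - 1 - k) = d * (l + 1) by
    rw [Nat.mul_succ]; omega]

/-- The multinomial theorem bounds the probability of a single outcome by one. -/
lemma factorial_mul_prod_pow_le {ι : Type*} [Fintype ι] (u : ι → ℕ) (l : ℕ) :
    (((∑ i, u i) * l)! : ℝ) * ∏ i, (u i : ℝ) ^ (u i * l) ≤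
      (∏ i, ((u i * l)! : ℝ)) * (∑ i, (u i : ℝ)) ^ ((∑ i, u i) * l) := by
  classical
  rw [Finset.sum_pow_eq_sum_piAntidiag]
  have h1 : (fun i => u i * l) ∈ Finset.piAntidiag Finset.univ ((∑ i, u i) * l) := by
    simp [Finset.mem_piAntidiag, Finset.sum_mul]
  have h2 := Finset.single_le_sum (f := fun k : ι → ℕ =>
    (Nat.multinomial Finset.univ k : ℝ) * ∏ i, (u i : ℝ) ^ k i)
    (fun k _ => by positivity) h1
  have h3 : ((∏ i, ((u i * l)! : ℝ)) * Nat.multinomial Finset.univ fun i => u i * l) =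
      (((∑ i, u i) * l)! : ℝ) := by
    have := Nat.multinomial_spec Finset.univ fun i => u i * l
    rw [← Finset.sum_mul] at this
    exact_mod_cast this
  rw [← h3, mul_assoc]
  exact mul_le_mul_of_nonneg_left h2 (by positivity)

/-- Along the multiples of `d` the coefficients are bounded below by the multinomial theorem, applied
to the weights together with `κ`, whose sum is `d`. This makes the Borel–Laplace series diverge at
the boundary of its disc of convergence. -/
lemma exists_le_borelCoeff (hw : ∀ j, 0 < w j) (hd : 0 < d) (hK : 0 < K)
    (hsum : ∑ j, w j + K = d) :
    ∃ c : ℝ, 0 < c ∧ ∀ l : ℕ, c ≤ borelCoeff w d K (d * (l + 1)) := by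
  have hdr : (0 : ℝ) < d := Nat.cast_pos.2 hd
  have hp : (0 : ℝ) < ∏ j, (w j : ℝ) := Finset.prod_pos fun j _ => Nat.cast_pos.2 (hw j)
  refine ⟨(∏ j, (w j : ℝ))⁻¹, inv_pos.2 hp, fun l => ?_⟩
  set n := l + 1 with hn
  have hn0 : 0 < n := Nat.succ_pos l
  have hnr : (1 : ℝ) ≤ n := by exact_mod_cast hn0
  have hmul := factorial_mul_prod_pow_le (fun i : Option (Fin N) => i.elim K w) n
  simp only [Fintype.prod_option, Fintype.sum_option, Option.elim_none, Option.elim_some] at hmul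
  rw [show K + ∑ j, w j = d by omega,
    show (K : ℝ) + ∑ j, (w j : ℝ) = d by exact_mod_cast (by omega : K + ∑ j, w j = d)] at hmul
  have hrate : borelRate w d K ^ (d * n) * (d : ℝ) ^ (d * n) =
      (K : ℝ) ^ (K * n) * ∏ j, (w j : ℝ) ^ (w j * n) := by
    rw [pow_mul, pow_mul, ← mul_pow, borelRate_pow hd]
    simp only [div_pow, Finset.prod_div_distrib, pow_mul (_ : ℝ) _ n, Finset.prod_pow]
    rw [Finset.prod_pow_eq_pow_sum, ← mul_pow]
    congr 1
    have : (d : ℝ) ^ d = d ^ (∑ j, w j) * d ^ K := by rw [← pow_add, hsum]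
    rw [this]
    field_simp
  have hG : ∀ j, Real.Gamma ((w j : ℝ) / d * (d * n : ℕ)) * (w j * n) = ((w j * n)! : ℕ) := by
    intro j
    have e : (w j : ℝ) / d * (d * n : ℕ) = ((w j * n : ℕ) : ℝ) := by push_cast; field_simp
    have hne : ((w j * n : ℕ) : ℝ) ≠ 0 := Nat.cast_ne_zero.2 (Nat.mul_pos (hw j) hn0).ne'
    rw [e, ← Real.Gamma_nat_eq_factorial, Real.Gamma_add_one hne]
    push_cast; ring
  have hGprod : (∏ j, Real.Gamma ((w j : ℝ) / d * (d * n : ℕ))) * ((∏ j, (w j : ℝ)) * n ^ N) =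
      ∏ j, (((w j * n)! : ℕ) : ℝ) := by
    simp only [← hG, Finset.prod_mul_distrib]
    simp
  have hGK : (((K * n)! : ℕ) : ℝ) * n ^ N ≤ Real.Gamma ((K : ℝ) / d * (d * n : ℕ) + (N + 1)) := by
    have e : (K : ℝ) / d * (d * n : ℕ) + (N + 1) = ((K * n + N : ℕ) : ℝ) + 1 := by
      push_cast; field_simp
      ring
    rw [e, Real.Gamma_nat_eq_factorial]
    have h1 := Nat.factorial_mul_pow_le_factorial (m := K * n) (n := N)
    have h2 : n ^ N ≤ (K * n + 1) ^ N := Nat.pow_le_pow_left (by nlinarith) N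
    exact_mod_cast (Nat.mul_le_mul_left _ h2).trans h1
  have hσ := borelRate_pos hw hd hK
  have hfac : (((d * n - 1)! : ℕ) : ℝ) ≤ ((d * n)! : ℕ) := by
    exact_mod_cast Nat.factorial_le (Nat.sub_le _ _)
  have hf : (0 : ℝ) < ((d * n - 1)! : ℕ) := Nat.cast_pos.2 (Nat.factorial_pos _)
  have hGpos : 0 < ∏ j, Real.Gamma ((w j : ℝ) / d * (d * n : ℕ)) := Finset.prod_pos fun j _ =>
    Real.Gamma_pos_of_pos (by have := hw j; positivity)
  unfold borelCoeff fjrwCoeff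
  rw [le_div_iff₀ (pow_pos hσ _), div_mul_eq_mul_div, le_div_iff₀ hf, inv_mul_eq_div,
    div_mul_eq_mul_div, div_le_iff₀ hp]
  have hdn : (0 : ℝ) < (d : ℝ) ^ (d * n) := by positivity
  refine le_of_mul_le_mul_right ?_ hdn
  calc borelRate w d K ^ (d * n) * (((d * n - 1)! : ℕ) : ℝ) * d ^ (d * n) =
        (((d * n - 1)! : ℕ) : ℝ) * (borelRate w d K ^ (d * n) * d ^ (d * n)) := by ring
    _ ≤ (((d * n)! : ℕ) : ℝ) * ((K : ℝ) ^ (K * n) * ∏ j, (w j : ℝ) ^ (w j * n)) := by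
        rw [hrate]; gcongr
    _ ≤ ((((K * n)! : ℕ) : ℝ) * ∏ j, (((w j * n)! : ℕ) : ℝ)) * d ^ (d * n) := hmul
    _ = (∏ j, Real.Gamma ((w j : ℝ) / d * (d * n : ℕ))) * ((((K * n)! : ℕ) : ℝ) * n ^ N) *
        (∏ j, (w j : ℝ)) * d ^ (d * n) := by rw [← hGprod]; ring
    _ ≤ _ := by gcongr

/-- An Abelian theorem: the ratio of two power series tends to the limit of the ratio of their
coefficients when the denominator diverges at the boundary. -/
lemma tendsto_tsum_div_tsum {u v : ℕ → ℝ} {c : ℝ} (hc : 0 < c) (hv : ∀ l, c ≤ v l)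
    (hu : ∀ x : ℝ, 0 < x → x < 1 → Summable fun l => u l * x ^ l)
    (hv' : ∀ x : ℝ, 0 < x → x < 1 → Summable fun l => v l * x ^ l)
    (huv : Tendsto (fun l => u l / v l) atTop (𝓝 1)) :
    Tendsto (fun x : ℝ => ∑' l, v l * x ^ l) (𝓝[<] 1) atTop ∧
    Tendsto (fun x : ℝ => (∑' l, u l * x ^ l) / ∑' l, v l * x ^ l) (𝓝[<] 1) (𝓝 1) := by
  have hmem : ∀ᶠ x : ℝ in 𝓝[<] 1, 0 < x ∧ x < 1 := by
    filter_upwards [Ioo_mem_nhdsLT (zero_lt_one (α := ℝ))] with x hx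
    exact hx
  have hV : Tendsto (fun x : ℝ => ∑' l, v l * x ^ l) (𝓝[<] 1) atTop := by
    have h1 : Tendsto (fun x : ℝ => c * (1 - x)⁻¹) (𝓝[<] 1) atTop := by
      refine Tendsto.const_mul_atTop hc (tendsto_inv_nhdsGT_zero.comp ?_)
      refine tendsto_nhdsWithin_iff.2 ⟨?_, ?_⟩
      · have : Tendsto (fun x : ℝ => 1 - x) (𝓝 1) (𝓝 (1 - 1)) := by
          exact (continuous_const.sub continuous_id).tendsto 1
        rw [sub_self] at this
        exact this.mono_left nhdsWithin_le_nhds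
      · filter_upwards [hmem] with x hx
        exact sub_pos.2 hx.2
    refine tendsto_atTop_mono' _ ?_ h1
    filter_upwards [hmem] with x hx
    rw [← tsum_geometric_of_lt_one hx.1.le hx.2, ← tsum_mul_left]
    refine Summable.tsum_le_tsum (fun l => ?_)
      ((summable_geometric_of_lt_one hx.1.le hx.2).mul_left c) (hv' x hx.1 hx.2)
    exact mul_le_mul_of_nonneg_right (hv l) (pow_nonneg hx.1.le l)
  refine ⟨hV, ?_⟩
  rw [Metric.tendsto_nhds]
  intro ε hε
  obtain ⟨n, hn⟩ := eventually_atTop.1 ((Metric.tendsto_nhds.1 huv) (ε / 3) (by positivity))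
  set B := ∑ l ∈ Finset.range n, |u l - v l| with hB
  filter_upwards [hmem, hV.eventually_gt_atTop 0, hV.eventually_gt_atTop (B / (ε / 3))] with x hx h1 h2
  have hU := hu x hx.1 hx.2
  have hV' := hv' x hx.1 hx.2
  set V := ∑' l, v l * x ^ l with hVdef
  rw [Real.dist_eq, div_sub_one h1.ne', abs_div, abs_of_pos h1, div_lt_iff₀ h1]
  have hdiff : ∑' l, u l * x ^ l - V = ∑' l, (u l - v l) * x ^ l := by
    rw [hVdef, ← hU.tsum_sub hV']
    exact tsum_congr fun l => by ring
  have hsum : Summable fun l => (u l - v l) * x ^ l := (hU.sub hV').congr fun l => by ring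
  have hterm : ∀ l, |(u l - v l) * x ^ l| ≤
      (if l ∈ Finset.range n then |u l - v l| else 0) + ε / 3 * (v l * x ^ l) := by
    intro l
    have hvl : 0 < v l := hc.trans_le (hv l)
    have hxl : 0 ≤ x ^ l := pow_nonneg hx.1.le l
    have hxl1 : x ^ l ≤ 1 := pow_le_one₀ hx.1.le hx.2.le
    rw [abs_mul, abs_of_nonneg hxl]
    split_ifs with h
    · have h1 : |u l - v l| * x ^ l ≤ |u l - v l| :=
        mul_le_of_le_one_right (abs_nonneg _) hxl1
      have : 0 ≤ ε / 3 * (v l * x ^ l) := by positivity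
      linarith
    · rw [zero_add, ← mul_assoc]
      refine mul_le_mul_of_nonneg_right ?_ hxl
      have h3 := hn l (by simpa using h)
      rw [Real.dist_eq, div_sub_one hvl.ne', abs_div, abs_of_pos hvl, div_lt_iff₀ hvl] at h3
      exact h3.le
  have hs2 : Summable fun l => (if l ∈ Finset.range n then |u l - v l| else 0) :=
    summable_of_ne_finset_zero (s := Finset.range n) fun l hl => if_neg hl
  have h3 : |∑' l, (u l - v l) * x ^ l| ≤ B + ε / 3 * V := by
    have hs3 := hs2.add (hV'.mul_left (ε / 3))
    have h4 : |∑' l, (u l - v l) * x ^ l| ≤ ∑' l, |(u l - v l) * x ^ l| := by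
      simpa only [Real.norm_eq_abs] using norm_tsum_le_tsum_norm hsum.norm
    refine h4.trans ((Summable.tsum_le_tsum hterm hsum.abs hs3).trans_eq ?_)
    rw [hs2.tsum_add (hV'.mul_left _), tsum_mul_left,
      tsum_eq_sum (s := Finset.range n) fun l hl => if_neg hl]
    congr 1
    exact Finset.sum_congr rfl fun l hl => if_pos hl
  rw [hdiff]
  rw [div_lt_iff₀ (by positivity)] at h2
  nlinarith

end Borel

/-! ### Relations from polynomial growth on a ray -/

section Rays

variable {N : ℕ} {w : Fin N → ℕ} {d K : ℕ}

/-- A linear combination of the components of the FJRW `I`-function. -/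
def narrowSeries (w : Fin N → ℕ) (d : ℕ) (b : Nar w d → ℂ) (t : ℂ) : ℂ :=
  ∑ k : Nar w d, b k * ∑' l : ℕ, ((-1) ^ (d + ∑ j, w j)) ^ l * t ^ (d * l + k.1 + 1) *
    fjrwCoeff w d (d * l + k.1 + 1)

lemma norm_neg_one_pow_pow (m l : ℕ) : ‖(((-1) ^ m) ^ l : ℂ)‖ = 1 := by
  rw [norm_pow, norm_pow, norm_neg, norm_one, one_pow, one_pow]

lemma norm_narrowSeries_term (hd : 0 < d) (hw : ∀ j, 0 < w j) (t : ℂ) (k l : ℕ) :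
    ‖((-1) ^ (d + ∑ j, w j)) ^ l * t ^ (d * l + k + 1) * (fjrwCoeff w d (d * l + k + 1) : ℂ)‖ =
      ‖t‖ ^ (d * l + k + 1) * fjrwCoeff w d (d * l + k + 1) := by
  rw [norm_mul, norm_mul, norm_neg_one_pow_pow, one_mul, norm_pow, norm_real,
    Real.norm_of_nonneg (fjrwCoeff_pos hd hw (Nat.succ_pos _)).le]

lemma summable_narrowSeries_term (hd : 0 < d) (hw : ∀ j, 0 < w j) (hκ : ∑ j, w j < d) (t : ℂ)
    (k : ℕ) : Summable fun l : ℕ => ((-1) ^ (d + ∑ j, w j)) ^ l * t ^ (d * l + k + 1) *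
      (fjrwCoeff w d (d * l + k + 1) : ℂ) := by
  refine Summable.of_norm ?_
  simp only [norm_narrowSeries_term hd hw]
  exact summable_fjrwCoeff hd hw hκ ‖t‖ k

lemma continuous_narrowSeries (hd : 0 < d) (hw : ∀ j, 0 < w j) (hκ : ∑ j, w j < d)
    (b : Nar w d → ℂ) : Continuous (narrowSeries w d b) := by
  unfold narrowSeries
  refine continuous_finsetSum _ fun k _ => continuous_const.mul ?_
  rw [continuous_iff_continuousAt]
  intro t
  have h1 : ContinuousOn (fun t : ℂ => ∑' l : ℕ, ((-1) ^ (d + ∑ j, w j)) ^ l *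
      t ^ (d * l + k.1 + 1) * (fjrwCoeff w d (d * l + k.1 + 1) : ℂ))
      (Metric.ball 0 (‖t‖ + 1)) := by
    refine continuousOn_tsum (fun l => by fun_prop) (summable_fjrwCoeff hd hw hκ (‖t‖ + 1) k.1)
      fun l s hs => ?_
    rw [norm_narrowSeries_term hd hw]
    have := (fjrwCoeff_pos hd hw (Nat.succ_pos (d * l + k.1))).le
    have hs' : ‖s‖ ≤ ‖t‖ + 1 := by simpa using (mem_ball_zero_iff.1 hs).le
    gcongr
  exact h1.continuousAt (Metric.isOpen_ball.mem_nhds (by simp))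

/-- The exponent of `p⁻¹` in the Laplace transform of `t ^ M v ^ N`, where `t ^ d = v ^ κ`. -/
def laplaceExponent (N d K M : ℕ) : ℝ := (K : ℝ) / d * M + (N + 1)

lemma laplaceExponent_pos (N d K M : ℕ) : 0 < laplaceExponent N d K M := by
  unfold laplaceExponent; positivity

lemma fjrwCoeff_mul_Gamma_mul_rpow (hd : 0 < d) (hw : ∀ j, 0 < w j) (hK : 0 < K) (M : ℕ)
    {r : ℝ} (hr : 0 < r) :
    fjrwCoeff w d M * Real.Gamma (laplaceExponent N d K M) * r ^ (-laplaceExponent N d K M) =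
      borelCoeff w d K M * (borelRate w d K * r ^ (-((K : ℝ) / d))) ^ M * r ^ (-(N + 1 : ℝ)) := by
  have hσ := (pow_pos (borelRate_pos hw hd hK) M).ne'
  have e : r ^ (-laplaceExponent N d K M) = (r ^ (-((K : ℝ) / d))) ^ M * r ^ (-(N + 1 : ℝ)) := by
    rw [← Real.rpow_natCast, ← Real.rpow_mul hr.le, ← Real.rpow_add hr]
    congr 1
    unfold laplaceExponent
    ring
  rw [e, mul_pow]
  unfold borelCoeff laplaceExponent
  field_simp

/-- The abscissa of convergence of the Laplace-transformed series. -/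
def laplaceAbscissa (w : Fin N → ℕ) (d K : ℕ) : ℝ := borelRate w d K ^ ((d : ℝ) / K)

lemma laplaceAbscissa_pos (hd : 0 < d) (hw : ∀ j, 0 < w j) (hK : 0 < K) :
    0 < laplaceAbscissa w d K := Real.rpow_pos_of_pos (borelRate_pos hw hd hK) _

lemma borelRate_eq (hd : 0 < d) (hw : ∀ j, 0 < w j) (hK : 0 < K) :
    borelRate w d K = laplaceAbscissa w d K ^ ((K : ℝ) / d) := by
  have hdr : (d : ℝ) ≠ 0 := Nat.cast_ne_zero.2 hd.ne'
  have hKr : (K : ℝ) ≠ 0 := Nat.cast_ne_zero.2 hK.ne'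
  unfold laplaceAbscissa
  rw [← Real.rpow_mul (borelRate_pos hw hd hK).le, div_mul_div_cancel₀ hKr, div_self hdr,
    Real.rpow_one]

lemma borelRate_mul_rpow_lt_one (hd : 0 < d) (hw : ∀ j, 0 < w j) (hK : 0 < K) {r : ℝ}
    (hr : laplaceAbscissa w d K < r) : borelRate w d K * r ^ (-((K : ℝ) / d)) < 1 := by
  have h0 := laplaceAbscissa_pos hd hw hK
  have hr0 : 0 < r := h0.trans hr
  rw [Real.rpow_neg hr0.le, ← div_eq_mul_inv, div_lt_one (Real.rpow_pos_of_pos hr0 _),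
    borelRate_eq hd hw hK]
  exact Real.rpow_lt_rpow h0.le hr (by positivity)

lemma summable_laplace (hd : 0 < d) (hw : ∀ j, 0 < w j) (hK : 0 < K) (hsum : ∑ j, w j + K = d)
    (k : ℕ) {r : ℝ} (hr : laplaceAbscissa w d K < r) :
    Summable fun l : ℕ => fjrwCoeff w d (d * l + k + 1) *
      Real.Gamma (laplaceExponent N d K (d * l + k + 1)) *
        r ^ (-laplaceExponent N d K (d * l + k + 1)) := by
  have hr0 : 0 < r := (laplaceAbscissa_pos hd hw hK).trans hr
  have hy1 := borelRate_mul_rpow_lt_one hd hw hK hr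
  have hy0 : 0 < borelRate w d K * r ^ (-((K : ℝ) / d)) :=
    mul_pos (borelRate_pos hw hd hK) (Real.rpow_pos_of_pos hr0 _)
  simp only [fjrwCoeff_mul_Gamma_mul_rpow hd hw hK _ hr0]
  set y := borelRate w d K * r ^ (-((K : ℝ) / d)) with hy
  refine (((summable_borelCoeff hw hd hK hsum k (pow_pos hy0 d)
    (pow_lt_one₀ hy0.le hy1 hd.ne')).mul_right (y ^ (k + 1))).mul_right (r ^ (-(N + 1 : ℝ)))).congr
      fun l => ?_
  rw [add_assoc, pow_add y (d * l) (k + 1), pow_mul y d l]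
  ring

/-- The summand of index `k`, `l` of the Laplace transform of
`v ↦ narrowSeries (e ^ (i ϑ) v ^ (κ / d)) v ^ N`. -/
def laplaceTerm (K : ℕ) (b : Nar w d → ℂ) (ϑ : ℝ) (k : Nar w d) (l : ℕ) (p : ℂ) : ℂ :=
  b k * ((-1) ^ (d + ∑ j, w j)) ^ l * cexp (ϑ * (d * l + k.1 + 1 : ℕ) * I) *
    (fjrwCoeff w d (d * l + k.1 + 1) *
      Real.Gamma (laplaceExponent N d K (d * l + k.1 + 1)) : ℝ) *
    p ^ (-(laplaceExponent N d K (d * l + k.1 + 1) : ℂ))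

lemma norm_laplaceTerm (hd : 0 < d) (hw : ∀ j, 0 < w j) (b : Nar w d → ℂ) (ϑ : ℝ) (k : Nar w d)
    (l : ℕ) (p : ℂ) : ‖laplaceTerm K b ϑ k l p‖ = ‖b k‖ * (fjrwCoeff w d (d * l + k.1 + 1) *
      Real.Gamma (laplaceExponent N d K (d * l + k.1 + 1)) *
        ‖p‖ ^ (-laplaceExponent N d K (d * l + k.1 + 1))) := by
  have h1 := (fjrwCoeff_pos hd hw (Nat.succ_pos (d * l + k.1))).le
  have h2 := (Real.Gamma_pos_of_pos (laplaceExponent_pos N d K (d * l + k.1 + 1))).le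
  unfold laplaceTerm
  rw [norm_mul, norm_mul, norm_mul, norm_mul, norm_neg_one_pow_pow, mul_one, norm_real,
    Real.norm_of_nonneg (mul_nonneg h1 h2)]
  have e1 : ‖cexp (ϑ * (d * l + k.1 + 1 : ℕ) * I)‖ = 1 := by
    have := norm_exp_ofReal_mul_I (ϑ * (d * l + k.1 + 1 : ℕ))
    push_cast at this ⊢
    exact this
  have e2 : ‖p ^ (-(laplaceExponent N d K (d * l + k.1 + 1) : ℂ))‖ =
      ‖p‖ ^ (-laplaceExponent N d K (d * l + k.1 + 1)) := by
    rw [← ofReal_neg, norm_cpow_real]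
  rw [e1, e2, mul_one, mul_assoc]

/-- The Laplace transform along the ray of argument `ϑ`. -/
def laplaceIntegrand (K : ℕ) (b : Nar w d → ℂ) (ϑ : ℝ) (v : ℝ) : ℂ :=
  narrowSeries w d b (cexp (ϑ * I) * (v ^ ((K : ℝ) / d) : ℝ)) * (v : ℂ) ^ N

lemma integrableOn_laplaceIntegrand (hd : 0 < d) (hw : ∀ j, 0 < w j) (hK : 0 < K)
    (hsum : ∑ j, w j + K = d) (b : Nar w d → ℂ) {ϑ : ℝ} {C R : ℝ}
    (hF : ∀ r : ℝ, R ≤ r → ‖narrowSeries w d b (cexp (ϑ * I) * r)‖ ≤ C * r) {δ : ℝ} (hδ : 0 < δ) :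
    IntegrableOn (fun v : ℝ => laplaceIntegrand K b ϑ v * cexp (-(δ : ℂ) * v)) (Ioi 0) := by
  have hdr : (0 : ℝ) < d := Nat.cast_pos.2 hd
  have hcont := continuous_narrowSeries hd hw (by omega : ∑ j, w j < d) b
  have hcont' : Continuous fun r : ℝ => narrowSeries w d b (cexp (ϑ * I) * r) :=
    hcont.comp (by fun_prop)
  obtain ⟨B, hB⟩ := (isCompact_Icc (a := (0 : ℝ)) (b := R)).exists_bound_of_continuousOn
    hcont'.continuousOn
  have hbound : ∀ r : ℝ, 0 ≤ r → ‖narrowSeries w d b (cexp (ϑ * I) * r)‖ ≤ |B| + |C| * r := by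
    intro r hr
    rcases le_total R r with h | h
    · have := hF r h
      have h2 : C * r ≤ |C| * r := mul_le_mul_of_nonneg_right (le_abs_self C) hr
      linarith [abs_nonneg B]
    · have := hB r ⟨hr, h⟩
      have h2 : 0 ≤ |C| * r := by positivity
      linarith [le_abs_self B]
  have hmeas : AEStronglyMeasurable
      (fun v : ℝ => laplaceIntegrand K b ϑ v * cexp (-(δ : ℂ) * v)) (volume.restrict (Ioi 0)) := by
    unfold laplaceIntegrand
    refine Continuous.aestronglyMeasurable (Continuous.mul (Continuous.mul ?_ (by fun_prop))
      (by fun_prop))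
    refine hcont'.comp (Real.continuous_rpow_const ?_)
    positivity
  have hint : ∀ n : ℕ, IntegrableOn (fun v : ℝ => v ^ n * Real.exp (-(δ * v))) (Ioi 0) := by
    intro n
    have := (integrableOn_cpow_mul_exp (a := n + 1) (by simp; positivity) hδ).norm
    refine IntegrableOn.congr_fun (s := Ioi 0) this (fun v hv => ?_) measurableSet_Ioi
    have hv' : (0 : ℝ) < v := hv
    rw [norm_mul_cexp_neg_mul, add_sub_cancel_right, cpow_natCast, norm_pow, norm_real,
      Real.norm_of_nonneg hv'.le, ofReal_re]
  refine Integrable.mono' (((hint N).const_mul (|B| + |C|)).add ((hint (N + 1)).const_mul |C|))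
    hmeas ?_
  filter_upwards [ae_restrict_mem measurableSet_Ioi] with v hv
  have hv' : (0 : ℝ) < v := hv
  rw [norm_mul_cexp_neg_mul, ofReal_re]
  unfold laplaceIntegrand
  rw [norm_mul, norm_pow, norm_real, Real.norm_of_nonneg hv'.le]
  have h1 := hbound (v ^ ((K : ℝ) / d)) (Real.rpow_nonneg hv'.le _)
  have h2 : v ^ ((K : ℝ) / d) ≤ 1 + v := by
    have hKd : (K : ℝ) / d ≤ 1 := by
      rw [div_le_one hdr]; exact_mod_cast (by omega : K ≤ d)
    rcases le_total v 1 with h | h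
    · have := Real.rpow_le_one hv'.le h (by positivity : 0 ≤ (K : ℝ) / d)
      linarith
    · have := Real.rpow_le_rpow_of_exponent_le h hKd
      rw [Real.rpow_one] at this
      linarith
  have h3 : ‖narrowSeries w d b (cexp (ϑ * I) * (v ^ ((K : ℝ) / d) : ℝ))‖ ≤
      |B| + |C| + |C| * v := by
    refine h1.trans ?_
    nlinarith [mul_le_mul_of_nonneg_left h2 (abs_nonneg C)]
  calc _ ≤ (|B| + |C| + |C| * v) * v ^ N * Real.exp (-(δ * v)) := by gcongr
    _ = _ := by simp only [Pi.add_apply]; ring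

/-- For large `Re p` the Laplace transform can be computed term by term. -/
lemma integral_laplaceIntegrand_eq (hd : 0 < d) (hw : ∀ j, 0 < w j) (hK : 0 < K)
    (hsum : ∑ j, w j + K = d) (b : Nar w d → ℂ) (ϑ : ℝ) {p : ℂ}
    (hp : laplaceAbscissa w d K < p.re) :
    ∫ v in Ioi (0 : ℝ), laplaceIntegrand K b ϑ v * cexp (-p * v) =
      ∑' l : ℕ, ∑ k : Nar w d, laplaceTerm K b ϑ k l p := by
  have hp0 : 0 < p.re := (laplaceAbscissa_pos hd hw hK).trans hp
  set c : Nar w d → ℕ → ℂ := fun k l => b k * ((-1) ^ (d + ∑ j, w j)) ^ l *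
    cexp (ϑ * (d * l + k.1 + 1 : ℕ) * I) * fjrwCoeff w d (d * l + k.1 + 1) with hc
  have hcn : ∀ k l, ‖c k l‖ = ‖b k‖ * fjrwCoeff w d (d * l + k.1 + 1) := by
    intro k l
    have e1 : ‖cexp (ϑ * (d * l + k.1 + 1 : ℕ) * I)‖ = 1 := by
      have := norm_exp_ofReal_mul_I (ϑ * (d * l + k.1 + 1 : ℕ))
      push_cast at this ⊢
      exact this
    simp only [hc]
    rw [norm_mul, norm_mul, norm_mul, norm_neg_one_pow_pow, e1, mul_one, mul_one, norm_real,
      Real.norm_of_nonneg (fjrwCoeff_pos hd hw (Nat.succ_pos _)).le]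
  set s : Nar w d → ℕ → ℝ := fun k l => laplaceExponent N d K (d * l + k.1 + 1) with hs
  have hs0 : ∀ k l, 0 < s k l := fun k l => laplaceExponent_pos _ _ _ _
  set f : Nar w d → ℕ → ℝ → ℂ := fun k l v => c k l * ((v : ℂ) ^ ((s k l : ℂ) - 1) * cexp (-p * v))
    with hf
  have hfint : ∀ k l, IntegrableOn (f k l) (Ioi 0) := fun k l =>
    (integrableOn_laplace (fun δ hδ => integrableOn_cpow_mul_exp
      (by rw [ofReal_re]; exact hs0 k l) hδ) hp0).const_mul _
  have hfval : ∀ k l, ∫ v in Ioi (0 : ℝ), f k l v = laplaceTerm K b ϑ k l p := by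
    intro k l
    simp only [hf]
    rw [integral_const_mul, integral_cpow_mul_cexp_neg_mul (by rw [ofReal_re]; exact hs0 k l) hp0,
      Gamma_ofReal]
    simp only [hc, laplaceTerm, hs, ofReal_mul]
    ring
  have hfnorm : ∀ k l, ∫ v in Ioi (0 : ℝ), ‖f k l v‖ = ‖b k‖ * (fjrwCoeff w d (d * l + k.1 + 1) *
      Real.Gamma (laplaceExponent N d K (d * l + k.1 + 1)) *
        p.re ^ (-laplaceExponent N d K (d * l + k.1 + 1))) := by
    intro k l
    have h1 : ∫ v in Ioi (0 : ℝ), ‖f k l v‖ =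
        ∫ v in Ioi (0 : ℝ), ‖c k l‖ * (v ^ (s k l - 1) * Real.exp (-(p.re * v))) := by
      refine setIntegral_congr_fun measurableSet_Ioi fun v hv => ?_
      have hv' : (0 : ℝ) < v := hv
      simp only [hf]
      rw [norm_mul, norm_mul_cexp_neg_mul]
      have : ((s k l : ℂ) - 1) = ((s k l - 1 : ℝ) : ℂ) := by push_cast; rfl
      rw [this, norm_cpow_real, norm_real, Real.norm_of_nonneg hv'.le]
    rw [h1, integral_const_mul, Real.integral_rpow_mul_exp_neg_mul_Ioi (hs0 k l) hp0, hcn,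
      one_div, Real.inv_rpow hp0.le, ← Real.rpow_neg hp0.le]
    simp only [hs]
    ring
  have hsummable : Summable fun l => ∑ k : Nar w d, ∫ v in Ioi (0 : ℝ), ‖f k l v‖ := by
    refine summable_sum fun k _ => ?_
    simp only [hfnorm]
    exact (summable_laplace hd hw hK hsum k.1 hp).mul_left _
  have hmain := hasSum_integral_of_summable_integral_norm
    (μ := volume.restrict (Ioi (0 : ℝ))) (F := fun l v => ∑ k : Nar w d, f k l v)
    (fun l => integrable_finsetSum _ fun k _ => hfint k l)
    (by
      refine Summable.of_nonneg_of_le (fun l => integral_nonneg fun v => norm_nonneg _)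
        (fun l => ?_) hsummable
      rw [← integral_finsetSum _ fun k _ => (hfint k l).norm]
      exact integral_mono (integrable_finsetSum _ fun k _ => hfint k l).norm
        (integrable_finsetSum _ fun k _ => (hfint k l).norm) fun v => norm_sum_le _ _)
  have hval : ∀ l, ∫ v in Ioi (0 : ℝ), ∑ k : Nar w d, f k l v =
      ∑ k : Nar w d, laplaceTerm K b ϑ k l p := by
    intro l
    rw [integral_finsetSum _ fun k _ => hfint k l]
    exact Finset.sum_congr rfl fun k _ => hfval k l
  rw [← tsum_congr hval, hmain.tsum_eq]
  refine setIntegral_congr_fun measurableSet_Ioi fun v hv => ?_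
  have hv' : (0 : ℝ) < v := hv
  have hterm : ∀ k l, f k l v = b k * (((-1) ^ (d + ∑ j, w j)) ^ l *
      (cexp (ϑ * I) * (v ^ ((K : ℝ) / d) : ℝ)) ^ (d * l + k.1 + 1) *
        fjrwCoeff w d (d * l + k.1 + 1)) * ((v : ℂ) ^ N * cexp (-p * v)) := by
    intro k l
    have e1 : (v : ℂ) ^ ((s k l : ℂ) - 1) =
        ((v ^ ((K : ℝ) / d) : ℝ) : ℂ) ^ (d * l + k.1 + 1) * (v : ℂ) ^ N := by
      have : ((s k l : ℂ) - 1) = ((s k l - 1 : ℝ) : ℂ) := by push_cast; rfl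
      rw [this, ← ofReal_cpow hv'.le, ← ofReal_pow, ← ofReal_pow, ← ofReal_mul]
      congr 1
      rw [← Real.rpow_natCast, ← Real.rpow_natCast, ← Real.rpow_mul hv'.le, ← Real.rpow_add hv']
      congr 1
      simp only [hs, laplaceExponent]
      ring
    have e2 : cexp (ϑ * (d * l + k.1 + 1 : ℕ) * I) = cexp (ϑ * I) ^ (d * l + k.1 + 1) := by
      rw [← exp_nat_mul]; congr 1; ring
    simp only [hf, hc]
    rw [e1, e2, mul_pow]
    ring
  have hsm : ∀ k : Nar w d, Summable fun l => f k l v := by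
    intro k
    simp only [hterm]
    exact ((summable_narrowSeries_term hd hw (by omega) _ k.1).mul_left _).mul_right _
  rw [Summable.tsum_finsetSum fun k _ => hsm k]
  unfold laplaceIntegrand narrowSeries
  rw [mul_assoc, Finset.sum_mul]
  refine Finset.sum_congr rfl fun k _ => ?_
  simp only [hterm]
  rw [tsum_mul_right, tsum_mul_left]

lemma summable_laplaceTerm (hd : 0 < d) (hw : ∀ j, 0 < w j) (hK : 0 < K)
    (hsum : ∑ j, w j + K = d) (b : Nar w d → ℂ) (ϑ : ℝ) (k : Nar w d) {p : ℂ}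
    (hp : laplaceAbscissa w d K < ‖p‖) : Summable fun l => laplaceTerm K b ϑ k l p := by
  refine Summable.of_norm ?_
  simp only [norm_laplaceTerm hd hw]
  exact (summable_laplace hd hw hK hsum k.1 hp).mul_left _

lemma differentiableAt_tsum_laplaceTerm (hd : 0 < d) (hw : ∀ j, 0 < w j) (hK : 0 < K)
    (hsum : ∑ j, w j + K = d) (b : Nar w d → ℂ) (ϑ : ℝ) {p : ℂ} (hp0 : 0 < p.re)
    (hp : laplaceAbscissa w d K < ‖p‖) :
    DifferentiableAt ℂ (fun p => ∑' l : ℕ, ∑ k : Nar w d, laplaceTerm K b ϑ k l p) p := by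
  obtain ⟨r, hr, hrp⟩ := exists_between hp
  have hr0 : 0 < r := (laplaceAbscissa_pos hd hw hK).trans hr
  have hopen : IsOpen {p : ℂ | 0 < p.re ∧ r < ‖p‖} :=
    isOpen_re_pos.inter (isOpen_lt continuous_const continuous_norm)
  have h : DifferentiableOn ℂ (fun p => ∑' l : ℕ, ∑ k : Nar w d, laplaceTerm K b ϑ k l p)
      {p : ℂ | 0 < p.re ∧ r < ‖p‖} := by
    refine Complex.differentiableOn_tsum_of_summable_norm
      (u := fun l => ∑ k : Nar w d, ‖b k‖ * (fjrwCoeff w d (d * l + k.1 + 1) *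
        Real.Gamma (laplaceExponent N d K (d * l + k.1 + 1)) *
          r ^ (-laplaceExponent N d K (d * l + k.1 + 1)))) ?_ ?_ hopen ?_
    · exact summable_sum fun k _ => (summable_laplace hd hw hK hsum k.1 hr).mul_left _
    · intro l
      refine DifferentiableOn.fun_sum fun k _ => ?_
      intro q hq
      refine DifferentiableAt.differentiableWithinAt (DifferentiableAt.const_mul ?_ _)
      exact differentiableAt_id.cpow_const (Or.inl hq.1)
    · intro l q hq
      refine (norm_sum_le _ _).trans (Finset.sum_le_sum fun k _ => ?_)
      rw [norm_laplaceTerm hd hw]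
      have h1 := (fjrwCoeff_pos hd hw (Nat.succ_pos (d * l + k.1))).le
      have h2 := (Real.Gamma_pos_of_pos (laplaceExponent_pos N d K (d * l + k.1 + 1))).le
      have h3 : ‖q‖ ^ (-laplaceExponent N d K (d * l + k.1 + 1)) ≤
          r ^ (-laplaceExponent N d K (d * l + k.1 + 1)) :=
        Real.rpow_le_rpow_of_nonpos hr0 hq.2.le
          (neg_nonpos.2 (laplaceExponent_pos N d K (d * l + k.1 + 1)).le)
      gcongr
  exact h.differentiableAt (hopen.mem_nhds ⟨hp0, hrp⟩)

end Rays

section Relation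

variable {N : ℕ} {w : Fin N → ℕ} {d K : ℕ}

/-- The Laplace transform is given by its series on a half plane which is tilted by the angle `η`:
the two agree near the positive real axis, and a convex domain allows analytic continuation. -/
lemma integral_laplaceIntegrand_eq_of_tilted (hd : 0 < d) (hw : ∀ j, 0 < w j) (hK : 0 < K)
    (hsum : ∑ j, w j + K = d) (b : Nar w d → ℂ) {ϑ : ℝ} {C R : ℝ}
    (hF : ∀ r : ℝ, R ≤ r → ‖narrowSeries w d b (cexp (ϑ * I) * r)‖ ≤ C * r) {η : ℝ}
    (hη : 0 < Real.cos η) {p : ℂ} (hp0 : 0 < p.re)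
    (hp : laplaceAbscissa w d K < (p * cexp (-(η * I))).re) :
    ∫ v in Ioi (0 : ℝ), laplaceIntegrand K b ϑ v * cexp (-p * v) =
      ∑' l : ℕ, ∑ k : Nar w d, laplaceTerm K b ϑ k l p := by
  have hp₀ := laplaceAbscissa_pos hd hw hK
  set p₀ := laplaceAbscissa w d K with hp₀def
  set U : Set ℂ := {p | 0 < p.re} ∩ {p | p₀ < (p * cexp (-(η * I))).re} with hU
  have hexp : ‖cexp (-(η * I))‖ = 1 := by
    have := norm_exp_ofReal_mul_I (-η)
    rw [ofReal_neg, neg_mul] at this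
    exact this
  have hexpre : (cexp (-(η * I))).re = Real.cos η := by
    have := exp_ofReal_mul_I_re (-η)
    rw [ofReal_neg, neg_mul, Real.cos_neg] at this
    exact this
  have hlin : IsLinearMap ℝ fun p : ℂ => (p * cexp (-(η * I))).re :=
    ⟨fun x y => by rw [add_mul, add_re], fun c x => by
      rw [real_smul, mul_assoc, re_ofReal_mul, smul_eq_mul]⟩
  have hconv : Convex ℝ U := (convex_halfSpace_re_gt 0).inter (convex_halfSpace_gt hlin p₀)
  have hopen : IsOpen U := isOpen_re_pos.inter (isOpen_lt continuous_const (by fun_prop))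
  have hnorm : ∀ q ∈ U, p₀ < ‖q‖ := by
    intro q hq
    have h1 : (q * cexp (-(η * I))).re ≤ ‖q‖ := by
      have := re_le_norm (q * cexp (-(η * I)))
      rwa [norm_mul, hexp, mul_one] at this
    exact lt_of_lt_of_le hq.2 h1
  have hA : AnalyticOnNhd ℂ (fun p => ∫ v in Ioi (0 : ℝ), laplaceIntegrand K b ϑ v * cexp (-p * v))
      U := by
    refine ((differentiableOn_laplace fun δ hδ =>
      integrableOn_laplaceIntegrand hd hw hK hsum b hF hδ).mono inter_subset_left).analyticOnNhd hopen
  have hB : AnalyticOnNhd ℂ (fun p => ∑' l : ℕ, ∑ k : Nar w d, laplaceTerm K b ϑ k l p) U :=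
    DifferentiableOn.analyticOnNhd (fun q hq => (differentiableAt_tsum_laplaceTerm hd hw hK hsum b ϑ
      hq.1 (hnorm q hq)).differentiableWithinAt) hopen
  set x₀ : ℝ := (p₀ + 1) / Real.cos η with hx₀
  have hx₀p : p₀ + 1 ≤ x₀ := by
    rw [hx₀, le_div_iff₀ hη]
    nlinarith [Real.cos_le_one η]
  have hx₀U : (x₀ : ℂ) ∈ U := by
    refine ⟨?_, ?_⟩
    · simp only [mem_ofPred_eq, ofReal_re]; linarith
    · simp only [mem_ofPred_eq]
      rw [re_ofReal_mul, hexpre, hx₀, div_mul_cancel₀ _ hη.ne']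
      linarith
  refine hA.eqOn_of_preconnected_of_eventuallyEq hB hconv.isPreconnected hx₀U ?_ ⟨hp0, hp⟩
  have hmem : {q : ℂ | p₀ < q.re} ∈ 𝓝 (x₀ : ℂ) :=
    (isOpen_lt continuous_const continuous_re).mem_nhds (by
      simp only [mem_ofPred_eq, ofReal_re]; linarith)
  filter_upwards [hmem] with q hq
  exact integral_laplaceIntegrand_eq hd hw hK hsum b ϑ hq

/-- The value of the series on the ray of argument `η`, where all terms of a sector have the same
argument. -/
lemma laplaceTerm_exp (hd : 0 < d) (hw : ∀ j, 0 < w j) (hK : 0 < K) (b : Nar w d → ℂ)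
    {ϑ θ η τ : ℝ} (hτ : 0 < τ) (hη : η * ((K : ℝ) / d) = ϑ - θ) (hηpi : |η| < Real.pi / 2)
    (hθ : (-1) ^ (d + ∑ j, w j) * cexp (θ * d * I) = 1) (k : Nar w d) (l : ℕ) :
    laplaceTerm K b ϑ k l (τ * cexp (η * I)) =
      cexp (-(η * (N + 1) * I)) * (τ ^ (-(N + 1 : ℝ)) : ℝ) * (b k * cexp (θ * (k.1 + 1 : ℕ) * I)) *
        (borelCoeff w d K (d * l + k.1 + 1) *
          (borelRate w d K * τ ^ (-((K : ℝ) / d))) ^ (d * l + k.1 + 1) : ℝ) := by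
  set M := d * l + k.1 + 1 with hM
  set s := laplaceExponent N d K M with hs
  have hpi := Real.pi_pos
  obtain ⟨hη1, hη2⟩ := abs_lt.1 hηpi
  have hlog : log (τ * cexp (η * I)) = Real.log τ + η * I := by
    have e : (τ : ℂ) * cexp (η * I) = cexp (Real.log τ + η * I) := by
      rw [Complex.exp_add, ← ofReal_exp, Real.exp_log hτ]
    rw [e, log_exp]
    · simp; linarith
    · simp; linarith
  have hne : (τ : ℂ) * cexp (η * I) ≠ 0 :=
    mul_ne_zero (ofReal_ne_zero.2 hτ.ne') (exp_ne_zero _)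
  have hpow : ((τ : ℂ) * cexp (η * I)) ^ (-(s : ℂ)) = (τ ^ (-s) : ℝ) * cexp (-(η * s * I)) := by
    rw [cpow_def_of_ne_zero hne, hlog, Real.rpow_def_of_pos hτ, ofReal_exp, ← Complex.exp_add]
    congr 1
    push_cast
    ring
  have hηs : η * s = (ϑ - θ) * M + η * (N + 1) := by
    rw [hs, laplaceExponent, ← hη]; ring
  have hphase : ((-1) ^ (d + ∑ j, w j)) ^ l * cexp (ϑ * (M : ℕ) * I) * cexp (-(η * s * I)) =
      cexp (-(η * (N + 1) * I)) * cexp (θ * (k.1 + 1 : ℕ) * I) := by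
    have h1 : (η : ℂ) * s = (ϑ - θ) * M + η * (N + 1) := by exact_mod_cast hηs
    have h2 : ((-1) ^ (d + ∑ j, w j)) ^ l * cexp (θ * d * I) ^ l = 1 := by
      rw [← mul_pow, hθ, one_pow]
    rw [h1, mul_assoc, ← Complex.exp_add]
    have h3 : ϑ * (M : ℕ) * I + -(((ϑ - θ) * M + η * (N + 1)) * I) =
        (l : ℕ) * (θ * d * I) + (-(η * (N + 1) * I) + θ * (k.1 + 1 : ℕ) * I) := by
      rw [hM]; push_cast; ring
    rw [h3, Complex.exp_add, exp_nat_mul, ← mul_assoc, h2, one_mul, Complex.exp_add]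
  have hreal := fjrwCoeff_mul_Gamma_mul_rpow hd hw hK M hτ
  unfold laplaceTerm
  rw [← hM, ← hs, hpow]
  rw [← hs] at hreal
  have hreal' : ((fjrwCoeff w d M * Real.Gamma s : ℝ) : ℂ) * ((τ ^ (-s) : ℝ) : ℂ) =
      (borelCoeff w d K M * (borelRate w d K * τ ^ (-((K : ℝ) / d))) ^ M : ℝ) *
        ((τ ^ (-(N + 1 : ℝ)) : ℝ) : ℂ) := by
    rw [← ofReal_mul, hreal, ofReal_mul]
  calc _ = b k * (((-1) ^ (d + ∑ j, w j)) ^ l * cexp (ϑ * (M : ℕ) * I) * cexp (-(η * s * I))) *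
        (((fjrwCoeff w d M * Real.Gamma s : ℝ) : ℂ) * ((τ ^ (-s) : ℝ) : ℂ)) := by ring
    _ = _ := by rw [hphase, hreal']; ring

/-- If a linear combination of the components of the FJRW `I`-function has polynomial growth on a
ray of argument `ϑ`, then its coefficients satisfy a linear relation for each direction `θ` close to
`ϑ` in which the terms of each sector have constant argument: otherwise the positivity of the
coefficients would produce a singularity of the Laplace transform. -/
theorem sum_mul_cexp_eq_zero (hd : 0 < d) (hw : ∀ j, 0 < w j) (hK : 0 < K)
    (hsum : ∑ j, w j + K = d) (b : Nar w d → ℂ) {ϑ θ : ℝ} {C R : ℝ}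
    (hF : ∀ r : ℝ, R ≤ r → ‖narrowSeries w d b (cexp (ϑ * I) * r)‖ ≤ C * r)
    (hθ : (-1) ^ (d + ∑ j, w j) * cexp (θ * d * I) = 1)
    (hϑ : |ϑ - θ| * d / K < Real.pi / 2) :
    ∑ k : Nar w d, b k * cexp (θ * (k.1 + 1 : ℕ) * I) = 0 := by
  have hdr : (0 : ℝ) < d := Nat.cast_pos.2 hd
  have hKr : (0 : ℝ) < K := Nat.cast_pos.2 hK
  set η : ℝ := (ϑ - θ) * d / K with hη
  have hη1 : η * ((K : ℝ) / d) = ϑ - θ := by rw [hη]; field_simp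
  have hη2 : |η| < Real.pi / 2 := by
    rw [hη, abs_div, abs_mul, abs_of_pos hdr, abs_of_pos hKr]
    exact hϑ
  have hcos : 0 < Real.cos η := Real.cos_pos_of_mem_Ioo ⟨(abs_lt.1 hη2).1, (abs_lt.1 hη2).2⟩
  have hp₀ := laplaceAbscissa_pos hd hw hK
  set p₀ := laplaceAbscissa w d K with hp₀def
  set H : ℂ → ℂ := fun p => ∫ v in Ioi (0 : ℝ), laplaceIntegrand K b ϑ v * cexp (-p * v) with hH
  -- `x` is the variable of the power series, normalised to radius of convergence one
  set τ : ℝ → ℝ := fun x => p₀ * x ^ (-(1 / (K : ℝ))) with hτ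
  set y : ℝ → ℝ := fun x => x ^ (1 / (d : ℝ)) with hy
  set u : ℕ → ℕ → ℝ := fun k l => borelCoeff w d K (d * l + k + 1) with hu
  set V : ℝ → ℝ := fun x => ∑' l : ℕ, borelCoeff w d K (d * (l + 1)) * x ^ l with hV
  have hmem : ∀ᶠ x : ℝ in 𝓝[<] 1, 0 < x ∧ x < 1 := by
    filter_upwards [Ioo_mem_nhdsLT (zero_lt_one (α := ℝ))] with x hx
    exact hx
  have hval : ∀ x : ℝ, 0 < x → x < 1 → H (τ x * cexp (η * I)) =
      cexp (-(η * (N + 1) * I)) * (τ x ^ (-(N + 1 : ℝ)) : ℝ) *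
        ∑ k : Nar w d, (b k * cexp (θ * (k.1 + 1 : ℕ) * I)) *
          (y x ^ (k.1 + 1 : ℕ) * ∑' l : ℕ, u k.1 l * x ^ l : ℝ) := by
    intro x hx0 hx1
    have hτx : p₀ < τ x := by
      have : 1 < x ^ (-(1 / (K : ℝ))) := Real.one_lt_rpow_of_pos_of_lt_one_of_neg hx0 hx1
        (by rw [neg_lt_zero]; positivity)
      simp only [hτ]
      nlinarith
    have hτ0 : 0 < τ x := hp₀.trans hτx
    have hyx : borelRate w d K * τ x ^ (-((K : ℝ) / d)) = y x := by
      simp only [hτ, hy]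
      rw [Real.mul_rpow hp₀.le (Real.rpow_nonneg hx0.le _), ← Real.rpow_mul hx0.le,
        borelRate_eq hd hw hK, ← mul_assoc, ← hp₀def, ← Real.rpow_add hp₀, add_neg_cancel,
        Real.rpow_zero, one_mul]
      congr 1
      field_simp
    have hyd : y x ^ d = x := by
      simp only [hy]
      rw [← Real.rpow_natCast, ← Real.rpow_mul hx0.le, one_div, inv_mul_cancel₀ hdr.ne',
        Real.rpow_one]
    have hnormτ : ‖(τ x : ℂ) * cexp (η * I)‖ = τ x := by
      rw [norm_mul, norm_exp_ofReal_mul_I, mul_one, norm_real, Real.norm_of_nonneg hτ0.le]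
    simp only [hH]
    rw [integral_laplaceIntegrand_eq_of_tilted hd hw hK hsum b hF hcos (p := τ x * cexp (η * I))]
    · rw [Summable.tsum_finsetSum fun k _ => summable_laplaceTerm hd hw hK hsum b ϑ k
        (by rw [hnormτ]; exact hτx), Finset.mul_sum]
      refine Finset.sum_congr rfl fun k _ => ?_
      simp only [laplaceTerm_exp hd hw hK b hτ0 hη1 hη2 hθ k, hyx]
      rw [tsum_mul_left, mul_assoc (cexp _ * _), ← ofReal_tsum]
      congr 3
      rw [← tsum_mul_left]
      refine tsum_congr fun l => ?_
      rw [add_assoc, pow_add (y x) (d * l), pow_mul, hyd]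
      simp only [hu]
      ring_nf
    · rw [re_ofReal_mul, exp_ofReal_mul_I_re]
      positivity
    · rw [mul_assoc, ← Complex.exp_add, add_neg_cancel, Complex.exp_zero, mul_one, ofReal_re]
      exact hτx
  have hτlim : Tendsto τ (𝓝[<] 1) (𝓝 p₀) := by
    have h1 : Tendsto (fun x : ℝ => x ^ (-(1 / (K : ℝ)))) (𝓝[<] 1) (𝓝 (1 ^ (-(1 / (K : ℝ))))) :=
      (tendsto_id.mono_left nhdsWithin_le_nhds).rpow_const (Or.inl one_ne_zero)
    rw [Real.one_rpow] at h1
    have h2 := h1.const_mul p₀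
    rwa [mul_one] at h2
  have hylim : Tendsto y (𝓝[<] 1) (𝓝 1) := by
    have h1 : Tendsto y (𝓝[<] 1) (𝓝 (1 ^ (1 / (d : ℝ)))) :=
      (tendsto_id.mono_left nhdsWithin_le_nhds).rpow_const (Or.inl one_ne_zero)
    rwa [Real.one_rpow] at h1
  have hHlim : Tendsto (fun x => H (τ x * cexp (η * I))) (𝓝[<] 1) (𝓝 (H (p₀ * cexp (η * I)))) := by
    have h1 : ContinuousAt H (p₀ * cexp (η * I)) := by
      refine DifferentiableAt.continuousAt (𝕜 := ℂ) ((differentiableOn_laplace fun δ hδ =>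
        integrableOn_laplaceIntegrand hd hw hK hsum b hF hδ).differentiableAt
          (isOpen_re_pos.mem_nhds ?_))
      simp only [mem_ofPred_eq]
      rw [re_ofReal_mul, exp_ofReal_mul_I_re]
      positivity
    refine h1.tendsto.comp ?_
    exact ((continuous_ofReal.tendsto p₀).comp hτlim).mul_const _
  obtain ⟨c, hc, hcv⟩ := exists_le_borelCoeff hw hd hK hsum
  have hVsum : ∀ x : ℝ, 0 < x → x < 1 → Summable fun l => borelCoeff w d K (d * (l + 1)) * x ^ l := by
    intro x hx0 hx1
    refine (summable_borelCoeff hw hd hK hsum (d - 1) hx0 hx1).congr fun l => ?_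
    rw [show d * l + (d - 1) + 1 = d * (l + 1) by rw [Nat.mul_succ]; omega]
  have hAbel : ∀ k : Nar w d, Tendsto V (𝓝[<] 1) atTop ∧
      Tendsto (fun x => (∑' l : ℕ, u k.1 l * x ^ l) / V x) (𝓝[<] 1) (𝓝 1) := fun k =>
    tendsto_tsum_div_tsum hc hcv (fun x hx0 hx1 => summable_borelCoeff hw hd hK hsum k.1 hx0 hx1)
      hVsum (tendsto_borelCoeff_div hw hd hK hsum k.1.2)
  rcases isEmpty_or_nonempty (Nar w d) with hE | ⟨⟨k₀⟩⟩
  · exact Finset.sum_of_isEmpty _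
  have hVlim := (hAbel k₀).1
  have hlim1 : Tendsto (fun x => H (τ x * cexp (η * I)) * ((V x)⁻¹ : ℝ)) (𝓝[<] 1) (𝓝 0) := by
    have h1 : Tendsto (fun x => (((V x)⁻¹ : ℝ) : ℂ)) (𝓝[<] 1) (𝓝 ((0 : ℝ) : ℂ)) :=
      (continuous_ofReal.tendsto 0).comp (tendsto_inv_atTop_zero.comp hVlim)
    have h2 := hHlim.mul h1
    rwa [ofReal_zero, mul_zero] at h2
  have hlim2 : Tendsto (fun x => cexp (-(η * (N + 1) * I)) * (τ x ^ (-(N + 1 : ℝ)) : ℝ) *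
        ∑ k : Nar w d, (b k * cexp (θ * (k.1 + 1 : ℕ) * I)) *
          (y x ^ (k.1 + 1 : ℕ) * ((∑' l : ℕ, u k.1 l * x ^ l) / V x) : ℝ)) (𝓝[<] 1)
      (𝓝 (cexp (-(η * (N + 1) * I)) * (p₀ ^ (-(N + 1 : ℝ)) : ℝ) *
        ∑ k : Nar w d, (b k * cexp (θ * (k.1 + 1 : ℕ) * I)) * (1 ^ (k.1 + 1 : ℕ) * 1 : ℝ))) := by
    refine Tendsto.mul (Tendsto.const_mul _ ?_) (tendsto_finsetSum _ fun k _ => Tendsto.const_mul _ ?_)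
    · exact (continuous_ofReal.tendsto _).comp (hτlim.rpow_const (Or.inl hp₀.ne'))
    · exact (continuous_ofReal.tendsto _).comp ((hylim.pow _).mul (hAbel k).2)
  have heq : (fun x => H (τ x * cexp (η * I)) * ((V x)⁻¹ : ℝ)) =ᶠ[𝓝[<] 1]
      fun x => cexp (-(η * (N + 1) * I)) * (τ x ^ (-(N + 1 : ℝ)) : ℝ) *
        ∑ k : Nar w d, (b k * cexp (θ * (k.1 + 1 : ℕ) * I)) *
          (y x ^ (k.1 + 1 : ℕ) * ((∑' l : ℕ, u k.1 l * x ^ l) / V x) : ℝ) := by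
    filter_upwards [hmem] with x hx
    rw [hval x hx.1 hx.2, mul_assoc, Finset.sum_mul]
    congr 1
    refine Finset.sum_congr rfl fun k _ => ?_
    rw [mul_assoc (b k * _), ← ofReal_mul, div_eq_mul_inv, mul_assoc (y x ^ _)]
  have h0 := tendsto_nhds_unique (hlim1.congr' heq) hlim2
  have hne : cexp (-(η * (N + 1) * I)) * ((p₀ ^ (-(N + 1 : ℝ)) : ℝ) : ℂ) ≠ 0 :=
    mul_ne_zero (exp_ne_zero _) (ofReal_ne_zero.2 (Real.rpow_pos_of_pos hp₀ _).ne')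
  have h1 := (mul_eq_zero.1 h0.symm).resolve_left hne
  simpa using h1

end Relation

/-! ### Dimensions of the state spaces -/

section Nondegeneracy

variable {N : ℕ} {w : Fin N → ℕ} {d : ℕ}

/-- The chain rule for the restriction of a polynomial to a line parallel to a coordinate axis. -/
lemma derivative_aeval_line (x : Fin N → ℂ) (i : Fin N) (W : MvPolynomial (Fin N) ℂ) :
    Polynomial.derivative (MvPolynomial.aeval
      (fun k => Polynomial.C (x k) + Polynomial.C ((Pi.single i 1 : Fin N → ℂ) k) * Polynomial.X) W) =
    MvPolynomial.aeval
      (fun k => Polynomial.C (x k) + Polynomial.C ((Pi.single i 1 : Fin N → ℂ) k) * Polynomial.X)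
      (MvPolynomial.pderiv i W) := by
  induction W using MvPolynomial.induction_on with
  | C a => simp
  | add p q hp hq => simp only [map_add, hp, hq]
  | mul_X p k hp =>
    rw [map_mul, Polynomial.derivative_mul, hp, Derivation.leibniz, map_add, smul_eq_mul, smul_eq_mul,
      map_mul, map_mul, MvPolynomial.aeval_X, MvPolynomial.pderiv_X]
    rcases eq_or_ne k i with rfl | h
    · simp
      ring
    · rw [Pi.single_eq_of_ne h, Pi.single_eq_of_ne h]
      simp
      ring

lemma eval_aeval_line (x : Fin N → ℂ) (i : Fin N) (W : MvPolynomial (Fin N) ℂ) (s : ℂ) :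
    Polynomial.eval s (MvPolynomial.aeval
      (fun k => Polynomial.C (x k) + Polynomial.C ((Pi.single i 1 : Fin N → ℂ) k) * Polynomial.X) W) =
    MvPolynomial.eval (fun k => x k + (Pi.single i 1 : Fin N → ℂ) k * s) W := by
  induction W using MvPolynomial.induction_on with
  | C a => simp
  | add p q hp hq => simp only [map_add, Polynomial.eval_add, hp, hq]
  | mul_X p k hp => simp [hp]

/-- A nonzero fixed point of a root of unity of order dividing `d` cannot lie on a fixed space on
which `W` vanishes: the derivatives along the fixed space vanish, and those in the other directions
vanish because `W` is invariant. -/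
lemma exists_eval_ne_zero (hW : IsNondegenerate w d W) {lam : ℂ} (hlam : lam ^ d = 1)
    (hne : fixedSpace w lam ≠ ⊥) :
    ¬ ∀ x ∈ fixedSpace w lam, MvPolynomial.eval x W = 0 := by
  intro h
  apply hne
  rw [Submodule.eq_bot_iff]
  intro x hx
  refine (hW.singular_iff x).1 fun i => ?_
  by_cases hi : lam ^ w i = 1
  · have hzero : MvPolynomial.aeval
        (fun k => Polynomial.C (x k) + Polynomial.C ((Pi.single i 1 : Fin N → ℂ) k) * Polynomial.X) W =
          (0 : Polynomial ℂ) := by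
      refine Polynomial.funext fun s => ?_
      rw [eval_aeval_line, Polynomial.eval_zero]
      refine h _ fun j => ?_
      rcases eq_or_ne j i with rfl | hj
      · rw [hi, one_mul]
      · rw [Pi.single_eq_of_ne hj, zero_mul, add_zero]
        exact hx j
    have h1 := derivative_aeval_line x i W
    rw [hzero, Polynomial.derivative_zero] at h1
    have h2 := eval_aeval_line x i (MvPolynomial.pderiv i W) 0
    rw [← h1, Polynomial.eval_zero] at h2
    simpa using h2.symm
  · have hsum : MvPolynomial.pderiv i W = ∑ m ∈ W.support,
        MvPolynomial.monomial (m - Finsupp.single i 1) (W.coeff m * m i) := by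
      conv_lhs => rw [W.as_sum]
      rw [map_sum]
      simp only [MvPolynomial.pderiv_monomial]
    rw [hsum, map_sum]
    refine Finset.sum_eq_zero fun m hm => ?_
    rw [MvPolynomial.eval_monomial]
    rcases Nat.eq_zero_or_pos (m i) with h0 | h0
    · rw [h0]; simp
    by_cases hall : ∀ j, (m - Finsupp.single i 1 : Fin N →₀ ℕ) j ≠ 0 → lam ^ w j = 1
    · exfalso
      apply hi
      have hdeg : Finsupp.weight w m = d := hW.homogeneous (MvPolynomial.mem_support_iff.1 hm)
      have hm' : m = (m - Finsupp.single i 1) + Finsupp.single i 1 :=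
        (tsub_add_cancel_of_le (Finsupp.single_le_iff.2 h0)).symm
      rw [hm', map_add, Finsupp.weight_apply w (Finsupp.single i 1),
        Finsupp.sum_single_index (by rw [zero_smul]), one_smul] at hdeg
      have h3 : lam ^ Finsupp.weight w (m - Finsupp.single i 1) = 1 := by
        rw [Finsupp.weight_apply, Finsupp.sum, ← Finset.prod_pow_eq_pow_sum]
        refine Finset.prod_eq_one fun j hj => ?_
        rw [smul_eq_mul, mul_comm, pow_mul, hall j (Finsupp.mem_support_iff.1 hj), one_pow]
      rw [← hdeg, pow_add, h3, one_mul] at hlam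
      exact hlam
    · push Not at hall
      obtain ⟨j, hj, hj'⟩ := hall
      have hxj : x j = 0 := by
        have h1 : (lam ^ w j - 1) * x j = 0 := by rw [sub_mul, hx j, one_mul, sub_self]
        exact (mul_eq_zero.1 h1).resolve_left (sub_ne_zero.2 hj')
      refine mul_eq_zero_of_right _ (Finset.prod_eq_zero (Finsupp.mem_support_iff.2 hj) ?_)
      change x j ^ (m - Finsupp.single i 1 : Fin N →₀ ℕ) j = 0
      rw [hxj, zero_pow hj]

lemma finrank_fixedSpace (w : Fin N → ℕ) (lam : ℂ) :
    Module.finrank ℂ (fixedSpace w lam) =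
      Nat.card {j // lam ^ w j = 1} := by
  classical
  have h : fixedSpace w lam = ⨅ i ∈ {j | lam ^ w j ≠ 1},
      LinearMap.ker (LinearMap.proj i : (Fin N → ℂ) →ₗ[ℂ] ℂ) := by
    ext x
    simp only [Submodule.mem_iInf, LinearMap.mem_ker, LinearMap.proj_apply, mem_ofPred_eq]
    constructor
    · intro hx j hj
      have h1 : (lam ^ w j - 1) * x j = 0 := by rw [sub_mul, hx j, one_mul, sub_self]
      exact (mul_eq_zero.1 h1).resolve_left (sub_ne_zero.2 hj)
    · intro hx j
      by_cases hj : lam ^ w j = 1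
      · rw [hj, one_mul]
      · rw [hx j hj, mul_zero]
  have e := LinearMap.iInfKerProjEquiv ℂ (fun _ : Fin N => ℂ) (I := {j | lam ^ w j = 1})
    (J := {j | lam ^ w j ≠ 1}) (by
      rw [Set.disjoint_left]; intro j hj hj'; exact hj' hj) (by
      intro j _; exact em _)
  rw [h, e.finrank_eq, Module.finrank_fintype_fun_eq_card, Nat.card_eq_fintype_card]
  rfl

end Nondegeneracy

section Count

variable {N : ℕ} {w : Fin N → ℕ} {d : ℕ}

/-- The number of weights fixed by `exp (2 π i m / d)`. -/
def fixedCount (w : Fin N → ℕ) (d m : ℕ) : ℕ := (Finset.univ.filter fun j => d ∣ m * w j).card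

lemma fixedCount_pos_iff (m : ℕ) : 0 < fixedCount w d m ↔ ∃ j, d ∣ m * w j := by
  unfold fixedCount
  rw [Finset.card_pos]
  simp [Finset.Nonempty]

lemma finrank_fixedSpace_rootOfUnity (hd : 0 < d) (m : ℕ) :
    Module.finrank ℂ (fixedSpace w (rootOfUnity ((m : ℚ) / d))) = fixedCount w d m := by
  rw [finrank_fixedSpace, fixedCount, ← Fintype.card_subtype, Nat.card_eq_fintype_card]
  exact Fintype.card_congr (Equiv.subtypeEquivRight fun j => rootOfUnity_pow_eq_one_iff hd)

lemma ambientLength_eq (hd : 0 < d) {W : MvPolynomial (Fin N) ℂ} (hW : IsNondegenerate w d W)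
    {m : ℕ} (hm : 0 < fixedCount w d m) :
    ambientLength w W ((m : ℚ) / d) = fixedCount w d m - 1 := by
  unfold ambientLength
  rw [if_neg, finrank_fixedSpace_rootOfUnity hd]
  refine exists_eval_ne_zero hW ((rootOfUnity_pow_eq_one_iff hd).2 (Nat.dvd_mul_left d m)) ?_
  intro h
  rw [← finrank_fixedSpace_rootOfUnity hd, h, finrank_bot] at hm
  exact lt_irrefl _ hm

/-- The numbers `m` such that `m / d` indexes a sector. -/
def sectorNumbers (w : Fin N → ℕ) (d : ℕ) : Finset ℕ :=
  (Finset.range d).filter fun m => 0 < fixedCount w d m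

lemma injective_div (hd : 0 < d) : Function.Injective fun m : ℕ => (m : ℚ) / d := by
  have hdq : (d : ℚ) ≠ 0 := Nat.cast_ne_zero.2 hd.ne'
  intro m n h
  have h' : (m : ℚ) / d = n / d := h
  rw [div_left_inj' hdq] at h'
  exact_mod_cast h'

lemma sectors_eq (hd : 0 < d) (hw : ∀ j, 0 < w j) (hG : ∀ j, w j ∣ d) :
    sectors w = (sectorNumbers w d).image fun m : ℕ => (m : ℚ) / d := by
  have hdq : (d : ℚ) ≠ 0 := Nat.cast_ne_zero.2 hd.ne'
  ext f
  simp only [sectors, sectorNumbers, Finset.mem_biUnion, Finset.mem_univ, true_and,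
    Finset.mem_image, Finset.mem_range, Finset.mem_filter, fixedCount_pos_iff]
  constructor
  · rintro ⟨j, k, hk, rfl⟩
    obtain ⟨e, he⟩ := hG j
    have he0 : 0 < e := by
      rcases Nat.eq_zero_or_pos e with rfl | h
      · omega
      · exact h
    have hwq : (w j : ℚ) ≠ 0 := Nat.cast_ne_zero.2 (hw j).ne'
    refine ⟨k * e, ⟨?_, j, k, ?_⟩, ?_⟩
    · rw [he]; exact Nat.mul_lt_mul_of_pos_right hk he0
    · rw [he]; ring
    · have : (d : ℚ) = w j * e := by exact_mod_cast he
      have heq : (e : ℚ) ≠ 0 := Nat.cast_ne_zero.2 he0.ne'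
      rw [this]; push_cast; field_simp
  · rintro ⟨m, ⟨hm, j, n, hn⟩, rfl⟩
    have hwq : (w j : ℚ) ≠ 0 := Nat.cast_ne_zero.2 (hw j).ne'
    refine ⟨j, n, ?_, ?_⟩
    · have h1 : d * n < d * w j := by
        rw [← hn]; exact Nat.mul_lt_mul_of_pos_right hm (hw j)
      exact Nat.lt_of_mul_lt_mul_left h1
    · rw [div_eq_div_iff hwq hdq]
      have : (m : ℚ) * w j = d * n := by exact_mod_cast hn
      linear_combination -this

lemma card_filter_dvd_mul (hd : 0 < d) {c : ℕ} (hc : 0 < c) (hcd : c ∣ d) :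
    ((Finset.range d).filter fun m => d ∣ m * c).card = c := by
  obtain ⟨e, rfl⟩ := hcd
  have he : 0 < e := Nat.pos_of_mul_pos_left hd
  have h1 : ((Finset.range (c * e)).filter fun m => c * e ∣ m * c) =
      (Finset.range c).image fun k => k * e := by
    ext m
    simp only [Finset.mem_filter, Finset.mem_range, Finset.mem_image]
    rw [mul_comm m c, Nat.mul_dvd_mul_iff_left hc]
    constructor
    · rintro ⟨hm, k, rfl⟩
      refine ⟨k, ?_, mul_comm _ _⟩
      rw [mul_comm] at hm
      exact Nat.lt_of_mul_lt_mul_right hm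
    · rintro ⟨k, hk, rfl⟩
      exact ⟨Nat.mul_lt_mul_of_pos_right hk he, Dvd.intro_left k rfl⟩
  rw [h1, Finset.card_image_of_injective _ fun a b h => Nat.eq_of_mul_eq_mul_right he h,
    Finset.card_range]

lemma sum_fixedCount (hd : 0 < d) (hw : ∀ j, 0 < w j) (hG : ∀ j, w j ∣ d) :
    ∑ m ∈ sectorNumbers w d, fixedCount w d m = ∑ j, w j := by
  have h1 : ∑ m ∈ sectorNumbers w d, fixedCount w d m =
      ∑ m ∈ Finset.range d, fixedCount w d m := by
    refine Finset.sum_subset (Finset.filter_subset _ _) fun m hm hm' => ?_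
    by_contra hne
    exact hm' (Finset.mem_filter.2 ⟨hm, Nat.pos_of_ne_zero hne⟩)
  rw [h1]
  simp only [fixedCount, Finset.card_filter]
  rw [Finset.sum_comm]
  refine Finset.sum_congr rfl fun j _ => ?_
  rw [← Finset.card_filter, card_filter_dvd_mul hd (hw j) (hG j)]

/-- A residue class modulo `d` is narrow exactly if it is not the class of a sector of the inertia
stack. -/
lemma card_nar_add_card (hd : 0 < d) :
    Fintype.card (Nar w d) + (sectorNumbers w d).card = d := by
  classical
  have h1 : Fintype.card (Nar w d) =
      ((Finset.range d).filter fun k => ∀ j, ¬ d ∣ (k + 1) * w j).card := by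
    rw [← Nat.card_eq_fintype_card]
    have : Nat.card (Nar w d) = Nat.card {k : Fin d // ∀ j, ¬ d ∣ ((k : ℕ) + 1) * w j} :=
      Nat.card_congr (Equiv.subtypeEquivRight fun k => fixedSpace_eq_bot_iff_not_dvd hd k)
    rw [this, Nat.card_eq_fintype_card, Fintype.card_subtype]
    refine Finset.card_bij (fun k _ => (k : ℕ)) (fun k hk => ?_) (fun a _ b _ h => Fin.ext h)
      fun k hk => ?_
    · rw [Finset.mem_filter] at hk ⊢
      exact ⟨Finset.mem_range.2 k.2, hk.2⟩
    · rw [Finset.mem_filter, Finset.mem_range] at hk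
      exact ⟨⟨k, hk.1⟩, Finset.mem_filter.2 ⟨Finset.mem_univ _, hk.2⟩, rfl⟩
  have hper : Function.Periodic (fun m => ∃ j, d ∣ m * w j) d := by
    intro m
    simp only [eq_iff_iff]
    refine exists_congr fun j => ?_
    rw [add_mul]
    exact (Nat.dvd_add_iff_left (Nat.dvd_mul_right d (w j))).symm
  have h2 : (sectorNumbers w d).card =
      ((Finset.range d).filter fun k => ∃ j, d ∣ (k + 1) * w j).card := by
    have e1 := Nat.filter_Ico_card_eq_of_periodic 0 d (fun m => ∃ j, d ∣ m * w j) hper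
    have e2 := Nat.filter_Ico_card_eq_of_periodic 1 d (fun m => ∃ j, d ∣ m * w j) hper
    have e3 : sectorNumbers w d =
        (Finset.Ico 0 (0 + d)).filter (fun m => ∃ j, d ∣ m * w j) := by
      unfold sectorNumbers
      rw [zero_add, ← Finset.range_eq_Ico]
      simp only [fixedCount_pos_iff]
    rw [e3, e1, ← e2]
    symm
    refine Finset.card_bij (fun k _ => k + 1) (fun k hk => ?_) (fun a _ b _ h => by
      simpa using h) fun k hk => ?_
    · rw [Finset.mem_filter, Finset.mem_range] at hk
      rw [Finset.mem_filter, Finset.mem_Ico]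
      exact ⟨by omega, hk.2⟩
    · rw [Finset.mem_filter, Finset.mem_Ico] at hk
      refine ⟨k - 1, ?_, Nat.sub_add_cancel hk.1.1⟩
      rw [Finset.mem_filter, Finset.mem_range, Nat.sub_add_cancel hk.1.1]
      exact ⟨by omega, hk.2⟩
  have h3 := Finset.card_filter_add_card_filter_not (s := Finset.range d)
    (fun k => ∀ j, ¬ d ∣ (k + 1) * w j)
  rw [Finset.card_range] at h3
  rw [h1, h2]
  convert h3 using 3
  refine Finset.filter_congr fun k _ => ?_
  push Not
  rfl

/-- The sector of index `f` contributes `N_f - 1` to the ambient cohomology, and the numbers `N_f` add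
up to `∑ⱼ wⱼ`. -/
lemma finrank_ambientSpace_add (hd : 0 < d) (hw : ∀ j, 0 < w j) (hG : ∀ j, w j ∣ d)
    {W : MvPolynomial (Fin N) ℂ} (hW : IsNondegenerate w d W) :
    Module.finrank ℂ (AmbientSpace w W) + (sectorNumbers w d).card = ∑ j, w j := by
  rw [Module.finrank_fintype_fun_eq_card, Fintype.card_sigma]
  simp only [Fintype.card_fin]
  rw [Finset.sum_coe_sort (sectors w) fun f => ambientLength w W f, sectors_eq hd hw hG,
    Finset.sum_image fun a _ b _ h => injective_div hd h, ← sum_fixedCount hd hw hG,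
    Finset.card_eq_sum_ones, ← Finset.sum_add_distrib]
  refine Finset.sum_congr rfl fun m hm => ?_
  have hm' := (Finset.mem_filter.1 hm).2
  rw [ambientLength_eq hd hW hm']
  omega

/-- The narrow state space exceeds the ambient cohomology in dimension by `κ`. -/
lemma card_nar_eq (hd : 0 < d) (hw : ∀ j, 0 < w j) (hG : ∀ j, w j ∣ d) {K : ℕ}
    (hsum : ∑ j, w j + K = d) {W : MvPolynomial (Fin N) ℂ} (hW : IsNondegenerate w d W) :
    Fintype.card (Nar w d) = Module.finrank ℂ (AmbientSpace w W) + K := by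
  have h1 := finrank_ambientSpace_add hd hw hG hW
  have h2 := card_nar_add_card (w := w) hd
  omega

/-- Each sector `f` of the inertia stack is `⟨-a / d⟩` for a residue class `a` modulo `d`. -/
lemma exists_sector_residue (hd : 0 < d) (hw : ∀ j, 0 < w j) (hG : ∀ j, w j ∣ d)
    {W : MvPolynomial (Fin N) ℂ} (hW : IsNondegenerate w d W) (p : AmbientIndex w W) :
    ∃ a < d, p.1.1 = Int.fract (-((a : ℚ) / d)) ∧ (p.2 : ℕ) + 2 ≤ fixedCount w d a := by
  have hdq : (0 : ℚ) < d := Nat.cast_pos.2 hd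
  obtain ⟨⟨f, hf⟩, r⟩ := p
  have hf' := hf
  rw [sectors_eq hd hw hG, Finset.mem_image] at hf'
  obtain ⟨m, hm, rfl⟩ := hf'
  obtain ⟨hmd, hm0⟩ := Finset.mem_filter.1 hm
  rw [Finset.mem_range] at hmd
  have hr : (r : ℕ) < fixedCount w d m - 1 := r.2.trans_eq (ambientLength_eq hd hW hm0)
  have hcount : fixedCount w d ((d - m) % d) = fixedCount w d m := by
    rcases Nat.eq_zero_or_pos m with rfl | hmpos
    · rw [Nat.sub_zero, Nat.mod_self]
    rw [Nat.mod_eq_of_lt (by omega)]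
    unfold fixedCount
    congr 1
    refine Finset.filter_congr fun j _ => ?_
    rw [Nat.sub_mul]
    exact Nat.dvd_sub_iff_right (Nat.mul_le_mul_right _ hmd.le) (Nat.dvd_mul_right d (w j))
  refine ⟨(d - m) % d, Nat.mod_lt _ hd, ?_, ?_⟩
  · simp only
    rcases Nat.eq_zero_or_pos m with rfl | hmpos
    · simp
    · rw [Nat.mod_eq_of_lt (by omega), Nat.cast_sub hmd.le, sub_div, div_self hdq.ne', neg_sub,
        Int.fract_sub_one, eq_comm, Int.fract_eq_self]
      exact ⟨by positivity, (div_lt_one hdq).2 (by exact_mod_cast hmd)⟩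
  · rw [hcount]
    simp only
    omega

end Count

/-! ### Independence of the terms of the Gromov–Witten `I`-function -/

section Independence

variable {N : ℕ} {w : Fin N → ℕ} {d : ℕ}

lemma ofReal_mul_cexp_mem_goodSector (hw0 : 0 < ∑ j, w j) (hκ : ∑ j, w j < d) {ϑ r : ℝ} (hr : 0 < r)
    (hϑ : |ϑ - Real.pi / d| < Real.pi * (d - ∑ j, (w j : ℝ)) / (2 * d)) :
    (r : ℂ) * cexp (ϑ * I) ∈ goodSector w d := by
  have hd : 0 < d := by omega
  have hdr : (0 : ℝ) < d := Nat.cast_pos.2 hd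
  have hpi := Real.pi_pos
  obtain ⟨h1, h2⟩ := abs_lt.1 hϑ
  have hs : (0 : ℝ) ≤ ∑ j, (w j : ℝ) := Finset.sum_nonneg fun j _ => Nat.cast_nonneg _
  set s : ℝ := ∑ j, (w j : ℝ) with hsdef
  have e1 : Real.pi * (2 - (d - s)) / (2 * d) = Real.pi / d - Real.pi * (d - s) / (2 * d) := by
    field_simp
  have e2 : Real.pi * (2 + (d - s)) / (2 * d) = Real.pi / d + Real.pi * (d - s) / (2 * d) := by
    field_simp
  have hd1 : (1 : ℝ) ≤ d := by exact_mod_cast hd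
  have h3 : Real.pi * (d - s) / (2 * d) ≤ Real.pi / 2 := by
    rw [div_le_div_iff₀ (by positivity) two_pos]
    nlinarith
  have h4 : 0 < Real.pi / d := by positivity
  have h5 : ϑ ≤ Real.pi := by
    have hd2 : (2 : ℝ) ≤ d := by exact_mod_cast (by omega : 2 ≤ d)
    have : Real.pi / d ≤ Real.pi / 2 := div_le_div_of_nonneg_left hpi.le two_pos hd2
    linarith
  have harg : ((r : ℂ) * cexp (ϑ * I)).arg = ϑ := by
    rw [exp_mul_I]
    exact arg_mul_cos_add_sin_mul_I hr ⟨by linarith, h5⟩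
  refine ⟨mul_ne_zero (ofReal_ne_zero.2 hr.ne') (exp_ne_zero _), ?_, ?_⟩
  · rw [harg, e1]; linarith
  · rw [harg, e2]; linarith

lemma tendsto_ray (hw0 : 0 < ∑ j, w j) (hκ : ∑ j, w j < d) {ϑ : ℝ}
    (hϑ : |ϑ - Real.pi / d| < Real.pi * (d - ∑ j, (w j : ℝ)) / (2 * d)) :
    Tendsto (fun r : ℝ => cexp (ϑ * I) * (r : ℂ)) atTop (atInftyFrom (goodSector w d)) := by
  refine tendsto_inf.2 ⟨?_, tendsto_principal.2 ?_⟩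
  · rw [← tendsto_norm_atTop_iff_cobounded]
    refine tendsto_id.congr' ?_
    filter_upwards [eventually_ge_atTop 0] with r hr
    rw [norm_mul, norm_exp_ofReal_mul_I, one_mul, norm_real, Real.norm_of_nonneg hr, id]
  · filter_upwards [eventually_gt_atTop 0] with r hr
    rw [mul_comm]
    exact ofReal_mul_cexp_mem_goodSector hw0 hκ hr hϑ

lemma neBot_atInftyFrom_goodSector (hw0 : 0 < ∑ j, w j) (hκ : ∑ j, w j < d) :
    (atInftyFrom (goodSector w d)).NeBot := by
  have hdr : (0 : ℝ) < d := Nat.cast_pos.2 (by omega)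
  have hκr : (∑ j, (w j : ℝ)) < d := by exact_mod_cast hκ
  refine (tendsto_ray hw0 hκ (ϑ := Real.pi / d) ?_).neBot
  rw [sub_self, abs_zero]
  have := sub_pos.2 hκr
  have := Real.pi_pos
  positivity

/-- The part of the term of index `n` of the Gromov–Witten `I`-function which does not depend
on `q`. -/
def gwSeries (w : Fin N → ℕ) (d : ℕ) (n : ℚ) : PowerSeries ℂ :=
  hyperFactor d (n * d) 1 * (∏ j, hyperFactor (w j) (n * w j) 1)⁻¹

/-- The coefficient of `P ^ r` in `exp (-d X P) * gwSeries w d n`, as a polynomial in `X`. -/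
def gwPoly (w : Fin N → ℕ) (d : ℕ) (n : ℚ) (r : ℕ) : Polynomial ℂ :=
  ∑ ij ∈ Finset.HasAntidiagonal.antidiagonal r, Polynomial.C ((-(d : ℂ)) ^ ij.1 / (ij.1 ! : ℂ) *
    PowerSeries.coeff ij.2 (gwSeries w d n)) * Polynomial.X ^ ij.1

lemma constantCoeff_hyperFactor_ne_zero (c : ℕ) (x : ℚ) :
    PowerSeries.constantCoeff (hyperFactor c x 1) ≠ 0 := by
  rw [← taylor_hyperEval, ← PowerSeries.coeff_zero_eq_constantCoeff_apply, coeff_taylor]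
  simpa using hyperEval_zero_ne_zero c x

lemma coeff_zero_gwSeries_ne_zero (w : Fin N → ℕ) (d : ℕ) (n : ℚ) :
    PowerSeries.coeff 0 (gwSeries w d n) ≠ 0 := by
  rw [PowerSeries.coeff_zero_eq_constantCoeff_apply]
  unfold gwSeries
  rw [map_mul, PowerSeries.constantCoeff_inv, map_prod]
  exact mul_ne_zero (constantCoeff_hyperFactor_ne_zero _ _)
    (inv_ne_zero (Finset.prod_ne_zero_iff.2 fun j _ => constantCoeff_hyperFactor_ne_zero _ _))

/-- The constant coefficient of the hypergeometric factor does not vanish, so that the power of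
`log t` coming from `q ^ P` survives. -/
lemma degree_gwPoly (hd : 0 < d) (n : ℚ) (r : ℕ) : (gwPoly w d n r).degree = r := by
  refine Polynomial.degree_eq_of_le_of_coeff_ne_zero ?_ ?_
  · refine (Polynomial.degree_sum_le _ _).trans (Finset.sup_le fun ij hij => ?_)
    refine (Polynomial.degree_C_mul_X_pow_le _ _).trans ?_
    have := Finset.HasAntidiagonal.mem_antidiagonal.1 hij
    exact_mod_cast (by omega : ij.1 ≤ r)
  · unfold gwPoly
    rw [Polynomial.finsetSum_coeff, Finset.sum_eq_single (r, 0)]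
    · rw [Polynomial.coeff_C_mul_X_pow, if_pos rfl]
      refine mul_ne_zero (div_ne_zero (pow_ne_zero _ (neg_ne_zero.2 (Nat.cast_ne_zero.2 hd.ne'))) ?_)
        (coeff_zero_gwSeries_ne_zero w d n)
      exact Nat.cast_ne_zero.2 (Nat.factorial_ne_zero r)
    · intro ij hij hne
      rw [Polynomial.coeff_C_mul_X_pow, if_neg]
      rintro rfl
      apply hne
      have := Finset.HasAntidiagonal.mem_antidiagonal.1 hij
      ext
      · rfl
      · simp only; omega
    · intro h
      simp at h

lemma gwTerm_apply_eq_eval (hd : 0 < d) (W : MvPolynomial (Fin N) ℂ) {t : ℂ} (ht : t ≠ 0) (m : ℕ)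
    (p : AmbientIndex w W) :
    gwTerm w d W (-(d : ℂ) * log t) 1 ((m : ℚ) / d) p =
      if p.1.1 = Int.fract (-((m : ℚ) / d)) then
        (t ^ m)⁻¹ * (gwPoly w d ((m : ℚ) / d) p.2).eval (log t) else 0 := by
  have hdc : (d : ℂ) ≠ 0 := Nat.cast_ne_zero.2 hd.ne'
  unfold gwTerm ambientClass
  refine if_congr Iff.rfl ?_ rfl
  have h1 : 1 * cexp (((m : ℚ) / d : ℚ) * (-(d : ℂ) * log t)) = (t ^ m)⁻¹ := by
    rw [one_mul]
    have : (((m : ℚ) / d : ℚ) : ℂ) * (-(d : ℂ) * log t) = -(m * log t) := by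
      push_cast; field_simp
    rw [this, Complex.exp_neg, exp_nat_mul, exp_log ht]
  rw [h1, mul_assoc, mul_assoc, PowerSeries.coeff_C_mul]
  congr 1
  unfold gwPoly
  rw [PowerSeries.coeff_mul, Polynomial.eval_finsetSum]
  refine Finset.sum_congr rfl fun ij _ => ?_
  rw [Polynomial.eval_C_mul, Polynomial.eval_pow, Polynomial.eval_X, expSeries, PowerSeries.coeff_mk,
    div_one, mul_pow, gwSeries]
  ring

/-- The terms of the Gromov–Witten `I`-function span: a linear form all of whose asymptotic
expansions vanish is zero. -/
lemma linearForm_eq_zero_of_isLittleO (hd : 0 < d) {W : MvPolynomial (Fin N) ℂ} {l : Filter ℂ}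
    [l.NeBot] (hl : Tendsto (fun t : ℂ => ‖t‖) l atTop)
    (hA : ∀ p : AmbientIndex w W, ∃ a : ℕ, p.1.1 = Int.fract (-((a : ℚ) / d)))
    (α : AmbientSpace w W →ₗ[ℂ] ℂ)
    (h : ∀ m : ℕ, (fun t => ∑ i ∈ Finset.range (m + 1),
      α (gwTerm w d W (-(d : ℂ) * log t) 1 ((i : ℚ) / (d : ℚ)))) =o[l] fun t => (t ^ m)⁻¹) :
    α = 0 := by
  classical
  set c : AmbientIndex w W → ℂ := fun p => α fun j => if p = j then 1 else 0 with hc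
  have hα : ∀ x, α x = ∑ p, x p * c p := fun x => by
    rw [LinearMap.pi_apply_eq_sum_univ]; rfl
  set Q : ℕ → Polynomial ℂ := fun m => ∑ p : AmbientIndex w W,
    if p.1.1 = Int.fract (-((m : ℚ) / d)) then
      Polynomial.C (c p) * gwPoly w d ((m : ℚ) / d) p.2 else 0 with hQ
  have hterm : ∀ (m : ℕ) (t : ℂ), t ≠ 0 →
      α (gwTerm w d W (-(d : ℂ) * log t) 1 ((m : ℚ) / (d : ℚ))) =
        (t ^ m)⁻¹ * (Q m).eval (log t) := by
    intro m t ht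
    rw [hα, hQ, Polynomial.eval_finsetSum, Finset.mul_sum]
    refine Finset.sum_congr rfl fun p _ => ?_
    rw [gwTerm_apply_eq_eval hd W ht]
    split_ifs
    · rw [Polynomial.eval_C_mul]; ring
    · simp
  have hne : ∀ᶠ t : ℂ in l, t ≠ 0 := by
    filter_upwards [hl.eventually_gt_atTop 0] with t ht
    exact norm_pos_iff.1 ht
  have hlog : Tendsto (fun t : ℂ => ‖log t‖) l atTop := by
    refine tendsto_atTop_mono (fun t => ?_) (Real.tendsto_log_atTop.comp hl)
    rw [Function.comp_apply, ← log_re]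
    exact re_le_norm _
  have hQ0 : ∀ m, Q m = 0 := by
    intro m
    induction m using Nat.strong_induction_on with
    | _ m ih =>
      have h1 : (fun t => (t ^ m)⁻¹ * (Q m).eval (log t)) =o[l] fun t : ℂ => (t ^ m)⁻¹ := by
        refine (h m).congr' ?_ EventuallyEq.rfl
        filter_upwards [hne] with t ht
        rw [Finset.sum_range_succ, Finset.sum_eq_zero, zero_add, hterm m t ht]
        intro i hi
        rw [hterm i t ht, ih i (Finset.mem_range.1 hi), Polynomial.eval_zero, mul_zero]
      have h2 : Tendsto (fun t => (Q m).eval (log t)) l (𝓝 0) := by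
        rw [← Asymptotics.isLittleO_one_iff ℂ]
        refine (h1.mul_isBigO (Asymptotics.isBigO_refl (fun t : ℂ => t ^ m) l)).congr' ?_ ?_
        · filter_upwards [hne] with t ht
          have := pow_ne_zero m ht
          field_simp
        · filter_upwards [hne] with t ht
          exact inv_mul_cancel₀ (pow_ne_zero m ht)
      rcases le_or_gt (Q m).degree 0 with hdeg | hdeg
      · rw [Polynomial.eq_C_of_degree_le_zero hdeg] at h2 ⊢
        simp only [Polynomial.eval_C] at h2
        rw [tendsto_nhds_unique h2 tendsto_const_nhds |>.symm, Polynomial.C_0]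
      · exact absurd h2.norm (not_tendsto_nhds_of_tendsto_atTop
          (Polynomial.tendsto_norm_atTop (Q m) hdeg hlog) _)
  have hc0 : ∀ p, c p = 0 := by
    rintro ⟨f, r⟩
    obtain ⟨a, ha⟩ := hA ⟨f, r⟩
    have hQa := hQ0 a
    simp only [hQ] at hQa
    rw [Fintype.sum_sigma, Finset.sum_eq_single f] at hQa
    · set S : Polynomial.Sequence ℂ := ⟨gwPoly w d ((a : ℚ) / d), degree_gwPoly hd _⟩ with hS
      have hlin := S.linearIndependent.comp (fun r : Fin (ambientLength w W f.1) => (r : ℕ))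
        Fin.val_injective
      refine Fintype.linearIndependent_iff.1 hlin (fun r => c ⟨f, r⟩) ?_ r
      rw [← hQa]
      refine Finset.sum_congr rfl fun r' _ => ?_
      rw [if_pos ha, ← Polynomial.smul_eq_C_mul]
      rfl
    · intro g _ hg
      refine Finset.sum_eq_zero fun r' _ => if_neg fun hga => hg ?_
      exact Subtype.ext (hga.trans ha.symm)
    · intro hf
      exact absurd (Finset.mem_univ f) hf
  refine LinearMap.ext fun x => ?_
  rw [hα]
  simp [hc0]

lemma HasAsymptoticExpansion.linearMap_comp {E E' : Type*} [NormedAddCommGroup E]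
    [NormedSpace ℂ E] [FiniteDimensional ℂ E] [NormedAddCommGroup E'] [NormedSpace ℂ E']
    {l : Filter ℂ} {ψ : ℕ → ℂ → ℂ} {G : ℂ → E} {term : ℕ → ℂ → E}
    (h : HasAsymptoticExpansion l ψ G term) (B : E →ₗ[ℂ] E') :
    HasAsymptoticExpansion l ψ (fun t => B (G t)) (fun m t => B (term m t)) := by
  refine ⟨h.1, fun m => ?_⟩
  have h1 := (LinearMap.toContinuousLinearMap B).isBigO_comp
    (fun t => G t - ∑ i ∈ Finset.range (m + 1), term i t) l
  refine (h1.trans_isLittleO (h.2 m)).congr_left fun t => ?_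
  simp only [LinearMap.coe_toContinuousLinearMap', map_sub, map_sum]

end Independence

/-! ### The kernel of the connection map -/

section Kernel

variable {N : ℕ} {w : Fin N → ℕ} {d K : ℕ}

instance : DecidableEq (Nar w d) := inferInstanceAs (DecidableEq (Subtype _))

/-- The vector of the directions of the terms of the FJRW `I`-function along the ray of argument
`θ = (2 (i + 1) - κ) π / d`, for which all terms of a sector have the same argument. -/
def relationVector (w : Fin N → ℕ) (d K i : ℕ) : NarrowSpace w d := fun k =>
  fjrwPhase w d k.1 * cexp (((2 * (i + 1) - K) * Real.pi / d : ℝ) * (k.1 + 1 : ℕ) * I)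

lemma map_smallIFJRW_apply (hd : 0 < d) {W : MvPolynomial (Fin N) ℂ}
    (L : NarrowSpace w d →ₗ[ℂ] AmbientSpace w W) (t : ℂ) (p : AmbientIndex w W) :
    L (smallIFJRW w d t (-1)) p = narrowSeries w d
      (fun k => L (Pi.single k 1) p * fjrwPhase w d k.1) t := by
  have h : L (smallIFJRW w d t (-1)) = ∑ k, smallIFJRW w d t (-1) k • L (Pi.single k 1) := by
    conv_lhs => rw [pi_eq_sum_univ' (smallIFJRW w d t (-1))]
    rw [map_sum]
    refine Finset.sum_congr rfl fun k _ => ?_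
    rw [map_smul]
  rw [h, Finset.sum_apply]
  refine Finset.sum_congr rfl fun k _ => ?_
  rw [Pi.smul_apply, smul_eq_mul, smallIFJRW]
  simp only [fjrwTerm_eq hd]
  rw [tsum_mul_left]
  ring

/-- A linear map which turns the FJRW `I`-function into an expansion of power type annihilates the
vectors of all directions which can be reached from the sector. -/
lemma map_relationVector_eq_zero (hw : ∀ j, 0 < w j) (hw0 : 0 < ∑ j, w j) (hK : 0 < K)
    (hsum : ∑ j, w j + K = d) {W : MvPolynomial (Fin N) ℂ}
    (L : NarrowSpace w d →ₗ[ℂ] AmbientSpace w W)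
    (hL : HasAsymptoticExpansion (atInftyFrom (goodSector w d)) (fun m t => (t ^ m)⁻¹)
      (fun t => L (smallIFJRW w d t (-1)))
      (fun m t => gwTerm w d W (-(d : ℂ) * log t) 1 ((m : ℚ) / (d : ℚ)))) {i : ℕ} (hi : i < K) :
    L (relationVector w d K i) = 0 := by
  have hd : 0 < d := by omega
  have hκ : ∑ j, w j < d := by omega
  have hdr : (0 : ℝ) < d := Nat.cast_pos.2 hd
  have hKr : (0 : ℝ) < K := Nat.cast_pos.2 hK
  have hpi := Real.pi_pos
  have hwd : ∀ j, w j ≤ d := fun j =>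
    (Finset.single_le_sum (fun i _ => Nat.zero_le (w i)) (Finset.mem_univ j)).trans hκ.le
  have hKsum : (d : ℝ) - ∑ j, (w j : ℝ) = K := by
    have : (∑ j, (w j : ℝ)) + K = d := by exact_mod_cast hsum
    linarith
  funext p
  set θ : ℝ := (2 * (i + 1) - K) * Real.pi / d with hθ
  -- half way between the axis of the sector and the direction `θ`
  set ϑ : ℝ := Real.pi / d + (θ - Real.pi / d) / 2 with hϑ
  have hi' : (i : ℝ) + 1 ≤ K := by exact_mod_cast hi
  have hi0 : (0 : ℝ) ≤ i := Nat.cast_nonneg i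
  have habs : |θ - Real.pi / d| < Real.pi * K / d := by
    have e : θ - Real.pi / d = (2 * i + 1 - K) * Real.pi / d := by rw [hθ]; field_simp; ring
    rw [e, abs_div, abs_mul, abs_of_pos hpi, abs_of_pos hdr, mul_comm]
    gcongr
    rw [abs_lt]
    constructor <;> linarith
  have hmem : |ϑ - Real.pi / d| < Real.pi * (d - ∑ j, (w j : ℝ)) / (2 * d) := by
    rw [hKsum]
    have e : ϑ - Real.pi / d = (θ - Real.pi / d) / 2 := by rw [hϑ]; ring
    rw [e, abs_div, abs_of_pos (two_pos : (0 : ℝ) < 2)]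
    calc |θ - Real.pi / d| / 2 < Real.pi * K / d / 2 := by gcongr
      _ = _ := by field_simp
  have hdist : |ϑ - θ| * d / K < Real.pi / 2 := by
    have e : ϑ - θ = -((θ - Real.pi / d) / 2) := by rw [hϑ]; ring
    rw [e, abs_neg, abs_div, abs_of_pos (two_pos : (0 : ℝ) < 2)]
    calc |θ - Real.pi / d| / 2 * d / K < Real.pi * K / d / 2 * d / K := by gcongr
      _ = _ := by field_simp
  have hphase : (-1) ^ (d + ∑ j, w j) * cexp (θ * d * I) = 1 := by
    have e : (θ : ℂ) * d * I = ((2 * (i + 1) - K : ℤ) : ℂ) * (Real.pi * I) := by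
      have hdc : (d : ℂ) ≠ 0 := Nat.cast_ne_zero.2 hd.ne'
      rw [hθ]; push_cast; field_simp
    rw [e, Complex.exp_int_mul, exp_pi_mul_I, ← zpow_natCast, ← zpow_add₀ (by simp)]
    have e2 : ((d + ∑ j, w j : ℕ) : ℤ) + (2 * (i + 1) - K) = 2 * (∑ j, w j + i + 1 : ℕ) := by
      rw [← hsum]; push_cast; ring
    rw [e2, zpow_mul]
    simp
  obtain ⟨C, hC⟩ := exists_norm_circleCoeff_gwEval_le hd hwd (p.2 : ℕ) 0
  have hray := tendsto_ray hw0 hκ hmem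
  have h0 := ((Asymptotics.isLittleO_pi.1 (hL.2 0) p).comp_tendsto hray).def one_pos
  obtain ⟨R, hR⟩ := eventually_atTop.1 (h0.and (eventually_ge_atTop 1))
  have hgrowth : ∀ r : ℝ, R ≤ r → ‖narrowSeries w d
      (fun k => L (Pi.single k 1) p * fjrwPhase w d k.1) (cexp (ϑ * I) * r)‖ ≤ (1 + |C|) * r := by
    intro r hr
    obtain ⟨h1, h2⟩ := hR r hr
    have hn : ‖cexp (ϑ * I) * (r : ℂ)‖ = r := by
      rw [norm_mul, norm_exp_ofReal_mul_I, one_mul, norm_real, Real.norm_of_nonneg (by linarith)]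
    set t := cexp (ϑ * I) * (r : ℂ) with ht
    simp only [Function.comp_apply, pow_zero, inv_one, norm_one, mul_one, zero_add,
      Finset.sum_range_one, Pi.sub_apply] at h1
    rw [← ht, map_smallIFJRW_apply hd] at h1
    have h3 : ‖gwTerm w d W (-(d : ℂ) * log t) 1 ((0 : ℕ) / (d : ℚ)) p‖ ≤ |C| * r := by
      rw [gwTerm_apply_eq hd hwd]
      split_ifs
      · refine (hC t (by rw [hn]; exact h2)).trans ?_
        rw [hn]
        have h4 : r ^ (1 / 4 - (0 : ℕ) : ℝ) ≤ r := by
          calc r ^ (1 / 4 - (0 : ℕ) : ℝ) ≤ r ^ (1 : ℝ) :=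
                Real.rpow_le_rpow_of_exponent_le h2 (by norm_num)
            _ = r := Real.rpow_one r
        have h5 : 0 ≤ r ^ (1 / 4 - (0 : ℕ) : ℝ) := Real.rpow_nonneg (by linarith) _
        exact mul_le_mul (le_abs_self C) h4 h5 (abs_nonneg C)
      · rw [norm_zero]; positivity
    have h6 := norm_le_norm_add_norm_sub' (narrowSeries w d
      (fun k => L (Pi.single k 1) p * fjrwPhase w d k.1) t)
      (gwTerm w d W (-(d : ℂ) * log t) 1 ((0 : ℕ) / (d : ℚ)) p)
    nlinarith
  have hrel := sum_mul_cexp_eq_zero hd hw hK hsum _ hgrowth hphase hdist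
  have h : L (relationVector w d K i) = ∑ k, relationVector w d K i k • L (Pi.single k 1) := by
    conv_lhs => rw [pi_eq_sum_univ' (relationVector w d K i)]
    rw [map_sum]
    refine Finset.sum_congr rfl fun k _ => ?_
    rw [map_smul]
  rw [h, Finset.sum_apply, Pi.zero_apply, ← hrel]
  refine Finset.sum_congr rfl fun k _ => ?_
  rw [Pi.smul_apply, smul_eq_mul, relationVector, ← hθ]
  ring

/-- The directions are the columns of a Vandermonde matrix. -/
lemma linearIndependent_relationVector (hd : 0 < d) (hw : ∀ j, 0 < w j)
    (hcard : K ≤ Fintype.card (Nar w d)) :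
    LinearIndependent ℂ fun i : Fin K => relationVector w d K i := by
  have hdc : (d : ℂ) ≠ 0 := Nat.cast_ne_zero.2 hd.ne'
  rw [Fintype.linearIndependent_iff]
  intro c hc
  set Q : Polynomial ℂ := ∑ i : Fin K, Polynomial.C (c i) * Polynomial.X ^ (i : ℕ) with hQ
  set ζ : Nar w d → ℂ := fun k => cexp (2 * Real.pi * I * ((k.1 + 1 : ℕ) / d)) with hζ
  have hinj : Function.Injective ζ := by
    intro k l h
    obtain ⟨n, hn⟩ := Complex.exp_eq_exp_iff_exists_int.1 h
    have h1 : (2 * Real.pi * I) * ((k.1 : ℕ) - (l.1 : ℕ) - n * d : ℂ) = 0 := by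
      push_cast at hn
      field_simp at hn
      linear_combination (2 * Real.pi * I) * hn
    have h2 := (mul_eq_zero.1 h1).resolve_left two_pi_I_ne_zero
    have h3 : ((k.1 : ℕ) : ℤ) - (l.1 : ℕ) = d * n := by
      have : ((k.1 : ℕ) : ℂ) - (l.1 : ℕ) = d * n := by linear_combination h2
      exact_mod_cast this
    have h4 : ((k.1 : ℕ) : ℤ) - (l.1 : ℕ) = 0 := by
      apply Int.eq_zero_of_abs_lt_dvd (m := d) ⟨_, h3⟩
      have := k.1.2
      have := l.1.2
      rw [abs_lt]
      omega
    exact Subtype.ext (Fin.ext (by omega))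
  have heval : ∀ k, Q.eval (ζ k) = 0 := by
    intro k
    have h1 := congrFun hc k
    rw [Finset.sum_apply, Pi.zero_apply] at h1
    have h2 : ∀ i : Fin K, (c i • relationVector w d K i) k =
        fjrwPhase w d k.1 * cexp (((2 - K) * Real.pi / d : ℝ) * (k.1 + 1 : ℕ) * I) *
          (c i * ζ k ^ (i : ℕ)) := by
      intro i
      rw [Pi.smul_apply, smul_eq_mul, relationVector]
      simp only [hζ]
      rw [← exp_nat_mul]
      have e : (((2 * ((i : ℕ) + 1) - K) * Real.pi / d : ℝ) : ℂ) * (k.1 + 1 : ℕ) * I =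
          (((2 - K) * Real.pi / d : ℝ) : ℂ) * (k.1 + 1 : ℕ) * I +
            (i : ℕ) * (2 * Real.pi * I * ((k.1 + 1 : ℕ) / d)) := by
        push_cast; field_simp; ring
      rw [e, Complex.exp_add]
      ring
    simp only [h2] at h1
    rw [← Finset.mul_sum] at h1
    rw [hQ, Polynomial.eval_finsetSum]
    simp only [Polynomial.eval_C_mul, Polynomial.eval_pow, Polynomial.eval_X]
    exact (mul_eq_zero.1 h1).resolve_left
      (mul_ne_zero (fjrwPhase_ne_zero hd hw _) (exp_ne_zero _))
  intro i
  have hcoeff : Q.coeff i = c i := by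
    rw [hQ, Polynomial.finsetSum_coeff, Finset.sum_eq_single i]
    · rw [Polynomial.coeff_C_mul_X_pow, if_pos rfl]
    · intro j _ hj
      rw [Polynomial.coeff_C_mul_X_pow, if_neg fun h => hj (Fin.ext h.symm)]
    · intro h
      exact absurd (Finset.mem_univ i) h
  have hdeg : Q.natDegree < Fintype.card (Nar w d) := by
    have hK : 0 < K := i.pos
    have h1 : Q.natDegree ≤ K - 1 := by
      refine Polynomial.natDegree_sum_le_of_forall_le _ _ fun j _ => ?_
      refine (Polynomial.natDegree_C_mul_X_pow_le _ _).trans ?_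
      have := j.2
      omega
    omega
  rw [← hcoeff, Polynomial.eq_zero_of_natDegree_lt_card_of_eval_eq_zero Q hinj heval hdeg,
    Polynomial.coeff_zero]

end Kernel

/-! ### Existence and uniqueness of the connection map -/

section Main

variable {N : ℕ} {w : Fin N → ℕ} {d K : ℕ}

/-- A linear map which intertwines the `I`-functions is surjective, since a linear form which
vanishes on its range vanishes on all terms of the Gromov–Witten `I`-function. -/
lemma range_eq_top_of_hasAsymptoticExpansion (hd : 0 < d) {W : MvPolynomial (Fin N) ℂ}
    {l : Filter ℂ} [l.NeBot] (hl : Tendsto (fun t : ℂ => ‖t‖) l atTop)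
    (hA : ∀ p : AmbientIndex w W, ∃ a : ℕ, p.1.1 = Int.fract (-((a : ℚ) / d)))
    (L : NarrowSpace w d →ₗ[ℂ] AmbientSpace w W)
    (hL : HasAsymptoticExpansion l (fun m t => (t ^ m)⁻¹)
      (fun t => L (smallIFJRW w d t (-1)))
      (fun m t => gwTerm w d W (-(d : ℂ) * log t) 1 ((m : ℚ) / (d : ℚ)))) :
    LinearMap.range L = ⊤ := by
  by_contra hne
  obtain ⟨α, hα, hle⟩ := Submodule.exists_le_ker_of_lt_top _ (lt_top_iff_ne_top.2 hne)
  refine hα (linearForm_eq_zero_of_isLittleO hd hl hA α fun m => ?_)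
  refine ((hL.linearMap_comp α).2 m).neg_left.congr_left fun t => ?_
  have : α (L (smallIFJRW w d t (-1))) = 0 := LinearMap.mem_ker.1 (hle ⟨_, rfl⟩)
  simp only [this, zero_sub, neg_neg]

/-- The kernel of a surjective linear map which intertwines the `I`-functions is spanned by the
relation vectors, by a comparison of dimensions. -/
lemma ker_le_ker_of_relationVector (hd : 0 < d) (hw : ∀ j, 0 < w j) {W : MvPolynomial (Fin N) ℂ}
    (hcard : Fintype.card (Nar w d) = Module.finrank ℂ (AmbientSpace w W) + K)
    {L B : NarrowSpace w d →ₗ[ℂ] AmbientSpace w W} (hL : LinearMap.range L = ⊤)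
    (hLv : ∀ i < K, L (relationVector w d K i) = 0)
    (hBv : ∀ i < K, B (relationVector w d K i) = 0) : LinearMap.ker L ≤ LinearMap.ker B := by
  have hlin := linearIndependent_relationVector (w := w) (K := K) hd hw (by omega)
  have hspan : Submodule.span ℂ (range fun i : Fin K => relationVector w d K i) =
      LinearMap.ker L := by
    refine Submodule.eq_of_le_of_finrank_eq ?_ ?_
    · rw [Submodule.span_le]
      rintro _ ⟨i, rfl⟩
      exact hLv i i.2
    · rw [finrank_span_eq_card hlin, Fintype.card_fin]
      have h1 := LinearMap.finrank_range_add_finrank_ker L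
      rw [hL, finrank_top, Module.finrank_fintype_fun_eq_card ℂ (η := Nar w d), hcard] at h1
      omega
  rw [← hspan, Submodule.span_le]
  rintro _ ⟨i, rfl⟩
  exact hBv i i.2

/-- Two linear maps which intertwine the `I`-functions agree: their difference factors through the
first one and annihilates all terms of the Gromov–Witten `I`-function. -/
lemma eq_of_hasAsymptoticExpansion (hw : ∀ j, 0 < w j) (hw0 : 0 < ∑ j, w j) (hK : 0 < K)
    (hsum : ∑ j, w j + K = d) {W : MvPolynomial (Fin N) ℂ}
    (hA : ∀ p : AmbientIndex w W, ∃ a : ℕ, p.1.1 = Int.fract (-((a : ℚ) / d)))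
    (hcard : Fintype.card (Nar w d) = Module.finrank ℂ (AmbientSpace w W) + K)
    {L L' : NarrowSpace w d →ₗ[ℂ] AmbientSpace w W}
    (hL : HasAsymptoticExpansion (atInftyFrom (goodSector w d)) (fun m t => (t ^ m)⁻¹)
      (fun t => L (smallIFJRW w d t (-1)))
      (fun m t => gwTerm w d W (-(d : ℂ) * log t) 1 ((m : ℚ) / (d : ℚ))))
    (hL' : HasAsymptoticExpansion (atInftyFrom (goodSector w d)) (fun m t => (t ^ m)⁻¹)
      (fun t => L' (smallIFJRW w d t (-1)))
      (fun m t => gwTerm w d W (-(d : ℂ) * log t) 1 ((m : ℚ) / (d : ℚ)))) :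
    L' = L := by
  have hd : 0 < d := by omega
  have := neBot_atInftyFrom_goodSector hw0 (by omega : ∑ j, w j < d)
  have hl := tendsto_norm_atInftyFrom (goodSector w d)
  have hrange := range_eq_top_of_hasAsymptoticExpansion hd hl hA L hL
  have hv : ∀ i < K, L (relationVector w d K i) = 0 := fun i hi =>
    map_relationVector_eq_zero hw hw0 hK hsum L hL hi
  have hv' : ∀ i < K, (L' - L) (relationVector w d K i) = 0 := fun i hi => by
    rw [LinearMap.sub_apply, hv i hi, map_relationVector_eq_zero hw hw0 hK hsum L' hL' hi, sub_zero]
  have hker := ker_le_ker_of_relationVector hd hw hcard hrange hv hv'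
  obtain ⟨s, hs⟩ := L.exists_rightInverse_of_surjective hrange
  set B : AmbientSpace w W →ₗ[ℂ] AmbientSpace w W := (L' - L).comp s with hB
  have hfac : ∀ x, B (L x) = L' x - L x := by
    intro x
    have h1 : s (L x) - x ∈ LinearMap.ker L := by
      rw [LinearMap.mem_ker, map_sub]
      have := LinearMap.congr_fun hs (L x)
      rw [LinearMap.comp_apply, LinearMap.id_apply] at this
      rw [this, sub_self]
    have h2 := LinearMap.mem_ker.1 (hker h1)
    rw [map_sub, sub_eq_zero] at h2
    rw [hB, LinearMap.comp_apply, h2, LinearMap.sub_apply]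
  have hB0 : ∀ p, (LinearMap.proj p).comp B = 0 := by
    intro p
    refine linearForm_eq_zero_of_isLittleO hd hl hA _ fun m => ?_
    have h1 := (hL.linearMap_comp ((LinearMap.proj p).comp B)).2 m
    have h2 := (hL'.linearMap_comp (LinearMap.proj p)).2 m
    have h3 := (hL.linearMap_comp (LinearMap.proj p)).2 m
    refine ((h2.sub h3).sub h1).congr_left fun t => ?_
    simp only [LinearMap.comp_apply, hfac, map_sub]
    ring
  refine sub_eq_zero.1 (LinearMap.ext fun x => ?_)
  rw [LinearMap.sub_apply, ← hfac, LinearMap.zero_apply]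
  funext p
  exact LinearMap.congr_fun (hB0 p) (L x)

end Main

end LGGeneralType

end

theorem theorem1p5 {N : ℕ} (w : Fin N → ℕ) (d : ℕ) (W : MvPolynomial (Fin N) ℂ)
    (hw : ∀ j, 0 < w j) (hgcd : Finset.univ.gcd w = 1)
    (hW : LGGeneralType.IsNondegenerate w d W)
    (hGorenstein : ∀ j, w j ∣ d)
    (hκ : 0 < LGGeneralType.canonicalIndex w d) :
    -- the series defining the FJRW `I`-function at `z = -1` converges for every `t`
    (∀ (t : ℂ) (k : LGGeneralType.Nar w d),
      Summable fun l : ℕ => LGGeneralType.fjrwTerm w d t (-1) (k.1 : ℕ) l) ∧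
    ∃ a b : ℝ, -Real.pi ≤ a ∧ a < b ∧ b ≤ Real.pi ∧
      ∃! L : LGGeneralType.NarrowSpace w d →ₗ[ℂ] LGGeneralType.AmbientSpace w W,
        Module.finrank ℂ (LinearMap.range L) =
            Module.finrank ℂ (LGGeneralType.AmbientSpace w W) ∧
          -- the terms of the GW `I`-function at `q = t ^ (-d)`, `z = 1` are those with
          -- `n = m / d` (as `w j ∣ d`), of size `t ^ (-m)` up to powers of `log t`
          LGGeneralType.HasAsymptoticExpansion
            (LGGeneralType.atInftyFrom (LGGeneralType.sector a b))
            (fun m t => (t ^ m)⁻¹)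
            (fun t => L (LGGeneralType.smallIFJRW w d t (-1)))
            (fun m t => LGGeneralType.gwTerm w d W (-(d : ℂ) * Complex.log t) 1
              ((m : ℚ) / (d : ℚ))) := by
  have hκ' : ∑ j, w j < d := by
    unfold LGGeneralType.canonicalIndex at hκ
    have : ((∑ j, w j : ℕ) : ℤ) < d := by push_cast; linarith
    exact_mod_cast this
  have hd : 0 < d := by omega
  -- the weights have greatest common divisor one, so there is at least one of them
  have hw0 : 0 < ∑ j, w j := by
    rcases isEmpty_or_nonempty (Fin N) with hE | ⟨⟨j⟩⟩
    · rw [Finset.univ_eq_empty, Finset.gcd_empty] at hgcd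
      exact absurd hgcd zero_ne_one
    · exact (hw j).trans_le (Finset.single_le_sum (fun i _ => Nat.zero_le (w i)) (Finset.mem_univ j))
  obtain ⟨K, hsum⟩ := Nat.exists_eq_add_of_lt hκ'
  have hsum' : ∑ j, w j + (K + 1) = d := by omega
  have hdr : (0 : ℝ) < d := Nat.cast_pos.2 hd
  have hd1 : (1 : ℝ) ≤ d := by exact_mod_cast hd
  have hpi := Real.pi_pos
  have hκr : (∑ j, (w j : ℝ)) + 1 ≤ d := by exact_mod_cast hκ'
  have hw0r : (1 : ℝ) ≤ ∑ j, (w j : ℝ) := by exact_mod_cast hw0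
  refine ⟨fun t k => LGGeneralType.summable_fjrwTerm hd hw hκ' t k.1,
    Real.pi * (2 - (d - ∑ j, (w j : ℝ))) / (2 * d), Real.pi * (2 + (d - ∑ j, (w j : ℝ))) / (2 * d),
    ?_, ?_, ?_, ?_⟩
  · rw [le_div_iff₀ (by positivity)]
    nlinarith
  · apply div_lt_div_of_pos_right _ (by positivity)
    apply mul_lt_mul_of_pos_left _ hpi
    linarith
  · rw [div_le_iff₀ (by positivity)]
    nlinarith
  choose A hA hAf hAc using LGGeneralType.exists_sector_residue (W := W) hd hw hGorenstein hW
  have hexp := LGGeneralType.hasAsymptoticExpansion_connectionMap hw hκ' W A hA hAf hAc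
  have hA' : ∀ p : LGGeneralType.AmbientIndex w W, ∃ a : ℕ, p.1.1 = Int.fract (-((a : ℚ) / d)) :=
    fun p => ⟨A p, hAf p⟩
  have hcard := LGGeneralType.card_nar_eq hd hw hGorenstein hsum' hW
  have := LGGeneralType.neBot_atInftyFrom_goodSector hw0 hκ'
  refine ⟨LGGeneralType.connectionMap w d W A, ⟨?_, hexp⟩, ?_⟩
  · rw [LGGeneralType.range_eq_top_of_hasAsymptoticExpansion hd
      (LGGeneralType.tendsto_norm_atInftyFrom _) hA' _ hexp, finrank_top]
  · rintro L ⟨-, hL⟩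
    exact LGGeneralType.eq_of_hasAsymptoticExpansion hw hw0 (Nat.succ_pos K) hsum' hA' hcard hexp hL
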